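/- **Setting.** A finite two-player extensive-form game has horizon $H$, finite state set $\mathcal S=\bigsqcup_{h=1}^H\mathcal S_h$, action sets of sizes $A$ (Alice) and $B$ (Bob), an initial distribution $p_0$ on $\mathcal S_1$, transition probabilities $p(\cdot\mid s_h,a_h,b_h)$ on $\mathcal S_{h+1}$ for $h<H$, random costs $u(s,a,b)\in[-1,1]$ of Alice with mean $\bar u(s,a,b)$, and surjective infoset maps $x:\mathcal S\to\mathcal X$ (Alice, $|\mathcal X|=X$) and $y:\mathcal S\to\mathcal Y$ (Bob). The game is tree-structured (every state is reached by exactly one sequence of states and actions) and has perfect recall (states in the same infoset of a player lie in the same stage, and the player's infosets and actions on the paths to them agree). So every infoset of a player lies in one stage ($\mathcal X=\bigsqcup_h\mathcal X_h$) and, if $h>1$, has a unique predecessor pair. Alice's treeplex $\mathcal T$ is the set of $\mu\in\mathbb R^{X\cdot A}$ with $\mu\ge 0$ and $\sum_a\mu(x_h,a)=\mu(x_{h-1},a_{h-1})$, where $(x_{h-1},a_{h-1})$ is the predecessor pair of $x_h$ and $\mu(x_0,a_0):=1$; Bob's treeplex $\mathcal T'$ is analogous. For $\mu\in\mathcal T$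 let $\pi_\mu(a|x)=\mu(x,a)/\sum_{a'}\mu(x,a')$. If Bob plays $\nu\in\mathcal T'$, Alice's cost vector is $$c(x,a)=\sum_{s:\,x(s)=x}\sum_b p(s)\,\nu(y(s),b)\,\bar u(s,a,b),$$ where $p(s)$ is the product of $p_0$ and the transition probabilities along the path to $s$. **Algorithm.** Inputs: $T$, $\delta$, $\mu^c\in\mathcal T$, and an interval $[\ell,\ell+r]$, $r>0$, containing all costs of the game almost surely; the algorithm works with the normalised costs $\tilde u=(u-\ell)/r\in[0,1]$. Put $R=\delta^{-1}\sqrt{8XH^3\log(A)\,T}$, $\eta=\sqrt{\delta^2X\log(A)/(8H^2T)}$, $\tau=\sqrt{XA\log(A)/(H^3T)}$. Let $$D(\mu\|\mu')=\sum_{x,a}\mu(x,a)\log\frac{\pi_\mu(a|x)}{\pi_{\mu'}(a|x)},\qquad D^{\rm bal}(\mu\|\mu')=\sum_{h=1}^H\sum_{x_h\in\mathcal X_h,a}\frac{\mu(x_h,a)}{\mu^{h,\rm bal}(x_h,a)}\log\frac{\pi_\mu(a|x_h)}{\pi_{\mu'}(a|x_h)},$$ where $\mu^{h,\rm bal}\in\mathcal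 T$ is the strategy of the policy that, at an infoset of a stage before $h$, plays each action with probability proportional to the number of infosets of stage $h$ reachable through it, and plays uniformly from stage $h$ on. Start with $\hat\mu^1(x_h,a)=A^{-h}$, $\alpha=1/R$, $k=1$, $\mathrm{start}=1$. In each round $t=1,\dots,T$ Alice plays $\mu^t=\alpha\hat\mu^t+(1-\alpha)\mu^c$, Bob plays some $\nu^t\in\mathcal T'$ that may depend on the past, a trajectory is sampled from $\mu^t$ and $\nu^t$, and Alice observes her infosets, actions and costs $(x_h^t,a_h^t,u_h^t)_{h\le H}$. She forms $\hat c^t(x_h,a)=\mathbb 1\{(x_h^t,a_h^t)=(x_h,a)\}\,\tilde u_h^t/\mu^t(x_h,a)$. If $\alpha<1$ and $\max_{\mu\in\mathcal T}\sum_{j=\mathrm{start}}^t\langle\hat c^j,\mu^c-\mu\rangle>2R$, then $k\leftarrow k+1$, $\mathrm{start}\leftarrow t+1$, $\hat\mu^{t+1}(x_h,a)\leftarrow A^{-h}$, $\alpha\leftarrow\min\{2^{k-1}/R,1\}$. Otherwise $\hat\mu^{t+1}=\arg\min_{\mu\in\mathcal T}\big(\eta\langle\mu,\hat c^t\rangle+D(\mu\|\hat\mu^t)\big)$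 if $\alpha<1$, and $\hat\mu^{t+1}=\arg\min_{\mu\in\mathcal T}\big(\tau\langle\mu,\hat c^t\rangle+D^{\rm bal}(\mu\|\hat\mu^t)\big)$ if $\alpha=1$. **Theorem.** There are universal constants $C>0$ and $d\in\mathbb N$ such that the following holds for every such game, every $T$, every $\delta\in(0,1/A]$ and every $\mu^c\in\mathcal T$ with $\mu^c(x,a)\ge\delta$ for all $x,a$, against every Bob. Let $c^t$ be the cost vector induced by $\nu^t$ and $\mathcal R(\mu)=\sum_{t=1}^T\mathbb E[\langle\mu^t-\mu,c^t\rangle]$ (the expectations exist). Then $$\mathcal R(\mu^c)\le r\qquad\text{and}\qquad\max_{\mu\in\mathcal T}\mathcal R(\mu)\le r\cdot C\,\log^d\!\Big(2+\frac{XAHT}{\delta}\Big)\cdot\delta^{-1}\sqrt{XH^3T}.$$ In particular, if all costs lie in $[0,1]$, the algorithm run on the costs themselves ($\ell=0$, $r=1$) satisfies $\mathcal R(\mu^c)\le 1$ and $\max_{\mu\in\mathcal T}\mathcal R(\mu)\le\tilde O(\delta^{-1}\sqrt{XH^3T})$; for costs in $[-1,1]$ ($\ell=-1$, $r=2$) the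 same bounds hold for the regret measured in the normalised costs $(1+u)/2$. -/

import Mathlib

open MeasureTheory ProbabilityTheory
open scoped Classical

noncomputable section

/-- A finite two-player zero-sum extensive-form game with horizon `H`, `nS` states, `nX` infosets of
Alice, `nY` infosets of Bob, `A` actions of Alice and `B` actions of Bob.  Stages are numbered from
`0` to `H - 1`. -/
structure EFG (H nS nX nY A B : ℕ) where
  /-- the stage of a state -/
  stage : Fin nS → Fin H
  /-- the initial distribution -/
  p0 : Fin nS → ℝ
  /-- `p s a b s'` is the probability of moving from `s` to `s'` under the actions `a`, `b` -/
  p : Fin nS → Fin A → Fin B → Fin nS → ℝ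
  /-- the law of Alice's random cost -/
  cost : Fin nS → Fin A → Fin B → Measure ℝ
  /-- Alice's infosets -/
  x : Fin nS → Fin nX
  /-- Bob's infosets -/
  y : Fin nS → Fin nY
  p0_nonneg : ∀ s, 0 ≤ p0 s
  p0_sum : ∑ s, p0 s = 1
  p0_stage : ∀ s, p0 s ≠ 0 → (stage s : ℕ) = 0
  p_nonneg : ∀ s a b s', 0 ≤ p s a b s'
  p_sum : ∀ s a b, (stage s : ℕ) + 1 < H → ∑ s', p s a b s' = 1
  p_stage : ∀ s a b s', p s a b s' ≠ 0 → (stage s' : ℕ) = stage s + 1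
  cost_prob : ∀ s a b, IsProbabilityMeasure (cost s a b)
  cost_mem : ∀ s a b, ∀ᵐ r ∂(cost s a b), r ∈ Set.Icc (-1 : ℝ) 1
  x_surj : Function.Surjective x
  y_surj : Function.Surjective y

/-- The treeplex of a player with infosets `I` and actions `K`: `root i` says that `i` is an infoset
of the first stage, `child i k j` that `(i, k)` is the predecessor pair of `j`. -/
def treeplex {I K : Type*} [Fintype K] (root : I → Prop) (child : I → K → I → Prop) :
    Set (I → K → ℝ) :=
  {μ | (∀ i k, 0 ≤ μ i k) ∧ (∀ i, root i → ∑ k, μ i k = 1) ∧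
    ∀ i k j, child i k j → ∑ k', μ j k' = μ i k}

/-- The policy `π_μ(k | i) = μ(i, k) / ∑ k', μ(i, k')` of a treeplex strategy. -/
def policyOf {I K : Type*} [Fintype K] (μ : I → K → ℝ) (i : I) (k : K) : ℝ :=
  μ i k / ∑ k', μ i k'

/-- The Euclidean inner product of two vectors indexed by pairs. -/
def pairing {I K : Type*} [Fintype I] [Fintype K] (μ c : I → K → ℝ) : ℝ :=
  ∑ i, ∑ k, μ i k * c i k

/-- A minimiser of `F` over the set `Z`. -/
def argminOn {V : Type*} [Inhabited V] (F : V → ℝ) (Z : Set V) : V :=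
  Classical.epsilon fun v => v ∈ Z ∧ ∀ z ∈ Z, F v ≤ F z

namespace EFG

variable {H nS nX nY A B : ℕ} (G : EFG H nS nX nY A B)

/-- `(x, a)` is a predecessor pair of Alice's infoset `x'`. -/
def childX (x : Fin nX) (a : Fin A) (x' : Fin nX) : Prop :=
  ∃ s b s', G.x s = x ∧ G.x s' = x' ∧ G.p s a b s' ≠ 0

/-- `(y, b)` is a predecessor pair of Bob's infoset `y'`. -/
def childY (y : Fin nY) (b : Fin B) (y' : Fin nY) : Prop :=
  ∃ s a s', G.y s = y ∧ G.y s' = y' ∧ G.p s a b s' ≠ 0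

/-- Tree structure and perfect recall of both players.  Both conditions are written for the last
step of the path leading to a state; for the whole path they follow by induction on the stage. -/
structure IsTreePerfectRecall : Prop where
  tree : ∀ s', (G.stage s' : ℕ) ≠ 0 →
    ∃! q : Fin nS × Fin A × Fin B, G.p q.1 q.2.1 q.2.2 s' ≠ 0
  x_stage : ∀ s s', G.x s = G.x s' → G.stage s = G.stage s'
  y_stage : ∀ s s', G.y s = G.y s' → G.stage s = G.stage s'
  x_recall : ∀ s s' r r' a a' b b', G.x s = G.x s' → G.p r a b s ≠ 0 → G.p r' a' b' s' ≠ 0 →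
    G.x r = G.x r' ∧ a = a'
  y_recall : ∀ s s' r r' a a' b b', G.y s = G.y s' → G.p r a b s ≠ 0 → G.p r' a' b' s' ≠ 0 →
    G.y r = G.y r' ∧ b = b'

/-- The stage of an infoset of Alice. -/
def level (x : Fin nX) : Fin H := G.stage (Function.surjInv G.x_surj x)

/-- The stage of an infoset of Bob. -/
def levelY (y : Fin nY) : Fin H := G.stage (Function.surjInv G.y_surj y)

/-- Alice's treeplex. -/
def TX : Set (Fin nX → Fin A → ℝ) := treeplex (fun x => (G.level x : ℕ) = 0) G.childX

/-- Bob's treeplex. -/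
def TY : Set (Fin nY → Fin B → ℝ) := treeplex (fun y => (G.levelY y : ℕ) = 0) G.childY

/-- The mean cost. -/
def meanCost (s : Fin nS) (a : Fin A) (b : Fin B) : ℝ := ∫ r, r ∂(G.cost s a b)

/-- Auxiliary recursion for `reach`: the total weight of all paths with `n` transitions from an
initial state to `s`. -/
def reachAux : ℕ → Fin nS → ℝ
  | 0, s => G.p0 s
  | n + 1, s => ∑ r, ∑ a, ∑ b, reachAux n r * G.p r a b s

/-- `p(s)`, the product of the transition probabilities along the path leading to `s`.  In a
tree-structured game the sum in `reachAux` has at most one nonzero term. -/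
def reach (s : Fin nS) : ℝ := G.reachAux (G.stage s) s

/-- The cost vector `c(x, a) = ∑_{s : x(s) = x, b} p(s) ν(y(s), b) ū(s, a, b)` induced by Bob's
strategy `ν`. -/
def costVec (ν : Fin nY → Fin B → ℝ) (x : Fin nX) (a : Fin A) : ℝ :=
  ∑ s, if G.x s = x then ∑ b, G.reach s * ν (G.y s) b * G.meanCost s a b else 0

/-- The probability of a sequence of states and actions, when Alice and Bob use the policies of the
treeplex strategies `μ` and `ν`. -/
def pathProb (μ : Fin nX → Fin A → ℝ) (ν : Fin nY → Fin B → ℝ)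
    (z : Fin H → Fin nS × Fin A × Fin B) : ℝ :=
  ∏ h : Fin H,
    ((if (h : ℕ) = 0 then G.p0 (z h).1 else 1) *
      policyOf μ (G.x (z h).1) (z h).2.1 * policyOf ν (G.y (z h).1) (z h).2.2 *
      (if hh : (h : ℕ) + 1 < H then
        G.p (z h).1 (z h).2.1 (z h).2.2 (z ⟨(h : ℕ) + 1, hh⟩).1 else 1))

end EFG

/-- Trajectories `(s_h, a_h, b_h)_h` together with the realised costs `(u_h)_h`. -/
abbrev Traj (H nS A B : ℕ) : Type := (Fin H → Fin nS × Fin A × Fin B) × (Fin H → ℝ)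

namespace EFG

variable {H nS nX nY A B : ℕ} (G : EFG H nS nX nY A B)

/-- The law of the trajectory when the treeplex strategies `μ` and `ν` are played; given the states
and actions, the costs are drawn independently from their laws. -/
def trajLaw (μ : Fin nX → Fin A → ℝ) (ν : Fin nY → Fin B → ℝ) : Measure (Traj H nS A B) :=
  ∑ z : Fin H → Fin nS × Fin A × Fin B, ENNReal.ofReal (G.pathProb μ ν z) •
    (Measure.dirac z).prod (Measure.pi fun h => G.cost (z h).1 (z h).2.1 (z h).2.2)

/-- What Alice sees of a trajectory: her infosets, her actions and her costs. -/
def observe (w : Traj H nS A B) (h : Fin H) : Fin nX × Fin A × ℝ :=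
  (G.x (w.1 h).1, (w.1 h).2.1, w.2 h)

/-- The path to the infoset `x'` goes through the pair `(x, a)`. -/
def Through (x : Fin nX) (a : Fin A) (x' : Fin nX) : Prop :=
  ∃ x₁, G.childX x a x₁ ∧ Relation.ReflTransGen (fun u v => ∃ a', G.childX u a' v) x₁ x'

/-- The strategy `μ_π(x, a)`: the product of `π` along the path to `(x, a)`, including `(x, a)`. -/
def seqForm (π : Fin nX → Fin A → ℝ) (x : Fin nX) (a : Fin A) : ℝ :=
  π x a * ∏ x', ∏ a', if G.Through x' a' x then π x' a' else 1

/-- The balanced exploration policy for the stage `h`. -/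
def balPolicy (h : Fin H) (x : Fin nX) (a : Fin A) : ℝ :=
  if G.level x < h then
    ({x' | G.level x' = h ∧ G.Through x a x'}.ncard : ℝ) /
      ({x' | G.level x' = h ∧ ∃ a', G.Through x a' x'}.ncard : ℝ)
  else 1 / (A : ℝ)

/-- The balanced exploration strategy for the stage `h`. -/
def balStrategy (h : Fin H) : Fin nX → Fin A → ℝ := G.seqForm (G.balPolicy h)

/-- The unbalanced dilated KL divergence. -/
def dilKL (μ μ' : Fin nX → Fin A → ℝ) : ℝ :=
  ∑ x, ∑ a, μ x a * Real.log (policyOf μ x a / policyOf μ' x a)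

/-- The balanced dilated KL divergence. -/
def balKL (μ μ' : Fin nX → Fin A → ℝ) : ℝ :=
  ∑ x, ∑ a, μ x a / G.balStrategy (G.level x) x a *
    Real.log (policyOf μ x a / policyOf μ' x a)

/-- The strategy of the uniform policy. -/
def uniformStrategy (x : Fin nX) (_a : Fin A) : ℝ := 1 / (A : ℝ) ^ ((G.level x : ℕ) + 1)

/-- The regret parameter `R` of the algorithm. -/
def paramR (_G : EFG H nS nX nY A B) (δ : ℝ) (T : ℕ) : ℝ :=
  δ⁻¹ * √(8 * nX * (H : ℝ) ^ 3 * Real.log A * T)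

/-- The learning rate `η`. -/
def paramEta (_G : EFG H nS nX nY A B) (δ : ℝ) (T : ℕ) : ℝ :=
  √(δ ^ 2 * nX * Real.log A / (8 * (H : ℝ) ^ 2 * T))

/-- The balanced learning rate `τ`. -/
def paramTau (_G : EFG H nS nX nY A B) (T : ℕ) : ℝ :=
  √(nX * A * Real.log A / ((H : ℝ) ^ 3 * T))

end EFG

/-- The memory of the algorithm at the start of a round: the number `k` of the phase, the mixing
weight `α`, the sum of the cost estimators of the rounds of the current phase, and the iterate of
online mirror descent. -/
structure PAState (nX A : ℕ) where
  k : ℕ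
  alpha : ℝ
  cum : Fin nX → Fin A → ℝ
  muHat : Fin nX → Fin A → ℝ

/-- The strategy `α μHat + (1 - α) μc` which the algorithm plays. -/
def PAState.play {nX A : ℕ} (st : PAState nX A) (μc : Fin nX → Fin A → ℝ) :
    Fin nX → Fin A → ℝ :=
  fun x a => st.alpha * st.muHat x a + (1 - st.alpha) * μc x a

namespace EFG

variable {H nS nX nY A B : ℕ} (G : EFG H nS nX nY A B)

/-- The importance-weighted cost estimator, when `μ` has been played and `o` has been observed. -/
def estimator (μ : Fin nX → Fin A → ℝ) (o : Fin H → Fin nX × Fin A × ℝ)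
    (x : Fin nX) (a : Fin A) : ℝ :=
  if (o (G.level x)).1 = x ∧ (o (G.level x)).2.1 = a then (o (G.level x)).2.2 / μ x a else 0

/-- The initial memory. -/
def paInit (δ : ℝ) (T : ℕ) : PAState nX A where
  k := 1
  alpha := 1 / G.paramR δ T
  cum := fun _ _ => 0
  muHat := G.uniformStrategy

/-- One round of the algorithm, run for `T` rounds with margin `δ` and comparator `μc`, after the
observation `o`.  The comparison with the best strategy in the treeplex decides whether a new phase
begins (it then has the number `st.k + 1`); otherwise a step of online mirror descent is made. -/
def paStep (δ : ℝ) (T : ℕ) (μc : Fin nX → Fin A → ℝ) (st : PAState nX A)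
    (o : Fin H → Fin nX × Fin A × ℝ) : PAState nX A :=
  let cHat := G.estimator (st.play μc) o
  let cum : Fin nX → Fin A → ℝ := fun x a => st.cum x a + cHat x a
  if (∃ μ ∈ G.TX, 2 * G.paramR δ T < pairing cum (fun x a => μc x a - μ x a)) ∧ st.alpha < 1 then
    { k := st.k + 1
      alpha := min (2 ^ st.k / G.paramR δ T) 1
      cum := fun _ _ => 0
      muHat := G.uniformStrategy }
  else
    { k := st.k
      alpha := st.alpha
      cum := cum
      muHat :=
        if st.alpha < 1 then
          argminOn (fun μ => G.paramEta δ T * pairing μ cHat + dilKL μ st.muHat) G.TX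
        else
          argminOn (fun μ => G.paramTau T * pairing μ cHat + G.balKL μ st.muHat) G.TX }

/-- The memory before round `t` (rounds are numbered from `0`), when the trajectories of the earlier
rounds are given by `w`.  Costs known to lie in `[lo, lo + r]` are passed to the algorithm in the
normalised form `(u - lo) / r`. -/
def paState (δ : ℝ) (T : ℕ) (μc : Fin nX → Fin A → ℝ) (lo r : ℝ) (w : ℕ → Traj H nS A B) :
    ℕ → PAState nX A
  | 0 => G.paInit δ T
  | t + 1 => G.paStep δ T μc (paState δ T μc lo r w t) fun h =>
      ((G.observe (w t) h).1, (G.observe (w t) h).2.1, ((G.observe (w t) h).2.2 - lo) / r)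

/-- The strategy `μ^t` which Alice plays in round `t`. -/
def paStrategy (δ : ℝ) (T : ℕ) (μc : Fin nX → Fin A → ℝ) (lo r : ℝ) (w : ℕ → Traj H nS A B)
    (t : ℕ) : Fin nX → Fin A → ℝ :=
  (G.paState δ T μc lo r w t).play μc

/-- `T` rounds of play of Alice's algorithm against an arbitrary, possibly adaptive and randomising
Bob.  `ℱ t` is what is known before the trajectory of round `t` is drawn; `ν t` is Bob's strategy
and `w t` the trajectory of round `t`, which is drawn according to Alice's and Bob's strategies. -/
structure IsPlay {Ω : Type*} [mΩ : MeasurableSpace Ω] (P : Measure Ω) (ℱ : Filtration ℕ mΩ)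
    (δ : ℝ) (T : ℕ) (μc : Fin nX → Fin A → ℝ) (lo r : ℝ)
    (ν : ℕ → Ω → Fin nY → Fin B → ℝ) (w : ℕ → Ω → Traj H nS A B) : Prop where
  nu_mem : ∀ t < T, ∀ ω, ν t ω ∈ G.TY
  nu_meas : ∀ t < T, Measurable[ℱ t] (ν t)
  traj_meas : ∀ t < T, Measurable[ℱ (t + 1)] (w t)
  traj_law : ∀ t < T, ∀ E : Set (Traj H nS A B), MeasurableSet E →
    P⟦w t ⁻¹' E | ℱ t⟧ =ᵐ[P]
      fun ω => (G.trajLaw (G.paStrategy δ T μc lo r (fun j => w j ω) t) (ν t ω)).real E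

/-- `⟨μ^t - μ, c^t⟩`, where Alice has played `μt` and Bob `νt`. -/
def instRegret (μt : Fin nX → Fin A → ℝ) (νt : Fin nY → Fin B → ℝ) (μ : Fin nX → Fin A → ℝ) : ℝ :=
  pairing (fun x a => μt x a - μ x a) (G.costVec νt)

/-- The expected regret of Alice's algorithm compared to `μ`. -/
def regret {Ω : Type*} [MeasurableSpace Ω] (P : Measure Ω)
    (δ : ℝ) (T : ℕ) (μc : Fin nX → Fin A → ℝ) (lo r : ℝ)
    (ν : ℕ → Ω → Fin nY → Fin B → ℝ) (w : ℕ → Ω → Traj H nS A B)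
    (μ : Fin nX → Fin A → ℝ) : ℝ :=
  ∑ t ∈ Finset.range T,
    ∫ ω, G.instRegret (G.paStrategy δ T μc lo r (fun j => w j ω) t) (ν t ω) μ ∂P

end EFG

end

/-! The regret is analysed with the importance-weighted estimators of the normalised costs. They are
conditionally unbiased (`integral_pairing_estimator`), and normalisation only rescales regret,
because every strategy pays the same total for a constant shift of the costs (`instRegret_eq`).

The core is a doubling argument over phases. Since Alice mixes mirror descent with `μc` at weight
`α`, her regret to `μc` is `α` times that of mirror descent, whose regret within a phase with `α <
1` is at most `R` plus second-order terms. Such a phase ends when some `μ` beats `μc` by more than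
`2R` on the estimated costs. Mirror descent is then within `R` of that `μ`, so it has itself beaten
`μc` by `R`, and the phase has won `αR = 2^(k-1)` against `μc`. The wins `1 + 2 + ... + 2^(k-2) =
2^(k-1) - 1` of the completed phases pay for the possible loss `αR = 2^(k-1)` of the running phase,
except for `1`. Once `α = 1` the wins are at least `R - 1`, which exceeds what balanced mirror
descent can lose. Against any other `μ` a completed phase costs at most `4R`: the test had not fired
before its last round, and that round adds at most `H ≤ R`. There are only about `log₂ R` phases.
`PhaseBound` is this bookkeeping as an invariant, and `PhaseBound.step` preserves it.

For mirror descent, the dilated divergence lets one step be solved exactly by backward recursion on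
the tree of infosets, where each value is a log partition function. The objective then equals a
constant plus the divergence to the next iterate (`pairing_add_wKL`). This identifies the `argmin`
by an explicit, measurable formula and gives the step inequality. The second-order terms are small
because an estimator lives on a single path (`sum_backCost_sq_le`, `sum_backCost_sq_le_weighted`).

In expectation, `(x, a)` is visited with probability `μ^t(x, a) · occ(x)`, and `∑ μ · occ = H` for
every strategy `μ`. While `α < 1`, the ratio of the iterate to the played strategy is at most `1 +
μ̂/δ`, which turns the second-order sum into `2H/δ`. When `α = 1`, the balanced weights turn it into
`H`, while the divergence from the uniform strategy stays below `XA log A`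
(`sum_mass_mul_balWeight`). The tuning in `tunedParams` has to give constant exactly `1` in front of
`R`; this uses `δH ≤ 1` and, for `H = 1`, the factor `1 - δ` gained from `μc ≥ δ`.

The phases end at random times, but no stopping argument is needed. The pathwise bounds contain the
second-order terms of all rounds, compared with bounds known before each round, and the difference
has nonpositive expectation. -/

set_option linter.unusedSectionVars false

/-- The predecessor relation of the infosets of a player with perfect recall, graded by the
stage. -/
structure IsGradedTree {I K : Type*} (level : I → ℕ) (child : I → K → I → Prop) : Prop where
  level_child : ∀ {x a x'}, child x a x' → level x' = level x + 1
  exists_parent : ∀ {x'}, level x' ≠ 0 → ∃ x a, child x a x'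
  parent_unique : ∀ {x y a b x'}, child x a x' → child y b x' → x = y ∧ a = b

/-! ### Dilated divergences on a treeplex. -/

section Treeplex

variable {I K : Type*} [Fintype K] {level : I → ℕ} {child : I → K → I → Prop}

theorem mass_nonneg {root : I → Prop} {μ : I → K → ℝ} (hμ : μ ∈ treeplex root child) (x : I) :
    0 ≤ ∑ a, μ x a := Finset.sum_nonneg fun a _ => hμ.1 x a

theorem le_mass {root : I → Prop} {μ : I → K → ℝ} (hμ : μ ∈ treeplex root child) (x : I) (a : K) :
    μ x a ≤ ∑ a, μ x a :=
  Finset.single_le_sum (f := μ x) (fun a _ => hμ.1 x a) (Finset.mem_univ a)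

/-- At an infoset of mass zero the quotient is `0` by convention and the entries vanish too, so no
positivity assumption is needed. -/
theorem mul_policyOf {root : I → Prop} {μ : I → K → ℝ} (hμ : μ ∈ treeplex root child) (x : I)
    (a : K) : (∑ a, μ x a) * policyOf μ x a = μ x a := by
  unfold policyOf
  by_cases h : ∑ a, μ x a = 0
  · have := le_mass hμ x a
    have h0 := hμ.1 x a
    rw [h]; simp; linarith
  · field_simp

theorem policyOf_nonneg {root : I → Prop} {μ : I → K → ℝ} (hμ : μ ∈ treeplex root child) (x : I)
    (a : K) : 0 ≤ policyOf μ x a := div_nonneg (hμ.1 x a) (mass_nonneg hμ x)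

theorem policyOf_le_one {root : I → Prop} {μ : I → K → ℝ} (hμ : μ ∈ treeplex root child) (x : I)
    (a : K) : policyOf μ x a ≤ 1 := div_le_one_of_le₀ (le_mass hμ x a) (mass_nonneg hμ x)

theorem sum_policyOf {μ : I → K → ℝ} {x : I} (h : ∑ a, μ x a ≠ 0) :
    ∑ a, policyOf μ x a = 1 := by
  unfold policyOf
  rw [← Finset.sum_div, div_self h]

theorem policyOf_pos {μ : I → K → ℝ} (h : ∀ x a, 0 < μ x a) (x : I) (a : K) :
    0 < policyOf μ x a :=
  div_pos (h x a) (Finset.sum_pos (fun a _ => h x a) ⟨a, Finset.mem_univ a⟩)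

theorem mass_le_one (hT : IsGradedTree level child) {μ : I → K → ℝ}
    (hμ : μ ∈ treeplex (fun x => level x = 0) child) (x : I) : ∑ a, μ x a ≤ 1 := by
  induction hn : level x generalizing x with
  | zero => exact (hμ.2.1 x hn).le
  | succ n ih =>
    obtain ⟨p, b, hpb⟩ := hT.exists_parent (x' := x) (by omega)
    have h1 := hT.level_child hpb
    rw [hμ.2.2 _ _ _ hpb]
    exact (le_mass hμ p b).trans (ih p (by omega))

variable [Fintype I]

/-- The dilated KL divergence with weights `w`. -/
noncomputable def wKL (w : I → ℝ) (μ μ' : I → K → ℝ) : ℝ :=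
  ∑ x, ∑ a, w x * (μ x a * Real.log (policyOf μ x a / policyOf μ' x a))

/-- Summation is rearranged by successor: a non-root infoset has exactly one predecessor pair, and
the weight of that pair is the mass of the infoset. -/
theorem sum_parent_mul (hT : IsGradedTree level child) {μ : I → K → ℝ}
    (hμ : μ ∈ treeplex (fun x => level x = 0) child) (V : I → ℝ) :
    ∑ x, ∑ a, μ x a * ∑ x', (if child x a x' then V x' else 0) =
      ∑ x', if level x' = 0 then 0 else (∑ a, μ x' a) * V x' := by
  simp_rw [Finset.mul_sum]
  have : ∀ x, ∑ a, ∑ x', μ x a * (if child x a x' then V x' else 0) =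
      ∑ x', ∑ a, μ x a * (if child x a x' then V x' else 0) := fun x => Finset.sum_comm
  simp_rw [this]
  rw [Finset.sum_comm]
  refine Finset.sum_congr rfl fun x' _ => ?_
  split_ifs with h
  · refine Finset.sum_eq_zero fun x _ => Finset.sum_eq_zero fun a _ => ?_
    rw [if_neg, mul_zero]
    intro hc
    have := hT.level_child hc
    omega
  · obtain ⟨p, b, hpb⟩ := hT.exists_parent h
    rw [Finset.sum_eq_single p, Finset.sum_eq_single b]
    · rw [if_pos hpb, hμ.2.2 _ _ _ hpb]
    · intro a _ ha
      rw [if_neg, mul_zero]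
      exact fun hc => ha (hT.parent_unique hc hpb).2
    · simp
    · intro x _ hx
      refine Finset.sum_eq_zero fun a _ => ?_
      rw [if_neg, mul_zero]
      exact fun hc => hx (hT.parent_unique hc hpb).1
    · simp

/-- This is what makes values telescope along the tree, leaving only those at the roots, where the
mass is one. -/
theorem sum_mass_mul (hT : IsGradedTree level child) {μ : I → K → ℝ}
    (hμ : μ ∈ treeplex (fun x => level x = 0) child) (V : I → ℝ) :
    ∑ x, (∑ a, μ x a) * V x = (∑ x, if level x = 0 then V x else 0) +
      ∑ x, ∑ a, μ x a * ∑ x', (if child x a x' then V x' else 0) := by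
  rw [sum_parent_mul hT hμ, ← Finset.sum_add_distrib]
  refine Finset.sum_congr rfl fun x _ => ?_
  split_ifs with h
  · rw [hμ.2.1 x h]; ring
  · ring

/-- `klFun` differs from `t log t` by `1 - t`; these corrections cancel because both policies sum to
one. In this form every summand is nonnegative. -/
theorem wKL_eq_sum_klFun {root : I → Prop} (w : I → ℝ) {μ μ' : I → K → ℝ}
    (hμ : μ ∈ treeplex root child) (hpos : ∀ x a, 0 < μ' x a) :
    wKL w μ μ' = ∑ x, w x * ((∑ a, μ x a) *
      ∑ a, policyOf μ' x a * InformationTheory.klFun (policyOf μ x a / policyOf μ' x a)) := by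
  unfold wKL
  refine Finset.sum_congr rfl fun x _ => ?_
  rw [← Finset.mul_sum]
  congr 1
  by_cases h : ∑ a, μ x a = 0
  · rw [h, zero_mul]
    refine Finset.sum_eq_zero fun a _ => ?_
    have := le_mass hμ x a
    have h0 := hμ.1 x a
    rw [show μ x a = 0 by linarith, zero_mul]
  · rcases isEmpty_or_nonempty K with hK | ⟨⟨a₀⟩⟩
    · simp
    have h1 := sum_policyOf h
    have h2 : ∑ a, policyOf μ' x a = 1 :=
      sum_policyOf (Finset.sum_pos (fun a _ => hpos x a) ⟨a₀, Finset.mem_univ _⟩).ne'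
    have h3 : ∀ a, policyOf μ' x a * InformationTheory.klFun (policyOf μ x a / policyOf μ' x a) =
        policyOf μ x a * Real.log (policyOf μ x a / policyOf μ' x a) + policyOf μ' x a -
          policyOf μ x a := by
      intro a
      have := (policyOf_pos hpos x a).ne'
      rw [InformationTheory.klFun_apply]
      field_simp
    simp_rw [h3]
    rw [Finset.sum_sub_distrib, Finset.sum_add_distrib, h1, h2, add_sub_cancel_right,
      Finset.mul_sum]
    refine Finset.sum_congr rfl fun a _ => ?_
    rw [← mul_assoc, mul_policyOf hμ]

theorem wKL_nonneg {root : I → Prop} {w : I → ℝ} (hw : ∀ x, 0 ≤ w x) {μ μ' : I → K → ℝ}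
    (hμ : μ ∈ treeplex root child) (hpos : ∀ x a, 0 < μ' x a) : 0 ≤ wKL w μ μ' := by
  rw [wKL_eq_sum_klFun w hμ hpos]
  refine Finset.sum_nonneg fun x _ => mul_nonneg (hw x) (mul_nonneg (mass_nonneg hμ x)
    (Finset.sum_nonneg fun a _ => mul_nonneg (policyOf_pos hpos x a).le ?_))
  exact InformationTheory.klFun_nonneg
    (div_nonneg (policyOf_nonneg hμ x a) (policyOf_pos hpos x a).le)

theorem wKL_self (w : I → ℝ) {μ : I → K → ℝ} (hpos : ∀ x a, 0 < μ x a) : wKL w μ μ = 0 := by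
  unfold wKL
  refine Finset.sum_eq_zero fun x _ => Finset.sum_eq_zero fun a _ => ?_
  rw [div_self (policyOf_pos hpos x a).ne']; simp

/-- A vanishing divergence forces equal policies only where `μ` has mass. Going down from the roots,
the masses agree by induction with those of the positive `μ'`, so no infoset is missed. -/
theorem eq_of_wKL_nonpos (hT : IsGradedTree level child) {w : I → ℝ} (hw : ∀ x, 0 < w x)
    {μ μ' : I → K → ℝ} (hμ : μ ∈ treeplex (fun x => level x = 0) child)
    (hμ' : μ' ∈ treeplex (fun x => level x = 0) child)
    (hpos : ∀ x a, 0 < μ' x a) (h : wKL w μ μ' ≤ 0) : μ = μ' := by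
  have hk : ∀ x a, 0 ≤ policyOf μ' x a *
      InformationTheory.klFun (policyOf μ x a / policyOf μ' x a) := fun x a =>
    mul_nonneg (policyOf_pos hpos x a).le (InformationTheory.klFun_nonneg
      (div_nonneg (policyOf_nonneg hμ x a) (policyOf_pos hpos x a).le))
  have hk' : ∀ x, 0 ≤ w x * ((∑ a, μ x a) * ∑ a, policyOf μ' x a *
      InformationTheory.klFun (policyOf μ x a / policyOf μ' x a)) := fun x =>
    mul_nonneg (hw x).le (mul_nonneg (mass_nonneg hμ x) (Finset.sum_nonneg fun a _ => hk x a))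
  have h0 := le_antisymm h (wKL_nonneg (fun x => (hw x).le) hμ hpos)
  rw [wKL_eq_sum_klFun w hμ hpos, Finset.sum_eq_zero_iff_of_nonneg fun x _ => hk' x] at h0
  have key : ∀ x, ∑ a, μ x a = ∑ a, μ' x a → μ x = μ' x := by
    intro x hx
    funext a
    have hm : ∑ a, μ x a ≠ 0 :=
      hx ▸ (Finset.sum_pos (fun a _ => hpos x a) ⟨a, Finset.mem_univ _⟩).ne'
    have h1 := h0 x (Finset.mem_univ _)
    rw [mul_eq_zero, mul_eq_zero, or_iff_right (hw x).ne', or_iff_right hm,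
      Finset.sum_eq_zero_iff_of_nonneg fun a _ => hk x a] at h1
    have h2 := h1 a (Finset.mem_univ _)
    rw [mul_eq_zero, or_iff_right (policyOf_pos hpos x a).ne',
      InformationTheory.klFun_eq_zero_iff
        (div_nonneg (policyOf_nonneg hμ x a) (policyOf_pos hpos x a).le),
      div_eq_one_iff_eq (policyOf_pos hpos x a).ne'] at h2
    rw [← mul_policyOf hμ x a, ← mul_policyOf hμ' x a, hx, h2]
  funext x
  induction hn : level x generalizing x with
  | zero => exact key x (by rw [hμ.2.1 x hn, hμ'.2.1 x hn])
  | succ n ih =>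
    obtain ⟨p, b, hpb⟩ := hT.exists_parent (x' := x) (by omega)
    have h1 := hT.level_child hpb
    exact key x (by rw [hμ.2.2 _ _ _ hpb, hμ'.2.2 _ _ _ hpb, ih p (by omega)])

/-! ### One step of mirror descent solved by backward recursion. -/

/-- `n` steps of the backward recursion for the value of one step of mirror descent. -/
noncomputable def backIter (child : I → K → I → Prop) (w : I → ℝ) (π c : I → K → ℝ) :
    ℕ → I → ℝ
  | 0, _ => 0
  | n + 1, x => -w x * Real.log (∑ a, π x a * Real.exp (-(c x a +
      ∑ x', if child x a x' then backIter child w π c n x' else 0) / w x))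

/-- The value of the mirror descent problem below an infoset. -/
noncomputable def backValue (H : ℕ) (level : I → ℕ) (child : I → K → I → Prop) (w : I → ℝ)
    (π c : I → K → ℝ) (x : I) : ℝ :=
  backIter child w π c (H - level x) x

/-- The cost of an action together with the values of the infosets reached by it. -/
noncomputable def backCost (H : ℕ) (level : I → ℕ) (child : I → K → I → Prop) (w : I → ℝ)
    (π c : I → K → ℝ) (x : I) (a : K) : ℝ :=
  c x a + ∑ x', if child x a x' then backValue H level child w π c x' else 0

/-- The policy of the next iterate of mirror descent. -/
noncomputable def nextPolicy (H : ℕ) (level : I → ℕ) (child : I → K → I → Prop) (w : I → ℝ)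
    (π c : I → K → ℝ) (x : I) (a : K) : ℝ :=
  π x a * Real.exp (-(backCost H level child w π c x a - backValue H level child w π c x) / w x)

variable {H : ℕ} {w : I → ℝ} {π c : I → K → ℝ}

/-- The depth `H - level x` drops by exactly one at each successor, so the counted iteration is a
genuine recursion; `level x < H` rules out the dummy value `0` of depth zero. -/
theorem backValue_eq (hT : IsGradedTree level child) (hH : ∀ x, level x < H) (x : I) :
    backValue H level child w π c x = -w x * Real.log (∑ a, π x a *
      Real.exp (-backCost H level child w π c x a / w x)) := by
  obtain ⟨n, hn⟩ : ∃ n, H - level x = n + 1 := ⟨H - level x - 1, by have := hH x; omega⟩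
  rw [backValue, hn, backIter]
  congr 3
  funext a
  congr 4
  rw [backCost]
  congr 1
  refine Finset.sum_congr rfl fun x' _ => ?_
  split_ifs with h
  · have := hT.level_child h
    rw [backValue, show H - level x' = n by omega]
  · rfl

/-- Subtracting the value in the exponent divides by the partition function, as `-V/w` is its
logarithm. -/
theorem sum_nextPolicy [Nonempty K] (hT : IsGradedTree level child) (hH : ∀ x, level x < H)
    (hw : ∀ x, 0 < w x) (hπ : ∀ x a, 0 < π x a) (x : I) :
    ∑ a, nextPolicy H level child w π c x a = 1 := by
  have hs : 0 < ∑ a, π x a * Real.exp (-backCost H level child w π c x a / w x) :=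
    Finset.sum_pos (fun a _ => mul_pos (hπ x a) (Real.exp_pos _)) Finset.univ_nonempty
  have h1 : ∀ a, nextPolicy H level child w π c x a =
      π x a * Real.exp (-backCost H level child w π c x a / w x) /
        ∑ a, π x a * Real.exp (-backCost H level child w π c x a / w x) := by
    intro a
    have hw' := (hw x).ne'
    rw [nextPolicy, backValue_eq hT hH]
    rw [show -(backCost H level child w π c x a - -w x * Real.log (∑ a, π x a *
      Real.exp (-backCost H level child w π c x a / w x))) / w x =
      -backCost H level child w π c x a / w x - Real.log (∑ a, π x a *
      Real.exp (-backCost H level child w π c x a / w x)) by field_simp; ring]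
    rw [Real.exp_sub, Real.exp_log hs, mul_div_assoc]
  simp_rw [h1]
  rw [← Finset.sum_div, div_self hs.ne']

/-- The objective of mirror descent, up to a constant, is the divergence to the next iterate. -/
theorem pairing_add_wKL (hT : IsGradedTree level child) (hw : ∀ x, 0 < w x)
    {μ μ₀ μ₁ : I → K → ℝ} (hμ : μ ∈ treeplex (fun x => level x = 0) child)
    (h₀ : ∀ x a, 0 < μ₀ x a)
    (h₁ : ∀ x a, policyOf μ₁ x a = nextPolicy H level child w (policyOf μ₀) c x a) :
    pairing μ c + wKL w μ μ₀ =
      (∑ x, if level x = 0 then backValue H level child w (policyOf μ₀) c x else 0) +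
        wKL w μ μ₁ := by
  set V := backValue H level child w (policyOf μ₀) c with hV
  -- Taking logarithms in `nextPolicy` gives `w log(π_μ/π₀) = w log(π_μ/π₁) - U + V`, with `U` the
  -- cost-to-go. Where `μ x a = 0` the logarithms are meaningless, but they are multiplied by zero.
  -- Summation then telescopes `V` down to the roots.
  have e : ∀ x a, w x * (μ x a * Real.log (policyOf μ x a / policyOf μ₀ x a)) =
      w x * (μ x a * Real.log (policyOf μ x a / policyOf μ₁ x a)) -
        (μ x a * c x a + μ x a * (∑ x', if child x a x' then V x' else 0)) + μ x a * V x := by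
    intro x a
    rcases (hμ.1 x a).eq_or_lt with h | h
    · rw [← h]; ring
    have hp : 0 < policyOf μ x a := div_pos h (h.trans_le (le_mass hμ x a))
    have hp0 := policyOf_pos h₀ x a
    have hw' := (hw x).ne'
    rw [h₁, nextPolicy, Real.log_div hp.ne' hp0.ne', Real.log_div hp.ne'
      (mul_pos hp0 (Real.exp_pos _)).ne', Real.log_mul hp0.ne' (Real.exp_pos _).ne', Real.log_exp,
      backCost]
    field_simp
    ring
  have hs := sum_mass_mul hT hμ V
  unfold wKL
  simp_rw [e, Finset.sum_add_distrib, Finset.sum_sub_distrib, Finset.sum_add_distrib,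
    ← Finset.sum_mul]
  rw [hs, pairing]
  ring

/-- The next iterate is the only minimiser of the objective of mirror descent. -/
theorem argminOn_eq (hT : IsGradedTree level child) (hw : ∀ x, 0 < w x) {μ₁ : I → K → ℝ}
    (hμ₁ : μ₁ ∈ treeplex (fun x => level x = 0) child) (hpos : ∀ x a, 0 < μ₁ x a)
    {F : (I → K → ℝ) → ℝ} {C : ℝ}
    (hF : ∀ μ ∈ treeplex (fun x => level x = 0) child, F μ = C + wKL w μ μ₁) :
    argminOn F (treeplex (fun x => level x = 0) child) = μ₁ := by
  -- `argminOn` is a choice operator, so it is known to be a minimiser only after one has been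
  -- exhibited; uniqueness then identifies it.
  have hex : ∃ v, v ∈ treeplex (fun x => level x = 0) child ∧
      ∀ z ∈ treeplex (fun x => level x = 0) child, F v ≤ F z := by
    refine ⟨μ₁, hμ₁, fun z hz => ?_⟩
    rw [hF _ hμ₁, hF _ hz, wKL_self w hpos]
    linarith [wKL_nonneg (fun x => (hw x).le) hz hpos]
  have h : argminOn F (treeplex (fun x => level x = 0) child) ∈
      treeplex (fun x => level x = 0) child ∧ ∀ z ∈ treeplex (fun x => level x = 0) child,
        F (argminOn F (treeplex (fun x => level x = 0) child)) ≤ F z :=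
    Classical.epsilon_spec hex
  refine eq_of_wKL_nonpos hT hw h.1 hμ₁ hpos ?_
  have h2 := h.2 μ₁ hμ₁
  rw [hF _ hμ₁, hF _ h.1, wKL_self w hpos] at h2
  linarith

/-- With nonnegative costs the partition function averages numbers at most one. -/
theorem backValue_nonneg [Nonempty K] (hT : IsGradedTree level child) (hH : ∀ x, level x < H)
    (hw : ∀ x, 0 < w x) (hπ : ∀ x a, 0 < π x a) (hπ1 : ∀ x, ∑ a, π x a = 1)
    (hc : ∀ x a, 0 ≤ c x a) (x : I) : 0 ≤ backValue H level child w π c x := by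
  induction hn : H - level x generalizing x with
  | zero => have := hH x; omega
  | succ n ih =>
    rw [backValue_eq hT hH, neg_mul, neg_nonneg]
    refine mul_nonpos_of_nonneg_of_nonpos (hw x).le (Real.log_nonpos
      (Finset.sum_nonneg fun a _ => mul_nonneg (hπ x a).le (Real.exp_pos _).le) ?_)
    rw [← hπ1 x]
    refine Finset.sum_le_sum fun a _ => mul_le_of_le_one_right (hπ x a).le
      (Real.exp_le_one_iff.2 ?_)
    refine div_nonpos_of_nonpos_of_nonneg (neg_nonpos.2 ?_) (hw x).le
    refine add_nonneg (hc x a) (Finset.sum_nonneg fun x' _ => ?_)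
    split_ifs with h
    · have := hT.level_child h
      exact ih x' (by omega)
    · exact le_rfl

theorem backCost_nonneg [Nonempty K] (hT : IsGradedTree level child) (hH : ∀ x, level x < H)
    (hw : ∀ x, 0 < w x) (hπ : ∀ x a, 0 < π x a) (hπ1 : ∀ x, ∑ a, π x a = 1)
    (hc : ∀ x a, 0 ≤ c x a) (x : I) (a : K) : 0 ≤ backCost H level child w π c x a := by
  refine add_nonneg (hc x a) (Finset.sum_nonneg fun x' _ => ?_)
  split_ifs with h
  · exact backValue_nonneg hT hH hw hπ hπ1 hc x'
  · exact le_rfl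

/-- From `(1 - y + y²/2)(1 + y + y²/2) = 1 + y⁴/4 ≥ 1` and `exp y ≥ 1 + y + y²/2`. -/
theorem exp_neg_le_quadratic {y : ℝ} (hy : 0 ≤ y) : Real.exp (-y) ≤ 1 - y + y ^ 2 / 2 := by
  have h1 := Real.quadratic_le_exp_of_nonneg hy
  have h2 : Real.exp (-y) * Real.exp y = 1 := by rw [← Real.exp_add]; simp
  have h3 := Real.exp_pos (-y)
  by_contra hcon
  push Not at hcon
  have h4 : 0 < 1 - y + y ^ 2 / 2 := by nlinarith [sq_nonneg (y - 1)]
  have h5 : (1 - y + y ^ 2 / 2) * (1 + y + y ^ 2 / 2) = 1 + y ^ 4 / 4 := by ring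
  have h6 : 0 ≤ y ^ 4 := by positivity
  nlinarith [mul_lt_mul_of_pos_right hcon (Real.exp_pos y), mul_le_mul_of_nonneg_left h1 h4.le]

/-- `log S ≤ S - 1` combined with the quadratic bound for `exp`; nonnegativity of the cost-to-go is
what permits the latter without any smallness condition. -/
theorem backValue_ge [Nonempty K] (hT : IsGradedTree level child) (hH : ∀ x, level x < H)
    (hw : ∀ x, 0 < w x) (hπ : ∀ x a, 0 < π x a) (hπ1 : ∀ x, ∑ a, π x a = 1)
    (hc : ∀ x a, 0 ≤ c x a) (x : I) :
    ∑ a, π x a * (backCost H level child w π c x a -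
      backCost H level child w π c x a ^ 2 / (2 * w x)) ≤ backValue H level child w π c x := by
  have hs : 0 < ∑ a, π x a * Real.exp (-backCost H level child w π c x a / w x) :=
    Finset.sum_pos (fun a _ => mul_pos (hπ x a) (Real.exp_pos _)) Finset.univ_nonempty
  rw [backValue_eq hT hH]
  have h1 := Real.log_le_sub_one_of_pos hs
  have h2 : ∑ a, π x a * Real.exp (-backCost H level child w π c x a / w x) ≤
      ∑ a, π x a * (1 - backCost H level child w π c x a / w x +
        (backCost H level child w π c x a / w x) ^ 2 / 2) := by
    refine Finset.sum_le_sum fun a _ => mul_le_mul_of_nonneg_left ?_ (hπ x a).le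
    rw [neg_div]
    exact exp_neg_le_quadratic
      (div_nonneg (backCost_nonneg hT hH hw hπ hπ1 hc x a) (hw x).le)
  have h3 : ∑ a, π x a * (backCost H level child w π c x a -
      backCost H level child w π c x a ^ 2 / (2 * w x)) =
      -w x * (∑ a, π x a * (1 - backCost H level child w π c x a / w x +
        (backCost H level child w π c x a / w x) ^ 2 / 2) - 1) := by
    have hS : ∀ S : ℝ, S - 1 = S - ∑ a, π x a := fun S => by rw [hπ1]
    rw [hS, ← Finset.sum_sub_distrib, Finset.mul_sum]
    refine Finset.sum_congr rfl fun a _ => ?_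
    have := (hw x).ne'
    field_simp
    ring
  rw [h3]
  have := hw x
  nlinarith

/-- Jensen's inequality for `exp`: the soft minimum is at most the mean. -/
theorem backValue_le [Nonempty K] (hT : IsGradedTree level child) (hH : ∀ x, level x < H)
    (hw : ∀ x, 0 < w x) (hπ : ∀ x a, 0 < π x a) (hπ1 : ∀ x, ∑ a, π x a = 1) (x : I) :
    backValue H level child w π c x ≤ ∑ a, π x a * backCost H level child w π c x a := by
  have hs : 0 < ∑ a, π x a * Real.exp (-backCost H level child w π c x a / w x) :=
    Finset.sum_pos (fun a _ => mul_pos (hπ x a) (Real.exp_pos _)) Finset.univ_nonempty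
  rw [backValue_eq hT hH]
  have h1 := convexOn_exp.map_sum_le (t := Finset.univ) (w := π x)
    (p := fun a => -backCost H level child w π c x a / w x) (fun a _ => (hπ x a).le) (hπ1 x)
    (fun a _ => Set.mem_univ _)
  simp only [smul_eq_mul] at h1
  have h2 := (Real.le_log_iff_exp_le hs).2 h1
  have h3 : ∑ a, π x a * (-backCost H level child w π c x a / w x) =
      -(∑ a, π x a * backCost H level child w π c x a) / w x := by
    rw [← Finset.sum_neg_distrib, Finset.sum_div]
    exact Finset.sum_congr rfl fun a _ => by ring
  rw [h3, div_le_iff₀ (hw x)] at h2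
  linarith

/-- The value of a step of mirror descent, up to a second-order term. -/
theorem sum_root_backValue_ge [Nonempty K] (hT : IsGradedTree level child)
    (hH : ∀ x, level x < H) (hw : ∀ x, 0 < w x) {μ₀ : I → K → ℝ}
    (hμ₀ : μ₀ ∈ treeplex (fun x => level x = 0) child) (h₀ : ∀ x a, 0 < μ₀ x a)
    (hc : ∀ x a, 0 ≤ c x a) :
    pairing μ₀ c - ∑ x, ∑ a, μ₀ x a *
        backCost H level child w (policyOf μ₀) c x a ^ 2 / (2 * w x) ≤
      ∑ x, if level x = 0 then backValue H level child w (policyOf μ₀) c x else 0 := by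
  have hm : ∀ x, ∑ a, μ₀ x a ≠ 0 := fun x =>
    (Finset.sum_pos (fun a _ => h₀ x a) Finset.univ_nonempty).ne'
  have hs := sum_mass_mul hT hμ₀ (backValue H level child w (policyOf μ₀) c)
  have h1 : ∑ x, (∑ a, μ₀ x a) * ∑ a, policyOf μ₀ x a *
      (backCost H level child w (policyOf μ₀) c x a -
        backCost H level child w (policyOf μ₀) c x a ^ 2 / (2 * w x)) ≤
      ∑ x, (∑ a, μ₀ x a) * backValue H level child w (policyOf μ₀) c x :=
    Finset.sum_le_sum fun x _ => mul_le_mul_of_nonneg_left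
      (backValue_ge hT hH hw (policyOf_pos h₀) (fun x => sum_policyOf (hm x)) hc x)
      (mass_nonneg hμ₀ x)
  have h2 : ∑ x, (∑ a, μ₀ x a) * ∑ a, policyOf μ₀ x a *
      (backCost H level child w (policyOf μ₀) c x a -
        backCost H level child w (policyOf μ₀) c x a ^ 2 / (2 * w x)) =
      pairing μ₀ c + ∑ x, ∑ a, μ₀ x a * (∑ x', if child x a x' then
        backValue H level child w (policyOf μ₀) c x' else 0) - ∑ x, ∑ a, μ₀ x a *
        backCost H level child w (policyOf μ₀) c x a ^ 2 / (2 * w x) := by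
    simp_rw [pairing, ← Finset.sum_add_distrib, ← Finset.sum_sub_distrib, Finset.mul_sum,
      ← mul_assoc, mul_policyOf hμ₀]
    refine Finset.sum_congr rfl fun x _ => Finset.sum_congr rfl fun a _ => ?_
    rw [backCost, ← Finset.mul_sum]
    ring
  linarith

/-- One step of mirror descent, up to a second-order term. -/
theorem pairing_sub_le [Nonempty K] (hT : IsGradedTree level child)
    (hH : ∀ x, level x < H) (hw : ∀ x, 0 < w x) {μ μ₀ μ₁ : I → K → ℝ}
    (hμ : μ ∈ treeplex (fun x => level x = 0) child)
    (hμ₀ : μ₀ ∈ treeplex (fun x => level x = 0) child) (h₀ : ∀ x a, 0 < μ₀ x a)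
    (h₁ : ∀ x a, policyOf μ₁ x a = nextPolicy H level child w (policyOf μ₀) c x a)
    (hc : ∀ x a, 0 ≤ c x a) :
    pairing μ₀ c - pairing μ c ≤ wKL w μ μ₀ - wKL w μ μ₁ + ∑ x, ∑ a, μ₀ x a *
        backCost H level child w (policyOf μ₀) c x a ^ 2 / (2 * w x) := by
  have h1 := pairing_add_wKL (H := H) hT hw hμ h₀ h₁
  have h2 := sum_root_backValue_ge hT hH hw hμ₀ h₀ hc
  linarith

end Treeplex

/-! ### Second-order terms for costs supported on one path. -/

/-- The pairs of infosets and actions visited by a trajectory. -/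
structure IsPlayPath {I K : Type*} (level : I → ℕ) (child : I → K → I → Prop)
    (on : I → K → Prop) : Prop where
  unique : ∀ {x a y b}, on x a → on y b → level x = level y → x = y ∧ a = b
  parent : ∀ {x a x' a'}, child x a x' → on x' a' → on x a

section PlayPath

variable {I K : Type*} [Fintype I] [Fintype K] {level : I → ℕ} {child : I → K → I → Prop}
  {on : I → K → Prop} {H : ℕ} {w : I → ℝ} {π c : I → K → ℝ}

theorem IsPlayPath.card_le (ho : IsPlayPath level child on) (hH : ∀ x, level x < H) :
    (Finset.univ.filter fun q : I × K => on q.1 q.2).card ≤ H := by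
  rw [← Finset.card_range H]
  refine Finset.card_le_card_of_injOn (fun q => level q.1) (fun q _ => by simpa using hH q.1) ?_
  intro q hq q' hq' h
  have := ho.unique (by simpa using hq) (by simpa using hq') h
  exact Prod.ext this.1 this.2

/-- The weight of a pair is split among its successors, so weights can only decrease along a path.
-/
theorem IsPlayPath.le_of_level_le (hT : IsGradedTree level child) (ho : IsPlayPath level child on)
    {μ : I → K → ℝ} (hμ : μ ∈ treeplex (fun x => level x = 0) child) {x y : I} {a b : K}
    (hx : on x a) (hy : on y b) (h : level x ≤ level y) : μ y b ≤ μ x a := by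
  induction hn : level y - level x generalizing y b with
  | zero =>
    obtain ⟨rfl, rfl⟩ := ho.unique hx hy (by omega)
    exact le_rfl
  | succ n ih =>
    obtain ⟨p, q, hpq⟩ := hT.exists_parent (x' := y) (by omega)
    have h1 := hT.level_child hpq
    refine (le_mass hμ y b).trans ?_
    rw [hμ.2.2 _ _ _ hpq]
    exact ih (ho.parent hpq hy) (by omega) (by omega)

variable [Nonempty K]

/-- A path that misses an infoset misses everything after it, so all costs-to-go there are zero and
the partition function is one. -/
theorem backValue_eq_zero (hT : IsGradedTree level child) (hH : ∀ x, level x < H)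
    (hπ1 : ∀ x, ∑ a, π x a = 1) (ho : IsPlayPath level child on)
    (hc : ∀ x a, ¬ on x a → c x a = 0) {x : I} (hx : ∀ a, ¬ on x a) :
    backValue H level child w π c x = 0 := by
  induction hn : H - level x generalizing x with
  | zero => have := hH x; omega
  | succ n ih =>
    have hU : ∀ a, backCost H level child w π c x a = 0 := by
      intro a
      rw [backCost, hc x a (hx a), zero_add]
      refine Finset.sum_eq_zero fun x' _ => ?_
      split_ifs with h
      · have := hT.level_child h
        exact ih (fun a' h' => hx a (ho.parent h h')) (by omega)
      · rfl
    rw [backValue_eq hT hH]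
    simp [hU, hπ1]

theorem backCost_eq_zero (hT : IsGradedTree level child) (hH : ∀ x, level x < H)
    (hπ1 : ∀ x, ∑ a, π x a = 1) (ho : IsPlayPath level child on)
    (hc : ∀ x a, ¬ on x a → c x a = 0) {x : I} {a : K} (hx : ¬ on x a) :
    backCost H level child w π c x a = 0 := by
  rw [backCost, hc x a hx, zero_add]
  refine Finset.sum_eq_zero fun x' _ => ?_
  split_ifs with h
  · exact backValue_eq_zero hT hH hπ1 ho hc fun a' h' => hx (ho.parent h h')
  · rfl

/-- At most one successor lies on the path. Bounding its value by the mean cost-to-go turns the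
recursion into a sum over the rest of the path, with `μ₀(x, a)` replaced by the weights of the later
pairs. -/
theorem mul_backCost_le (hT : IsGradedTree level child) (hH : ∀ x, level x < H)
    (hw : ∀ x, 0 < w x) {μ₀ : I → K → ℝ}
    (hμ₀ : μ₀ ∈ treeplex (fun x => level x = 0) child) (h₀ : ∀ x a, 0 < μ₀ x a)
    (ho : IsPlayPath level child on) (hc : ∀ x a, ¬ on x a → c x a = 0)
    (hc0 : ∀ x a, 0 ≤ c x a) (x : I) (a : K) (hx : on x a) :
    μ₀ x a * backCost H level child w (policyOf μ₀) c x a ≤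
      ∑ q : I × K, if on q.1 q.2 ∧ level x ≤ level q.1 then μ₀ q.1 q.2 * c q.1 q.2 else 0 := by
  have hm : ∀ x, ∑ a, μ₀ x a ≠ 0 := fun x =>
    (Finset.sum_pos (fun a _ => h₀ x a) Finset.univ_nonempty).ne'
  have hπ1 : ∀ x, ∑ a, policyOf μ₀ x a = 1 := fun x => sum_policyOf (hm x)
  have hB : ∀ n, 0 ≤ ∑ q : I × K, if on q.1 q.2 ∧ n ≤ level q.1 then μ₀ q.1 q.2 * c q.1 q.2
      else 0 := fun n => Finset.sum_nonneg fun q _ => by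
    split_ifs
    · exact mul_nonneg (h₀ _ _).le (hc0 _ _)
    · exact le_rfl
  induction hn : H - level x generalizing x a with
  | zero => have := hH x; omega
  | succ n ih =>
    have h1 : μ₀ x a * (∑ x', if child x a x' then backValue H level child w (policyOf μ₀) c x'
        else 0) ≤ ∑ q : I × K, if on q.1 q.2 ∧ level x + 1 ≤ level q.1 then
          μ₀ q.1 q.2 * c q.1 q.2 else 0 := by
      by_cases hex : ∃ x' a', child x a x' ∧ on x' a'
      · obtain ⟨x', a', hch, hon⟩ := hex
        have hl := hT.level_child hch
        rw [Finset.sum_eq_single x']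
        · rw [if_pos hch, ← hμ₀.2.2 _ _ _ hch]
          refine (mul_le_mul_of_nonneg_left (backValue_le hT hH hw (policyOf_pos h₀) hπ1 x')
            (mass_nonneg hμ₀ x')).trans ?_
          rw [Finset.mul_sum, Finset.sum_eq_single a']
          · rw [← mul_assoc, mul_policyOf hμ₀, ← hl]
            exact ih x' a' hon (by omega)
          · intro b _ hb
            rw [backCost_eq_zero hT hH hπ1 ho hc fun h => hb (ho.unique h hon rfl).2]
            simp
          · simp
        · intro y _ hy
          split_ifs with h
          · refine backValue_eq_zero hT hH hπ1 ho hc fun b hb => hy (ho.unique hb hon ?_).1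
            rw [hT.level_child h, hl]
          · rfl
        · simp
      · push Not at hex
        rw [Finset.sum_eq_zero, mul_zero]
        · exact hB _
        · intro y _
          split_ifs with h
          · exact backValue_eq_zero hT hH hπ1 ho hc fun b => hex y b h
          · rfl
    have h2 : μ₀ x a * c x a + (∑ q : I × K, if on q.1 q.2 ∧ level x + 1 ≤ level q.1 then
          μ₀ q.1 q.2 * c q.1 q.2 else 0) ≤
        ∑ q : I × K, if on q.1 q.2 ∧ level x ≤ level q.1 then μ₀ q.1 q.2 * c q.1 q.2 else 0 := by
      have h3 : μ₀ x a * c x a = ∑ q : I × K, if q = (x, a) then μ₀ q.1 q.2 * c q.1 q.2 else 0 := by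
        simp
      rw [h3, ← Finset.sum_add_distrib]
      refine Finset.sum_le_sum fun q _ => ?_
      by_cases hq : q = (x, a)
      · subst hq
        simp [hx]
      · rw [if_neg hq, zero_add]
        split_ifs with h4 h5 h5
        · exact le_rfl
        · exact absurd ⟨h4.1, by omega⟩ h5
        · exact mul_nonneg (h₀ _ _).le (hc0 _ _)
        · exact le_rfl
    rw [backCost, mul_add]
    linarith

/-- The second-order term of a step of unweighted mirror descent. -/
theorem sum_backCost_sq_le (hT : IsGradedTree level child) (hH : ∀ x, level x < H)
    {μ₀ : I → K → ℝ} (hμ₀ : μ₀ ∈ treeplex (fun x => level x = 0) child) (h₀ : ∀ x a, 0 < μ₀ x a)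
    (ho : IsPlayPath level child on) (hc : ∀ x a, ¬ on x a → c x a = 0)
    (hc0 : ∀ x a, 0 ≤ c x a) :
    ∑ x, ∑ a, μ₀ x a * backCost H level child (fun _ => 1) (policyOf μ₀) c x a ^ 2 / (2 * 1) ≤
      (H : ℝ) ^ 2 / 2 * ∑ x, ∑ a, if on x a then μ₀ x a * c x a ^ 2 else 0 := by
  have hm : ∀ x, ∑ a, μ₀ x a ≠ 0 := fun x =>
    (Finset.sum_pos (fun a _ => h₀ x a) Finset.univ_nonempty).ne'
  have hπ1 : ∀ x, ∑ a, policyOf μ₀ x a = 1 := fun x => sum_policyOf (hm x)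
  set Q := ∑ x, ∑ a, if on x a then μ₀ x a * c x a ^ 2 else 0 with hQ
  have hQ0 : 0 ≤ Q := Finset.sum_nonneg fun x _ => Finset.sum_nonneg fun a _ => by
    have := (h₀ x a).le
    split_ifs <;> positivity
  have hcard : ((Finset.univ.filter fun q : I × K => on q.1 q.2).card : ℝ) ≤ H := by
    exact_mod_cast ho.card_le hH
  have key : ∀ x a, μ₀ x a * backCost H level child (fun _ => 1) (policyOf μ₀) c x a ^ 2 / (2 * 1)
      ≤ if on x a then H * Q / 2 else 0 := by
    intro x a
    split_ifs with hx
    · set U := backCost H level child (fun _ => 1) (policyOf μ₀) c x a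
      have hU : 0 ≤ U := backCost_nonneg hT hH (fun _ => one_pos) (policyOf_pos h₀) hπ1 hc0 x a
      have h1 := mul_backCost_le (w := fun _ => 1) hT hH (fun _ => one_pos) hμ₀ h₀ ho hc hc0 x a hx
      rw [← Finset.sum_filter] at h1
      -- Cauchy–Schwarz over the at most `H` remaining pairs of the path.
      have h3 := sq_sum_le_card_mul_sum_sq
        (s := Finset.univ.filter fun q : I × K => on q.1 q.2 ∧ level x ≤ level q.1)
        (f := fun q => μ₀ q.1 q.2 * c q.1 q.2)
      have h4 : ((Finset.univ.filter fun q : I × K =>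
          on q.1 q.2 ∧ level x ≤ level q.1).card : ℝ) ≤ H := by
        refine le_trans ?_ hcard
        exact_mod_cast Finset.card_le_card fun q hq => by
          simp only [Finset.mem_filter, Finset.mem_univ, true_and] at hq ⊢
          exact hq.1
      -- One factor of `μ₀` at a later pair is replaced by the larger `μ₀ x a`; dividing it out
      -- below leaves `μ₀ U² ≤ H Q`.
      have h5 : ∑ q ∈ Finset.univ.filter (fun q : I × K => on q.1 q.2 ∧ level x ≤ level q.1),
          (μ₀ q.1 q.2 * c q.1 q.2) ^ 2 ≤ μ₀ x a * Q := by
        rw [hQ, ← Fintype.sum_prod_type' (f := fun x a => if on x a then μ₀ x a * c x a ^ 2 else 0),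
          Finset.mul_sum, Finset.sum_filter]
        refine Finset.sum_le_sum fun q _ => ?_
        have hp := (h₀ q.1 q.2).le
        have hx0 := (h₀ x a).le
        split_ifs with h6 h7 h7
        · have := ho.le_of_level_le hT hμ₀ hx h6.1 h6.2
          rw [mul_pow, sq, mul_assoc]
          exact mul_le_mul_of_nonneg_right this (by positivity)
        · exact absurd h6.1 h7
        · positivity
        · simp
      have h6 : (μ₀ x a * U) ^ 2 ≤ H * (μ₀ x a * Q) := by
        have hs : (μ₀ x a * U) ^ 2 ≤ (∑ q ∈ Finset.univ.filter
            (fun q : I × K => on q.1 q.2 ∧ level x ≤ level q.1), μ₀ q.1 q.2 * c q.1 q.2) ^ 2 :=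
          pow_le_pow_left₀ (mul_nonneg (h₀ x a).le hU) h1 2
        refine hs.trans (h3.trans ?_)
        exact mul_le_mul h4 h5 (Finset.sum_nonneg fun q _ => sq_nonneg _) (Nat.cast_nonneg _)
      have h7 : μ₀ x a * (μ₀ x a * U ^ 2) ≤ μ₀ x a * (H * Q) := by nlinarith
      have h8 := le_of_mul_le_mul_left h7 (h₀ x a)
      linarith
    · rw [backCost_eq_zero hT hH hπ1 ho hc hx]; simp
  calc _ ≤ ∑ x, ∑ a, if on x a then H * Q / 2 else 0 :=
        Finset.sum_le_sum fun x _ => Finset.sum_le_sum fun a _ => key x a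
    _ = ((Finset.univ.filter fun q : I × K => on q.1 q.2).card : ℝ) * (H * Q / 2) := by
        rw [← Fintype.sum_prod_type' (f := fun x a => if on x a then H * Q / 2 else 0),
          ← Finset.sum_filter, Finset.sum_const, nsmul_eq_mul]
    _ ≤ H * (H * Q / 2) := mul_le_mul_of_nonneg_right hcard (by positivity)
    _ = _ := by ring

/-- The second-order term of a step of weighted mirror descent. -/
theorem sum_backCost_sq_le_weighted (hT : IsGradedTree level child) (hH : ∀ x, level x < H)
    (hw : ∀ x, 0 < w x) {μ₀ : I → K → ℝ}
    (hμ₀ : μ₀ ∈ treeplex (fun x => level x = 0) child) (h₀ : ∀ x a, 0 < μ₀ x a)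
    (ho : IsPlayPath level child on) (hc : ∀ x a, ¬ on x a → c x a = 0)
    (hc0 : ∀ x a, 0 ≤ c x a) {τ : ℝ} (hτ : 0 ≤ τ) (hcτ : ∀ x a, μ₀ x a * c x a ≤ τ) :
    ∑ x, ∑ a, μ₀ x a * backCost H level child w (policyOf μ₀) c x a ^ 2 / (2 * w x) ≤
      (τ * H) ^ 2 / 2 * ∑ x, ∑ a, if on x a then 1 / (w x * μ₀ x a) else 0 := by
  have hm : ∀ x, ∑ a, μ₀ x a ≠ 0 := fun x =>
    (Finset.sum_pos (fun a _ => h₀ x a) Finset.univ_nonempty).ne'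
  have hπ1 : ∀ x, ∑ a, policyOf μ₀ x a = 1 := fun x => sum_policyOf (hm x)
  have hcard : ((Finset.univ.filter fun q : I × K => on q.1 q.2).card : ℝ) ≤ H := by
    exact_mod_cast ho.card_le hH
  simp_rw [Finset.mul_sum]
  refine Finset.sum_le_sum fun x _ => Finset.sum_le_sum fun a _ => ?_
  split_ifs with hx
  · set U := backCost H level child w (policyOf μ₀) c x a
    have hU : 0 ≤ U := backCost_nonneg hT hH hw (policyOf_pos h₀) hπ1 hc0 x a
    have h1 := mul_backCost_le (w := w) hT hH hw hμ₀ h₀ ho hc hc0 x a hx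
    have h2 : ∑ q : I × K, (if on q.1 q.2 ∧ level x ≤ level q.1 then μ₀ q.1 q.2 * c q.1 q.2
        else 0) ≤ ∑ q : I × K, if on q.1 q.2 then τ else 0 := by
      refine Finset.sum_le_sum fun q _ => ?_
      split_ifs with h3 h4 h4
      · exact hcτ _ _
      · exact absurd h3.1 h4
      · exact hτ
      · exact le_rfl
    rw [← Finset.sum_filter (fun q : I × K => on q.1 q.2), Finset.sum_const, nsmul_eq_mul] at h2
    -- At most `H` pairs of the path remain, each contributing at most `τ`.
    have h3 : μ₀ x a * U ≤ τ * H :=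
      (h1.trans h2).trans (by rw [mul_comm τ]; exact mul_le_mul_of_nonneg_right hcard hτ)
    have h4 : (μ₀ x a * U) ^ 2 ≤ (τ * H) ^ 2 := pow_le_pow_left₀ (mul_nonneg (h₀ x a).le hU) h3 2
    have hp := h₀ x a
    have hwx := hw x
    have h5 : μ₀ x a * U ^ 2 / (2 * w x) = (μ₀ x a * U) ^ 2 / 2 * (1 / (w x * μ₀ x a)) := by
      field_simp
    rw [h5]
    gcongr
  · rw [backCost_eq_zero hT hH hπ1 ho hc hx]; simp

end PlayPath

/-! ### Alice's tree of infosets, reaching probabilities and strategies of policies. -/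

namespace EFG

variable {H nS nX nY A B : ℕ} {G : EFG H nS nX nY A B}

/-- The stage of an infoset is read off an arbitrary state in it; perfect recall makes the choice
irrelevant. -/
theorem level_x (hG : G.IsTreePerfectRecall) (s : Fin nS) : G.level (G.x s) = G.stage s :=
  hG.x_stage _ _ (Function.surjInv_eq G.x_surj _)

theorem levelY_y (hG : G.IsTreePerfectRecall) (s : Fin nS) : G.levelY (G.y s) = G.stage s :=
  hG.y_stage _ _ (Function.surjInv_eq G.y_surj _)

theorem isGradedTree_childX (hG : G.IsTreePerfectRecall) :
    IsGradedTree (fun x => (G.level x : ℕ)) G.childX where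
  level_child := by
    rintro _ a _ ⟨s, b, s', rfl, rfl, h⟩
    simp only [level_x hG, G.p_stage _ _ _ _ h]
  exists_parent := by
    intro x' h
    obtain ⟨s', rfl⟩ := G.x_surj x'
    rw [level_x hG] at h
    obtain ⟨q, hq, -⟩ := hG.tree s' h
    exact ⟨_, _, q.1, q.2.2, s', rfl, rfl, hq⟩
  parent_unique := by
    rintro _ _ a b _ ⟨s, b1, s', rfl, rfl, h⟩ ⟨r, b2, r', rfl, h1, h2⟩
    exact hG.x_recall _ _ _ _ _ _ _ _ h1.symm h h2

theorem level_childX (hG : G.IsTreePerfectRecall) {x x' : Fin nX} {a : Fin A}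
    (h : G.childX x a x') : (G.level x' : ℕ) = G.level x + 1 :=
  (isGradedTree_childX hG).level_child h

theorem exists_stage_zero (G : EFG H nS nX nY A B) : ∃ s, (G.stage s : ℕ) = 0 := by
  by_contra! h
  have : ∑ s, G.p0 s = 0 := Finset.sum_eq_zero fun s _ => by
    by_contra h0
    exact h s (G.p0_stage s h0)
  linarith [G.p0_sum]

theorem horizon_pos (G : EFG H nS nX nY A B) : 0 < H :=
  (Nat.zero_le _).trans_lt (G.stage G.exists_stage_zero.choose).2

/-- Before the last stage the transition probabilities sum to one, so they cannot all vanish. -/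
theorem exists_childX (hG : G.IsTreePerfectRecall) (hB : 0 < B) (x : Fin nX) (a : Fin A)
    (hx : (G.level x : ℕ) + 1 < H) : ∃ x', G.childX x a x' := by
  obtain ⟨s, rfl⟩ := G.x_surj x
  rw [level_x hG] at hx
  by_contra! h
  have h1 := G.p_sum s a ⟨0, hB⟩ hx
  rw [Finset.sum_eq_zero] at h1
  · exact zero_ne_one h1
  · intro s' _
    by_contra h0
    exact h (G.x s') ⟨s, _, s', rfl, rfl, h0⟩

/-! ### Reaching probabilities -/

theorem reachAux_nonneg (n : ℕ) (s : Fin nS) : 0 ≤ G.reachAux n s := by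
  induction n generalizing s with
  | zero => exact G.p0_nonneg s
  | succ n ih =>
    exact Finset.sum_nonneg fun r _ => Finset.sum_nonneg fun a _ => Finset.sum_nonneg fun b _ =>
      mul_nonneg (ih r) (G.p_nonneg r a b s)

theorem stage_of_reachAux_ne_zero {n : ℕ} {s : Fin nS} (h : G.reachAux n s ≠ 0) :
    (G.stage s : ℕ) = n := by
  induction n generalizing s with
  | zero => exact G.p0_stage s h
  | succ n ih =>
    obtain ⟨r, -, hr⟩ := Finset.exists_ne_zero_of_sum_ne_zero h
    obtain ⟨a, -, ha⟩ := Finset.exists_ne_zero_of_sum_ne_zero hr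
    obtain ⟨b, -, hb⟩ := Finset.exists_ne_zero_of_sum_ne_zero ha
    rw [G.p_stage _ _ _ _ (right_ne_zero_of_mul hb), ih (left_ne_zero_of_mul hb)]

theorem reach_nonneg (s : Fin nS) : 0 ≤ G.reach s := reachAux_nonneg _ _

/-- Conservation of probability from one stage to the next: the treeplex constraints replace the
mass at the successor by the weight of the pair played, and the transitions then sum out. -/
theorem sum_reachAux_mul_mass (hG : G.IsTreePerfectRecall) {μ : Fin nX → Fin A → ℝ}
    {ν : Fin nY → Fin B → ℝ} (hμ : μ ∈ G.TX) (hν : ν ∈ G.TY) {n : ℕ} (hn : n < H) :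
    ∑ s, G.reachAux n s * ((∑ a, μ (G.x s) a) * ∑ b, ν (G.y s) b) = 1 := by
  induction n with
  | zero =>
    rw [← G.p0_sum]
    refine Finset.sum_congr rfl fun s _ => ?_
    by_cases h : G.p0 s = 0
    · simp [reachAux, h]
    · have h0 := G.p0_stage s h
      have hx : (G.level (G.x s) : ℕ) = 0 := by rw [level_x hG, h0]
      have hy : (G.levelY (G.y s) : ℕ) = 0 := by rw [levelY_y hG, h0]
      rw [hμ.2.1 _ hx, hν.2.1 _ hy]
      simp [reachAux]
  | succ n ih =>
    rw [← ih (by omega)]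
    have h1 : ∀ s, G.reachAux (n + 1) s * ((∑ a, μ (G.x s) a) * ∑ b, ν (G.y s) b) =
        ∑ r, ∑ a, ∑ b, G.reachAux n r * (μ (G.x r) a * ν (G.y r) b) * G.p r a b s := by
      intro s
      rw [reachAux, Finset.sum_mul]
      refine Finset.sum_congr rfl fun r _ => ?_
      rw [Finset.sum_mul]
      refine Finset.sum_congr rfl fun a _ => ?_
      rw [Finset.sum_mul]
      refine Finset.sum_congr rfl fun b _ => ?_
      by_cases h : G.p r a b s = 0
      · simp [h]
      · rw [hμ.2.2 (G.x r) a (G.x s) ⟨r, b, s, rfl, rfl, h⟩,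
          hν.2.2 (G.y r) b (G.y s) ⟨r, a, s, rfl, rfl, h⟩]
        ring
    simp_rw [h1]
    rw [Finset.sum_comm]
    refine Finset.sum_congr rfl fun r _ => ?_
    rw [Finset.sum_comm, Finset.sum_mul_sum, Finset.mul_sum]
    refine Finset.sum_congr rfl fun a _ => ?_
    rw [Finset.sum_comm, Finset.mul_sum]
    refine Finset.sum_congr rfl fun b _ => ?_
    rw [← Finset.mul_sum]
    by_cases h : G.reachAux n r = 0
    · simp [h]
    · rw [G.p_sum r a b (by rw [stage_of_reachAux_ne_zero h]; exact hn), mul_one]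

/-- The weight with which chance and Bob lead to an infoset of Alice. -/
noncomputable def occ (G : EFG H nS nX nY A B) (ν : Fin nY → Fin B → ℝ) (x : Fin nX) : ℝ :=
  ∑ s, if G.x s = x then G.reach s * ∑ b, ν (G.y s) b else 0

theorem occ_nonneg {ν : Fin nY → Fin B → ℝ} (hν : ν ∈ G.TY) (x : Fin nX) : 0 ≤ G.occ ν x :=
  Finset.sum_nonneg fun s _ => by
    split_ifs
    · exact mul_nonneg (reach_nonneg s) (mass_nonneg hν _)
    · exact le_rfl

/-- All occupancy estimates rest on this: at each stage, mass times occupancy is a probability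
distribution over Alice's infosets, for any strategy. -/
theorem sum_mass_mul_occ (hG : G.IsTreePerfectRecall) {μ : Fin nX → Fin A → ℝ}
    {ν : Fin nY → Fin B → ℝ} (hμ : μ ∈ G.TX) (hν : ν ∈ G.TY) (h : Fin H) :
    ∑ x, (if G.level x = h then (∑ a, μ x a) * G.occ ν x else 0) = 1 := by
  rw [← sum_reachAux_mul_mass hG hμ hν h.2]
  have h1 : ∀ x, (if G.level x = h then (∑ a, μ x a) * G.occ ν x else 0) =
      ∑ s, if G.x s = x then G.reachAux h s * ((∑ a, μ (G.x s) a) * ∑ b, ν (G.y s) b) else 0 := by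
    intro x
    have h2 : ∀ (p : Prop) [Decidable p] (f : Fin nS → ℝ), (if p then ∑ s, f s else 0) =
        ∑ s, if p then f s else 0 := fun p _ f => by split_ifs <;> simp
    rw [occ, Finset.mul_sum, h2]
    refine Finset.sum_congr rfl fun s _ => ?_
    by_cases hx : G.x s = x
    · subst hx
      rw [if_pos rfl, if_pos rfl, level_x hG]
      split_ifs with hs
      · rw [reach, hs]; ring
      · by_contra h0
        exact hs (Fin.ext (stage_of_reachAux_ne_zero (left_ne_zero_of_mul (Ne.symm h0))))
    · simp [hx]
  simp_rw [h1]
  rw [Finset.sum_comm]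
  simp

/-! ### Descendants of infosets -/

/-- `x'` is `x` or comes after `x`. -/
def Below (G : EFG H nS nX nY A B) (x x' : Fin nX) : Prop :=
  Relation.ReflTransGen (fun u v => ∃ a', G.childX u a' v) x x'

theorem Below.level_le (hG : G.IsTreePerfectRecall) {x x' : Fin nX} (h : G.Below x x') :
    G.level x ≤ G.level x' := by
  induction h with
  | refl => exact le_rfl
  | tail _ h ih =>
    obtain ⟨a, ha⟩ := h
    have := level_childX hG ha
    rw [Fin.le_def] at ih ⊢
    omega

theorem Below.eq_of_level_eq (hG : G.IsTreePerfectRecall) {x x' : Fin nX} (h : G.Below x x')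
    (hl : G.level x = G.level x') : x = x' := by
  rcases Relation.ReflTransGen.cases_tail h with h | ⟨z, hz, a, ha⟩
  · exact h.symm
  · have h1 := level_childX hG ha
    have h2 := Fin.le_def.1 (Below.level_le hG hz)
    rw [Fin.ext_iff] at hl
    omega

/-- Both chains of predecessors of `z` are followed backwards; uniqueness of the predecessor pair
keeps them together until the common stage. -/
theorem Below.unique (hG : G.IsTreePerfectRecall) {x y z : Fin nX} (hx : G.Below x z)
    (hy : G.Below y z) (hl : G.level x = G.level y) : x = y := by
  induction hx with
  | refl => exact (hy.eq_of_level_eq hG hl.symm).symm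
  | @tail u v hu h ih =>
    obtain ⟨a, ha⟩ := h
    have h1 := level_childX hG ha
    have h2 := Fin.le_def.1 (Below.level_le hG hu)
    rcases Relation.ReflTransGen.cases_tail hy with h | ⟨u', hu', a', ha'⟩
    · subst h
      rw [Fin.ext_iff] at hl
      omega
    · obtain ⟨rfl, rfl⟩ := (isGradedTree_childX hG).parent_unique ha ha'
      exact ih hu'

theorem through_iff {x x' : Fin nX} {a : Fin A} :
    G.Through x a x' ↔ ∃ x₁, G.childX x a x₁ ∧ G.Below x₁ x' := Iff.rfl

theorem Through.level_lt (hG : G.IsTreePerfectRecall) {x x' : Fin nX} {a : Fin A}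
    (h : G.Through x a x') : G.level x < G.level x' := by
  obtain ⟨x₁, h1, h2⟩ := through_iff.1 h
  have h3 := level_childX hG h1
  have h4 := Fin.le_def.1 (Below.level_le hG h2)
  rw [Fin.lt_def]
  omega

theorem Through.action_unique (hG : G.IsTreePerfectRecall) {x x' : Fin nX} {a b : Fin A}
    (h : G.Through x a x') (h' : G.Through x b x') : a = b := by
  obtain ⟨x₁, h1, h2⟩ := through_iff.1 h
  obtain ⟨x₂, h3, h4⟩ := through_iff.1 h'
  have h5 := level_childX hG h1
  have h6 := level_childX hG h3
  obtain rfl := h2.unique hG h4 (Fin.ext (by omega))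
  exact ((isGradedTree_childX hG).parent_unique h1 h3).2

theorem through_child (hG : G.IsTreePerfectRecall) {x x' y : Fin nX} {a b : Fin A}
    (h : G.childX x a x') : G.Through y b x' ↔ G.Through y b x ∨ (y = x ∧ b = a) := by
  constructor
  · rintro ⟨x₁, h1, h2⟩
    rcases Relation.ReflTransGen.cases_tail h2 with rfl | ⟨z, hz, a', ha'⟩
    · exact Or.inr ((isGradedTree_childX hG).parent_unique h1 h)
    · obtain ⟨rfl, rfl⟩ := (isGradedTree_childX hG).parent_unique ha' h
      exact Or.inl ⟨x₁, h1, hz⟩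
  · rintro (⟨x₁, h1, h2⟩ | ⟨rfl, rfl⟩)
    · exact ⟨x₁, h1, h2.tail ⟨a, h⟩⟩
    · exact ⟨x', h, Relation.ReflTransGen.refl⟩

theorem below_iff_exists_through {x z : Fin nX}
    (hl : G.level x < G.level z) : G.Below x z ↔ ∃ a, G.Through x a z := by
  constructor
  · intro h
    rcases Relation.ReflTransGen.cases_head h with rfl | ⟨x₁, ⟨a, ha⟩, h2⟩
    · exact absurd hl (lt_irrefl _)
    · exact ⟨a, x₁, ha, h2⟩
  · rintro ⟨a, x₁, h1, h2⟩
    exact Relation.ReflTransGen.head ⟨a, h1⟩ h2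

theorem exists_below (hG : G.IsTreePerfectRecall) (hA : 0 < A) (hB : 0 < B) (h : Fin H)
    (x : Fin nX) (hx : G.level x ≤ h) : ∃ z, G.level z = h ∧ G.Below x z := by
  induction hn : (h : ℕ) - G.level x generalizing x with
  | zero =>
    refine ⟨x, Fin.ext ?_, Relation.ReflTransGen.refl⟩
    rw [Fin.le_def] at hx
    omega
  | succ n ih =>
    obtain ⟨x', hx'⟩ := exists_childX hG hB x ⟨0, hA⟩ (by omega)
    have h1 := level_childX hG hx'
    obtain ⟨z, hz, hz'⟩ := ih x' (Fin.le_def.2 (by omega)) (by omega)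
    exact ⟨z, hz, Relation.ReflTransGen.head ⟨_, hx'⟩ hz'⟩

/-! ### Strategies of policies -/

/-- The probability with which a policy of Alice leads to an infoset. -/
noncomputable def ownReach (G : EFG H nS nX nY A B) (π : Fin nX → Fin A → ℝ) (x : Fin nX) : ℝ :=
  ∏ x', ∏ a', if G.Through x' a' x then π x' a' else 1

theorem seqForm_eq (π : Fin nX → Fin A → ℝ) (x : Fin nX) (a : Fin A) :
    G.seqForm π x a = π x a * G.ownReach π x := rfl

theorem ownReach_pos {π : Fin nX → Fin A → ℝ} (hπ : ∀ x a, 0 < π x a) (x : Fin nX) :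
    0 < G.ownReach π x :=
  Finset.prod_pos fun x' _ => Finset.prod_pos fun a' _ => by
    split_ifs
    · exact hπ _ _
    · exact one_pos

theorem ownReach_root (hG : G.IsTreePerfectRecall) (π : Fin nX → Fin A → ℝ) {x : Fin nX}
    (hx : (G.level x : ℕ) = 0) : G.ownReach π x = 1 :=
  Finset.prod_eq_one fun x' _ => Finset.prod_eq_one fun a' _ => by
    rw [if_neg]
    intro h
    have := Fin.lt_def.1 (h.level_lt hG)
    omega

/-- The product runs over all pairs of the game; passing to a successor of `(x, a)` changes only the
factor at `(x, a)` itself. -/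
theorem ownReach_child (hG : G.IsTreePerfectRecall) (π : Fin nX → Fin A → ℝ) {x x' : Fin nX}
    {a : Fin A} (h : G.childX x a x') : G.ownReach π x' = G.ownReach π x * π x a := by
  have h1 : ∀ y b, (if G.Through y b x' then π y b else 1) =
      (if G.Through y b x then π y b else 1) * (if y = x then if b = a then π y b else 1 else 1) := by
    intro y b
    by_cases hy : G.Through y b x
    · have hne : y ≠ x := by
        rintro rfl
        exact lt_irrefl _ (hy.level_lt hG)
      simp [through_child hG h, hy, hne]
    · by_cases h2 : y = x
      · by_cases h3 : b = a
        · subst h2 h3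
          have : ¬ G.Through y b y := hy
          simp [through_child hG h, this]
        · simp [through_child hG h, h2, h3]
      · simp [through_child hG h, hy, h2]
  unfold ownReach
  simp_rw [h1, Finset.prod_mul_distrib]
  congr 1
  have h2 : ∀ y, (∏ b, if y = x then if b = a then π y b else 1 else 1) =
      if y = x then π y a else 1 := by
    intro y
    split_ifs <;> simp
  simp_rw [h2]
  simp

theorem seqForm_mem (hG : G.IsTreePerfectRecall) {π : Fin nX → Fin A → ℝ}
    (hπ : ∀ x a, 0 < π x a) (hπ1 : ∀ x, ∑ a, π x a = 1) : G.seqForm π ∈ G.TX := by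
  refine ⟨fun x a => (mul_pos (hπ x a) (ownReach_pos hπ x)).le, fun x hx => ?_, fun x a x' h => ?_⟩
  · simp_rw [seqForm_eq, ← Finset.sum_mul, hπ1, ownReach_root hG π hx, one_mul]
  · simp_rw [seqForm_eq, ← Finset.sum_mul, hπ1, ownReach_child hG π h, one_mul]
    ring

theorem seqForm_pos {π : Fin nX → Fin A → ℝ} (hπ : ∀ x a, 0 < π x a) (x : Fin nX) (a : Fin A) :
    0 < G.seqForm π x a := mul_pos (hπ x a) (ownReach_pos hπ x)

theorem sum_seqForm {π : Fin nX → Fin A → ℝ} (hπ1 : ∀ x, ∑ a, π x a = 1) (x : Fin nX) :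
    ∑ a, G.seqForm π x a = G.ownReach π x := by
  simp_rw [seqForm_eq, ← Finset.sum_mul, hπ1, one_mul]

theorem policyOf_seqForm {π : Fin nX → Fin A → ℝ} (hπ : ∀ x a, 0 < π x a)
    (hπ1 : ∀ x, ∑ a, π x a = 1) (x : Fin nX) (a : Fin A) :
    policyOf (G.seqForm π) x a = π x a := by
  rw [policyOf, sum_seqForm hπ1, seqForm_eq, mul_div_assoc, div_self (ownReach_pos hπ x).ne',
    mul_one]

theorem uniformStrategy_pos (hA : 0 < A) (x : Fin nX) (a : Fin A) :
    0 < G.uniformStrategy x a := by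
  unfold uniformStrategy
  positivity

theorem uniformStrategy_mem (hG : G.IsTreePerfectRecall) (hA : 0 < A) :
    G.uniformStrategy ∈ G.TX := by
  have : (A : ℝ) ≠ 0 := by positivity
  refine ⟨fun x a => (uniformStrategy_pos hA x a).le, fun x hx => ?_, fun x a x' h => ?_⟩
  · simp [uniformStrategy, hx, this]
  · have := level_childX hG h
    simp only [uniformStrategy, this, Finset.sum_const, Finset.card_univ, Fintype.card_fin,
      nsmul_eq_mul]
    field_simp
    ring

theorem policyOf_uniformStrategy (hA : 0 < A) (x : Fin nX) (a : Fin A) :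
    policyOf G.uniformStrategy x a = 1 / A := by
  have : (A : ℝ) ≠ 0 := by positivity
  simp only [policyOf, uniformStrategy, Finset.sum_const, Finset.card_univ, Fintype.card_fin,
    nsmul_eq_mul]
  field_simp

end EFG

namespace EFG

variable {H nS nX nY A B : ℕ} {G : EFG H nS nX nY A B}

/-! ### Balanced exploration -/

/-- The number of infosets of stage `h` at or after `x`. -/
noncomputable def numBelow (G : EFG H nS nX nY A B) (h : Fin H) (x : Fin nX) : ℝ :=
  ∑ z, if G.level z = h ∧ G.Below x z then 1 else 0

/-- The number of infosets of stage `h` reached through `(x, a)`. -/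
noncomputable def numThrough (G : EFG H nS nX nY A B) (h : Fin H) (x : Fin nX) (a : Fin A) : ℝ :=
  ∑ z, if G.level z = h ∧ G.Through x a z then 1 else 0

theorem ncard_eq_sum (p : Fin nX → Prop) [DecidablePred p] :
    ({x | p x}.ncard : ℝ) = ∑ x, if p x then 1 else 0 := by
  rw [Set.ncard_eq_toFinset_card', Finset.sum_boole]
  congr 2
  ext x
  simp

/-- The successors of `(x, a)` lie in the same stage, so each later infoset lies below only one of
them. -/
theorem numThrough_eq_sum (hG : G.IsTreePerfectRecall) (h : Fin H) (x : Fin nX) (a : Fin A) :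
    G.numThrough h x a = ∑ x', if G.childX x a x' then G.numBelow h x' else 0 := by
  have h2 : ∀ x', (if G.childX x a x' then G.numBelow h x' else 0) =
      ∑ z, if G.childX x a x' ∧ G.level z = h ∧ G.Below x' z then (1 : ℝ) else 0 := by
    intro x'
    unfold numBelow
    by_cases hc : G.childX x a x' <;> simp [hc]
  simp_rw [h2]
  rw [Finset.sum_comm, numThrough]
  refine Finset.sum_congr rfl fun z _ => ?_
  by_cases hz : G.level z = h ∧ G.Through x a z
  · obtain ⟨hl, x₁, h3, h4⟩ := hz
    rw [if_pos ⟨hl, x₁, h3, h4⟩, Finset.sum_eq_single x₁]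
    · rw [if_pos ⟨h3, hl, h4⟩]
    · intro y _ hy
      rw [if_neg]
      rintro ⟨h5, -, h6⟩
      refine hy (h6.unique hG h4 (Fin.ext ?_))
      rw [level_childX hG h5, level_childX hG h3]
    · simp
  · rw [if_neg hz, Finset.sum_eq_zero]
    intro x₁ _
    rw [if_neg]
    rintro ⟨h5, h6, h7⟩
    exact hz ⟨h6, x₁, h5, h7⟩

theorem numBelow_eq_sum (hG : G.IsTreePerfectRecall) {h : Fin H} {x : Fin nX}
    (hx : G.level x < h) : G.numBelow h x = ∑ a, G.numThrough h x a := by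
  unfold numThrough numBelow
  rw [Finset.sum_comm]
  refine Finset.sum_congr rfl fun z _ => ?_
  by_cases hz : G.level z = h
  · simp only [hz, true_and]
    rw [below_iff_exists_through (by rwa [hz])]
    by_cases he : ∃ a, G.Through x a z
    · obtain ⟨a, ha⟩ := he
      rw [if_pos ⟨a, ha⟩, Finset.sum_eq_single a]
      · rw [if_pos ha]
      · intro b _ hb
        rw [if_neg fun hc => hb (hc.action_unique hG ha)]
      · simp
    · rw [if_neg he, Finset.sum_eq_zero]
      intro a _
      rw [if_neg fun hc => he ⟨a, hc⟩]
  · simp [hz]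

theorem numBelow_self (hG : G.IsTreePerfectRecall) {h : Fin H} {x : Fin nX}
    (hx : G.level x = h) : G.numBelow h x = 1 := by
  unfold numBelow
  rw [Finset.sum_eq_single x]
  · rw [if_pos ⟨hx, Relation.ReflTransGen.refl⟩]
  · intro z _ hz
    rw [if_neg]
    rintro ⟨h1, h2⟩
    exact hz (h2.eq_of_level_eq hG (hx.trans h1.symm)).symm
  · simp

theorem numBelow_pos (hG : G.IsTreePerfectRecall) (hA : 0 < A) (hB : 0 < B) {h : Fin H}
    {x : Fin nX} (hx : G.level x ≤ h) : 0 < G.numBelow h x := by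
  obtain ⟨z, hz⟩ := exists_below hG hA hB h x hx
  refine Finset.sum_pos' (fun _ _ => by split_ifs <;> norm_num) ⟨z, Finset.mem_univ _, ?_⟩
  rw [if_pos hz]
  exact one_pos

theorem numThrough_pos (hG : G.IsTreePerfectRecall) (hA : 0 < A) (hB : 0 < B) {h : Fin H}
    {x : Fin nX} (hx : G.level x < h) (a : Fin A) : 0 < G.numThrough h x a := by
  have h0 := Fin.lt_def.1 hx
  obtain ⟨x', hx'⟩ := exists_childX hG hB x a (by omega)
  have h1 := level_childX hG hx'
  obtain ⟨z, hz, hz'⟩ := exists_below hG hA hB h x' (Fin.le_def.2 (by omega))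
  refine Finset.sum_pos' (fun _ _ => by split_ifs <;> norm_num) ⟨z, Finset.mem_univ _, ?_⟩
  rw [if_pos ⟨hz, x', hx', hz'⟩]
  exact one_pos

theorem balPolicy_of_lt {h : Fin H} {x : Fin nX} (hx : G.level x < h) (a : Fin A) :
    G.balPolicy h x a = G.numThrough h x a / G.numBelow h x := by
  rw [balPolicy, if_pos hx, ncard_eq_sum, ncard_eq_sum, numThrough, numBelow]
  refine congrArg₂ _ rfl (Finset.sum_congr rfl fun z _ => ?_)
  by_cases hz : G.level z = h
  · simp only [hz, true_and]
    rw [below_iff_exists_through (by rwa [hz])]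
    congr
  · simp [hz]

theorem balPolicy_pos (hG : G.IsTreePerfectRecall) (hA : 0 < A) (hB : 0 < B) (h : Fin H)
    (x : Fin nX) (a : Fin A) : 0 < G.balPolicy h x a := by
  by_cases hx : G.level x < h
  · rw [balPolicy_of_lt hx]
    exact div_pos (numThrough_pos hG hA hB hx a) (numBelow_pos hG hA hB hx.le)
  · rw [balPolicy, if_neg hx]
    positivity

theorem sum_balPolicy (hG : G.IsTreePerfectRecall) (hA : 0 < A) (hB : 0 < B) (h : Fin H)
    (x : Fin nX) : ∑ a, G.balPolicy h x a = 1 := by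
  by_cases hx : G.level x < h
  · simp_rw [balPolicy_of_lt hx]
    rw [← Finset.sum_div, ← numBelow_eq_sum hG hx, div_self (numBelow_pos hG hA hB hx.le).ne']
  · simp_rw [balPolicy, if_neg hx]
    have : (A : ℝ) ≠ 0 := by positivity
    simp [this]

theorem balStrategy_mem (hG : G.IsTreePerfectRecall) (hA : 0 < A) (hB : 0 < B) (h : Fin H) :
    G.balStrategy h ∈ G.TX :=
  seqForm_mem hG (balPolicy_pos hG hA hB h) (sum_balPolicy hG hA hB h)

/-- The weight of an infoset in the balanced divergence. -/
noncomputable def balWeight (G : EFG H nS nX nY A B) (x : Fin nX) : ℝ :=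
  A / G.ownReach (G.balPolicy (G.level x)) x

theorem balWeight_pos (hG : G.IsTreePerfectRecall) (hA : 0 < A) (hB : 0 < B) (x : Fin nX) :
    0 < G.balWeight x :=
  div_pos (by positivity) (ownReach_pos (balPolicy_pos hG hA hB _) x)

/-- At its own stage the balanced policy is uniform, so the value does not depend on the action.
This is why the balanced divergence has weights on infosets only and fits `wKL`. -/
theorem balStrategy_level (x : Fin nX) (a : Fin A) :
    G.balStrategy (G.level x) x a = 1 / G.balWeight x := by
  rw [balStrategy, seqForm_eq, balPolicy, if_neg (lt_irrefl _), balWeight, one_div_div]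
  ring

theorem balKL_eq (μ μ' : Fin nX → Fin A → ℝ) : G.balKL μ μ' = wKL G.balWeight μ μ' := by
  unfold balKL wKL
  refine Finset.sum_congr rfl fun x _ => Finset.sum_congr rfl fun a _ => ?_
  rw [balStrategy_level]
  simp
  ring

theorem dilKL_eq (μ μ' : Fin nX → Fin A → ℝ) : dilKL μ μ' = wKL (fun _ => 1) μ μ' := by
  simp [dilKL, wKL]

/-- The sum does not depend on the stage `j`. With `N` the number of stage-`h` infosets below and
`q` the balanced reach, `q(x') = q(x) N(x, a)/N(x)`, so the terms `N(x')/q(x')` over the successors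
of `(x, a)` add up to `N(x)/q(x)`. At the roots `q` and the masses are one, and the sum counts the
infosets of stage `h`. -/
theorem sum_mass_div_ownReach (hG : G.IsTreePerfectRecall) (hA : 0 < A) (hB : 0 < B)
    {μ : Fin nX → Fin A → ℝ} (hμ : μ ∈ G.TX) (h : Fin H) (j : ℕ) (hj : j ≤ h) :
    ∑ x, (if (G.level x : ℕ) = j then
      (∑ a, μ x a) * (G.numBelow h x / G.ownReach (G.balPolicy h) x) else 0) =
    ∑ x, if G.level x = h then 1 else 0 := by
  induction j with
  | zero =>
    have h1 : ∀ x, (if (G.level x : ℕ) = 0 then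
      (∑ a, μ x a) * (G.numBelow h x / G.ownReach (G.balPolicy h) x) else 0) =
        ∑ z, if (G.level x : ℕ) = 0 ∧ G.level z = h ∧ G.Below x z then (1 : ℝ) else 0 := by
      intro x
      by_cases hx : (G.level x : ℕ) = 0
      · rw [if_pos hx, hμ.2.1 x hx, ownReach_root hG _ hx]
        simp [hx, numBelow]
      · simp [hx]
    simp_rw [h1]
    rw [Finset.sum_comm]
    refine Finset.sum_congr rfl fun z _ => ?_
    have hroot : ∀ n, ∀ z, (G.level z : ℕ) = n → ∃ x, (G.level x : ℕ) = 0 ∧ G.Below x z := by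
      intro n
      induction n with
      | zero => exact fun z hz => ⟨z, hz, Relation.ReflTransGen.refl⟩
      | succ n ih =>
        intro z hz
        obtain ⟨p, a, hp⟩ := (isGradedTree_childX hG).exists_parent (x' := z) (by omega)
        have := level_childX hG hp
        obtain ⟨x, hx, hx'⟩ := ih p (by omega)
        exact ⟨x, hx, hx'.tail ⟨a, hp⟩⟩
    obtain ⟨x, hx, hxz⟩ := hroot _ z rfl
    by_cases hz : G.level z = h
    · rw [Finset.sum_eq_single x, if_pos ⟨hx, hz, hxz⟩, if_pos hz]
      · intro y _ hy
        rw [if_neg]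
        rintro ⟨h2, -, h3⟩
        exact hy (h3.unique hG hxz (Fin.ext (by omega)))
      · simp
    · simp [hz]
  | succ j ih =>
    rw [← ih (by omega)]
    have h1 := sum_parent_mul (isGradedTree_childX hG) hμ (fun x => if (G.level x : ℕ) = j + 1 then
      G.numBelow h x / G.ownReach (G.balPolicy h) x else 0)
    have h2 : ∀ x, (if (G.level x : ℕ) = j + 1 then
      (∑ a, μ x a) * (G.numBelow h x / G.ownReach (G.balPolicy h) x) else 0) =
      if (G.level x : ℕ) = 0 then 0 else (∑ a, μ x a) * (if (G.level x : ℕ) = j + 1 then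
      G.numBelow h x / G.ownReach (G.balPolicy h) x else 0) := by
      intro x
      by_cases hx : (G.level x : ℕ) = j + 1 <;> simp [hx]
    simp_rw [h2]
    rw [← h1]
    refine Finset.sum_congr rfl fun x _ => ?_
    by_cases hx : (G.level x : ℕ) = j
    · have hlt : G.level x < h := Fin.lt_def.2 (by omega)
      rw [if_pos hx, Finset.sum_mul]
      refine Finset.sum_congr rfl fun a _ => ?_
      congr 1
      have hq := (ownReach_pos (G := G) (balPolicy_pos hG hA hB h) x).ne'
      have hN := (numThrough_pos hG hA hB hlt a).ne'
      have hD := (numBelow_pos hG hA hB hlt.le).ne'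
      have h3 : ∀ x', (if G.childX x a x' then (if (G.level x' : ℕ) = j + 1 then
          G.numBelow h x' / G.ownReach (G.balPolicy h) x' else 0) else 0) =
          (if G.childX x a x' then G.numBelow h x' else 0) *
            (G.numBelow h x / (G.ownReach (G.balPolicy h) x * G.numThrough h x a)) := by
        intro x'
        split_ifs with h4 h5
        · rw [ownReach_child hG _ h4, balPolicy_of_lt hlt]
          field_simp
        · exact absurd ((level_childX hG h4).trans (by rw [hx])) h5
        · simp
      simp_rw [h3]
      rw [← Finset.sum_mul, ← numThrough_eq_sum hG]
      field_simp
    · rw [if_neg hx]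
      refine Finset.sum_eq_zero fun a _ => ?_
      rw [Finset.sum_eq_zero, mul_zero]
      intro x' _
      split_ifs with h4 h5
      · exact absurd (by have := level_childX hG h4; omega) hx
      · rfl
      · rfl

/-- Balanced exploration: every strategy has total weight `X A` relative to the balanced ones. -/
theorem sum_mass_mul_balWeight (hG : G.IsTreePerfectRecall) (hA : 0 < A) (hB : 0 < B)
    {μ : Fin nX → Fin A → ℝ} (hμ : μ ∈ G.TX) :
    ∑ x, G.balWeight x * ∑ a, μ x a = nX * A := by
  have h1 : ∀ x, G.balWeight x * ∑ a, μ x a = ∑ h, A * (if (G.level x : ℕ) = (h : Fin H) then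
      (∑ a, μ x a) * (G.numBelow h x / G.ownReach (G.balPolicy h) x) else 0) := by
    intro x
    rw [Finset.sum_eq_single (G.level x)]
    · rw [if_pos rfl, numBelow_self hG rfl, balWeight]
      ring
    · intro h _ hh
      rw [if_neg fun h' => hh (Fin.ext h'.symm), mul_zero]
    · simp
  simp_rw [h1]
  rw [Finset.sum_comm]
  simp_rw [← Finset.mul_sum, sum_mass_div_ownReach hG hA hB hμ _ _ le_rfl]
  rw [Finset.sum_comm]
  simp
  ring

/-! ### Bounds on the divergences from the uniform strategy -/

/-- The logarithm is `log(A π) ≤ log A`. -/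
theorem wKL_uniform_le (hA : 0 < A) {w : Fin nX → ℝ} (hw : ∀ x, 0 ≤ w x)
    {μ : Fin nX → Fin A → ℝ} (hμ : μ ∈ G.TX) :
    wKL w μ G.uniformStrategy ≤ Real.log A * ∑ x, w x * ∑ a, μ x a := by
  rw [Finset.mul_sum]
  refine Finset.sum_le_sum fun x _ => ?_
  rw [Finset.mul_sum, Finset.mul_sum]
  refine Finset.sum_le_sum fun a _ => ?_
  rw [policyOf_uniformStrategy hA]
  have hlog : 0 ≤ Real.log A := Real.log_natCast_nonneg A
  have h2 : Real.log (policyOf μ x a / (1 / A)) ≤ Real.log A := by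
    rw [div_div_eq_mul_div, div_one]
    rcases (policyOf_nonneg hμ x a).eq_or_lt with h | h
    · rw [← h]; simpa using hlog
    · have hA' : (0 : ℝ) < A := by positivity
      exact Real.log_le_log (by positivity)
        (mul_le_of_le_one_left hA'.le (policyOf_le_one hμ x a))
  have h3 := mul_le_mul_of_nonneg_left h2 (mul_nonneg (hw x) (hμ.1 x a))
  linarith

theorem dilKL_uniform_le (hG : G.IsTreePerfectRecall) (hA : 0 < A)
    {μ : Fin nX → Fin A → ℝ} (hμ : μ ∈ G.TX) :
    dilKL μ G.uniformStrategy ≤ nX * Real.log A := by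
  rw [dilKL_eq]
  refine (wKL_uniform_le hA (fun _ => zero_le_one) hμ).trans ?_
  rw [mul_comm]
  refine mul_le_mul_of_nonneg_right ?_ (Real.log_natCast_nonneg A)
  calc _ ≤ ∑ _x : Fin nX, (1 : ℝ) := Finset.sum_le_sum fun x _ => by
        rw [one_mul]; exact mass_le_one (isGradedTree_childX hG) hμ x
    _ = nX := by simp

theorem balKL_uniform_le (hG : G.IsTreePerfectRecall) (hA : 0 < A) (hB : 0 < B)
    {μ : Fin nX → Fin A → ℝ} (hμ : μ ∈ G.TX) :
    G.balKL μ G.uniformStrategy ≤ nX * A * Real.log A := by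
  rw [balKL_eq]
  refine (wKL_uniform_le hA (fun x => (balWeight_pos hG hA hB x).le) hμ).trans ?_
  rw [sum_mass_mul_balWeight hG hA hB hμ, mul_comm]

/-- A strategy which is bounded below is closer to the uniform strategy. -/
theorem dilKL_uniform_le_of_ge (hG : G.IsTreePerfectRecall) (hA : 0 < A)
    {μ : Fin nX → Fin A → ℝ} (hμ : μ ∈ G.TX) {δ : ℝ} (hδ : 0 < δ) (h : ∀ x a, δ ≤ μ x a) :
    dilKL μ G.uniformStrategy ≤ (1 - δ) * (nX * Real.log A) := by
  have hlog : 0 ≤ Real.log A := Real.log_natCast_nonneg A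
  have hA' : (0 : ℝ) < A := by positivity
  have : Nonempty (Fin A) := ⟨⟨0, hA⟩⟩
  have hpos : ∀ x a, 0 < μ x a := fun x a => hδ.trans_le (h x a)
  have key : ∀ x, ∑ a, μ x a * Real.log (policyOf μ x a / policyOf G.uniformStrategy x a) ≤
      (1 - δ) * Real.log A := by
    intro x
    have hm : 0 < ∑ a, μ x a := Finset.sum_pos (fun a _ => hpos x a) Finset.univ_nonempty
    have hm1 := mass_le_one (isGradedTree_childX hG) hμ x
    -- Some action has at most the uniform probability; its logarithm is nonpositive and is dropped.
    -- Its weight of at least `δ` yields the factor `1 - δ`.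
    obtain ⟨a₀, -, ha₀⟩ : ∃ a ∈ Finset.univ, policyOf μ x a ≤ 1 / A := by
      refine Finset.exists_le_of_sum_le Finset.univ_nonempty ?_
      rw [sum_policyOf hm.ne']
      simp [hA'.ne']
    have h1 : ∀ a, μ x a * Real.log (policyOf μ x a / policyOf G.uniformStrategy x a) ≤
        if a = a₀ then 0 else μ x a * Real.log A := by
      intro a
      have hp := policyOf_pos hpos x a
      rw [policyOf_uniformStrategy hA, div_div_eq_mul_div, div_one]
      split_ifs with hc
      · subst hc
        refine mul_nonpos_of_nonneg_of_nonpos (hpos x a).le (Real.log_nonpos (by positivity) ?_)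
        rwa [le_div_iff₀ hA'] at ha₀
      · exact mul_le_mul_of_nonneg_left (Real.log_le_log (by positivity)
          (mul_le_of_le_one_left hA'.le (policyOf_le_one hμ x a))) (hpos x a).le
    refine (Finset.sum_le_sum fun a _ => h1 a).trans ?_
    have h2 : ∑ a, (if a = a₀ then 0 else μ x a * Real.log A) =
        (∑ a, μ x a - μ x a₀) * Real.log A := by
      have h3 : ∀ a, (if a = a₀ then 0 else μ x a * Real.log A) =
          μ x a * Real.log A - if a = a₀ then μ x a * Real.log A else 0 := fun a => by
        split_ifs <;> ring
      simp_rw [h3]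
      rw [Finset.sum_sub_distrib, ← Finset.sum_mul, Finset.sum_ite_eq', if_pos (Finset.mem_univ _)]
      ring
    rw [h2]
    exact mul_le_mul_of_nonneg_right (by linarith [h x a₀]) hlog
  refine (Finset.sum_le_sum fun x _ => key x).trans ?_
  simp
  linarith

/-- At every stage an action off the path keeps at least `δ`, so the mass after `n` steps is at most
`1 - nδ`. At the last stage it must still be at least `δ`. -/
theorem mul_horizon_le_one (hG : G.IsTreePerfectRecall) (hA : 2 ≤ A) (hB : 0 < B)
    {μ : Fin nX → Fin A → ℝ} (hμ : μ ∈ G.TX) {δ : ℝ} (h : ∀ x a, δ ≤ μ x a) : δ * H ≤ 1 := by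
  have hmass : ∀ n, ∀ x, (G.level x : ℕ) = n → ∑ a, μ x a ≤ 1 - n * δ := by
    intro n
    induction n with
    | zero => intro x hx; rw [hμ.2.1 x hx]; simp
    | succ n ih =>
      intro x hx
      obtain ⟨p, a, hp⟩ := (isGradedTree_childX hG).exists_parent (x' := x) (by omega)
      have h1 := level_childX hG hp
      have h2 := ih p (by omega)
      rw [hμ.2.2 _ _ _ hp]
      have : Nontrivial (Fin A) := Fin.nontrivial_iff_two_le.2 hA
      obtain ⟨b, hb⟩ := exists_ne a
      have h3 : μ p a + μ p b ≤ ∑ a, μ p a := by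
        rw [← Finset.sum_pair hb.symm]
        exact Finset.sum_le_sum_of_subset_of_nonneg (Finset.subset_univ _)
          fun a _ _ => hμ.1 p a
      have h4 := h p b
      push_cast
      linarith
  have hH := G.horizon_pos
  obtain ⟨s, hs⟩ := G.exists_stage_zero
  obtain ⟨z, hz, -⟩ := exists_below hG (by omega) hB ⟨H - 1, by omega⟩ (G.x s)
    (Fin.le_def.2 (by rw [level_x hG, hs]; exact Nat.zero_le _))
  have h1 := hmass (H - 1) z (by rw [hz])
  have h2 := le_mass hμ z ⟨0, by omega⟩
  have h3 := h z ⟨0, by omega⟩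
  rw [Nat.cast_sub hH] at h1
  push_cast at h1
  linarith

end EFG

/-! ### Bilinearity of the pairing. -/

section Pairing

variable {I K : Type*} [Fintype I] [Fintype K]

theorem pairing_comm (μ c : I → K → ℝ) : pairing μ c = pairing c μ := by
  simp only [pairing, mul_comm]

theorem pairing_sub_left (μ μ' c : I → K → ℝ) :
    pairing (fun x a => μ x a - μ' x a) c = pairing μ c - pairing μ' c := by
  simp only [pairing, sub_mul, Finset.sum_sub_distrib]

theorem pairing_add_right (μ c c' : I → K → ℝ) :
    pairing μ (fun x a => c x a + c' x a) = pairing μ c + pairing μ c' := by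
  simp only [pairing, mul_add, Finset.sum_add_distrib]

theorem pairing_smul_right (r : ℝ) (μ c : I → K → ℝ) :
    pairing μ (fun x a => r * c x a) = r * pairing μ c := by
  simp only [pairing, Finset.mul_sum]
  exact Finset.sum_congr rfl fun x _ => Finset.sum_congr rfl fun a _ => by ring

theorem pairing_sub_right (c μ μ' : I → K → ℝ) :
    pairing c (fun x a => μ x a - μ' x a) = pairing μ c - pairing μ' c := by
  rw [pairing_comm, pairing_sub_left]

theorem pairing_zero_right (μ : I → K → ℝ) : pairing μ (fun _ _ => 0) = 0 := by
  simp [pairing]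

end Pairing

namespace EFG

variable {H nS nX nY A B : ℕ} {G : EFG H nS nX nY A B}

/-! ### Trajectories as seen by Alice -/

/-- A sequence of observations which is consistent with the game, with costs in `[0, 1]`. -/
structure IsObservation (G : EFG H nS nX nY A B) (o : Fin H → Fin nX × Fin A × ℝ) : Prop where
  level_eq : ∀ h, G.level (o h).1 = h
  child : ∀ (h : Fin H) (hh : (h : ℕ) + 1 < H),
    G.childX (o h).1 (o h).2.1 (o ⟨(h : ℕ) + 1, hh⟩).1
  cost_nonneg : ∀ h, 0 ≤ (o h).2.2
  cost_le_one : ∀ h, (o h).2.2 ≤ 1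

/-- The observations `o` pass through `(x, a)`. -/
def Visits (G : EFG H nS nX nY A B) (o : Fin H → Fin nX × Fin A × ℝ) (x : Fin nX) (a : Fin A) :
    Prop :=
  (o (G.level x)).1 = x ∧ (o (G.level x)).2.1 = a

/-- The sum of `f` over the visited pairs. -/
noncomputable def visitSum (G : EFG H nS nX nY A B) (o : Fin H → Fin nX × Fin A × ℝ)
    (f : Fin nX → Fin A → ℝ) : ℝ :=
  ∑ x, ∑ a, if G.Visits o x a then f x a else 0

theorem isPlayPath_visits (hG : G.IsTreePerfectRecall) {o : Fin H → Fin nX × Fin A × ℝ}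
    (ho : G.IsObservation o) :
    IsPlayPath (fun x => (G.level x : ℕ)) G.childX (G.Visits o) where
  unique := by
    rintro x a y b ⟨h1, h2⟩ ⟨h3, h4⟩ h
    rw [Fin.ext h] at h1 h2
    exact ⟨h1.symm.trans h3, h2.symm.trans h4⟩
  parent := by
    rintro x a x' a' h ⟨h1, -⟩
    have hl := level_childX hG h
    have h2 := ho.child (G.level x) (by rw [← hl]; exact (G.level x').2)
    have h3 : (⟨(G.level x : ℕ) + 1, by rw [← hl]; exact (G.level x').2⟩ : Fin H) =
      G.level x' := Fin.ext hl.symm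
    rw [h3, h1] at h2
    exact (isGradedTree_childX hG).parent_unique h2 h

theorem visitSum_one_le (hG : G.IsTreePerfectRecall) {o : Fin H → Fin nX × Fin A × ℝ}
    (ho : G.IsObservation o) : G.visitSum o (fun _ _ => 1) ≤ H := by
  have h1 := (isPlayPath_visits hG ho).card_le fun x => (G.level x).2
  rw [visitSum, ← Fintype.sum_prod_type' (f := fun x a => if G.Visits o x a then (1 : ℝ) else 0),
    Finset.sum_boole]
  exact_mod_cast h1

theorem pairing_estimator (μ μ' : Fin nX → Fin A → ℝ) (o : Fin H → Fin nX × Fin A × ℝ) :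
    pairing μ' (G.estimator μ o) =
      G.visitSum o fun x a => μ' x a * ((o (G.level x)).2.2 / μ x a) := by
  refine Finset.sum_congr rfl fun x _ => Finset.sum_congr rfl fun a _ => ?_
  rw [estimator]
  simp only [Visits, mul_ite, mul_zero]
  congr

theorem estimator_nonneg {μ : Fin nX → Fin A → ℝ} {o : Fin H → Fin nX × Fin A × ℝ}
    (ho : G.IsObservation o) (hμ : ∀ x a, 0 < μ x a) (x : Fin nX) (a : Fin A) :
    0 ≤ G.estimator μ o x a := by
  unfold estimator
  split_ifs
  · exact div_nonneg (ho.cost_nonneg _) (hμ x a).le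
  · exact le_rfl

theorem estimator_le {μ : Fin nX → Fin A → ℝ} {o : Fin H → Fin nX × Fin A × ℝ}
    (ho : G.IsObservation o) (hμ : ∀ x a, 0 < μ x a) (x : Fin nX) (a : Fin A) :
    G.estimator μ o x a ≤ 1 / μ x a := by
  unfold estimator
  split_ifs
  · exact div_le_div_of_nonneg_right (ho.cost_le_one _) (hμ x a).le
  · exact one_div_nonneg.2 (hμ x a).le

theorem estimator_eq_zero {μ : Fin nX → Fin A → ℝ} {o : Fin H → Fin nX × Fin A × ℝ}
    {x : Fin nX} {a : Fin A} (h : ¬ G.Visits o x a) : G.estimator μ o x a = 0 := by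
  unfold estimator
  exact if_neg h

/-! ### Mirror descent -/

/-- The strategy of the policy obtained by a step of mirror descent with weights `w` and
learning rate `τ`. -/
noncomputable def omdStrategy (G : EFG H nS nX nY A B) (w : Fin nX → ℝ) (τ : ℝ)
    (μ₀ c : Fin nX → Fin A → ℝ) : Fin nX → Fin A → ℝ :=
  G.seqForm (nextPolicy H (fun x => (G.level x : ℕ)) G.childX w (policyOf μ₀)
    (fun x a => τ * c x a))

section OMD

variable {w : Fin nX → ℝ} {τ : ℝ} {μ μ₀ c : Fin nX → Fin A → ℝ}

theorem nextPolicy_pos (h₀ : ∀ x a, 0 < μ₀ x a) (x : Fin nX) (a : Fin A) :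
    0 < nextPolicy H (fun x => (G.level x : ℕ)) G.childX w (policyOf μ₀)
      (fun x a => τ * c x a) x a :=
  mul_pos (policyOf_pos h₀ x a) (Real.exp_pos _)

theorem omdStrategy_pos (h₀ : ∀ x a, 0 < μ₀ x a) (x : Fin nX) (a : Fin A) :
    0 < G.omdStrategy w τ μ₀ c x a := seqForm_pos (nextPolicy_pos h₀) x a

theorem omdStrategy_mem (hG : G.IsTreePerfectRecall) (hA : 0 < A) (hw : ∀ x, 0 < w x)
    (h₀ : ∀ x a, 0 < μ₀ x a) : G.omdStrategy w τ μ₀ c ∈ G.TX := by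
  have : Nonempty (Fin A) := ⟨⟨0, hA⟩⟩
  exact seqForm_mem hG (nextPolicy_pos h₀)
    (sum_nextPolicy (isGradedTree_childX hG) (fun x => (G.level x).2) hw (policyOf_pos h₀))

theorem policyOf_omdStrategy (hG : G.IsTreePerfectRecall) (hA : 0 < A) (hw : ∀ x, 0 < w x)
    (h₀ : ∀ x a, 0 < μ₀ x a) (x : Fin nX) (a : Fin A) :
    policyOf (G.omdStrategy w τ μ₀ c) x a = nextPolicy H (fun x => (G.level x : ℕ)) G.childX w
      (policyOf μ₀) (fun x a => τ * c x a) x a := by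
  have : Nonempty (Fin A) := ⟨⟨0, hA⟩⟩
  exact policyOf_seqForm (nextPolicy_pos h₀)
    (sum_nextPolicy (isGradedTree_childX hG) (fun x => (G.level x).2) hw (policyOf_pos h₀)) x a

/-- Replaces the choice operator in the algorithm by a formula, from which membership, positivity
and measurability of the iterates follow. -/
theorem argminOn_eq_omdStrategy (hG : G.IsTreePerfectRecall) (hA : 0 < A) (hw : ∀ x, 0 < w x)
    (h₀ : ∀ x a, 0 < μ₀ x a) :
    argminOn (fun μ => τ * pairing μ c + wKL w μ μ₀) G.TX = G.omdStrategy w τ μ₀ c := by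
  refine argminOn_eq (C := ∑ x, if (G.level x : ℕ) = 0 then backValue H
    (fun x => (G.level x : ℕ)) G.childX w (policyOf μ₀) (fun x a => τ * c x a) x else 0)
    (isGradedTree_childX hG) hw (omdStrategy_mem hG hA hw h₀)
    (omdStrategy_pos h₀) fun μ hμ => ?_
  rw [← pairing_smul_right]
  exact pairing_add_wKL (isGradedTree_childX hG) hw hμ h₀ (policyOf_omdStrategy hG hA hw h₀)

/-- The iterate `μ₀` and the strategy `p` whose play produced the estimator differ here because of
the mixing; hence the ratio `μ₀ / p²`. -/
theorem omdStrategy_dil_step (hG : G.IsTreePerfectRecall) (hA : 0 < A) (hτ : 0 < τ)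
    (hμ : μ ∈ G.TX) (hμ₀ : μ₀ ∈ G.TX) (h₀ : ∀ x a, 0 < μ₀ x a) {p : Fin nX → Fin A → ℝ}
    (hp : ∀ x a, 0 < p x a) {o : Fin H → Fin nX × Fin A × ℝ} (ho : G.IsObservation o) :
    pairing μ₀ (G.estimator p o) - pairing μ (G.estimator p o) ≤
      dilKL μ μ₀ / τ - dilKL μ (G.omdStrategy (fun _ => 1) τ μ₀ (G.estimator p o)) / τ +
        τ * H ^ 2 / 2 * G.visitSum o (fun x a => μ₀ x a / p x a ^ 2) := by
  have : Nonempty (Fin A) := ⟨⟨0, hA⟩⟩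
  have hT := isGradedTree_childX hG
  have hc0 : ∀ x a, 0 ≤ τ * G.estimator p o x a := fun x a =>
    mul_nonneg hτ.le (estimator_nonneg ho hp x a)
  have h1 := pairing_sub_le (H := H) hT (fun x => (G.level x).2) (w := fun _ => 1)
    (fun _ => one_pos) hμ hμ₀ h₀ (policyOf_omdStrategy (τ := τ) (c := G.estimator p o) hG hA
      (fun _ => one_pos) h₀) hc0
  have h2 := sum_backCost_sq_le (H := H) hT (fun x => (G.level x).2) hμ₀ h₀
    (isPlayPath_visits hG ho) (c := fun x a => τ * G.estimator p o x a)
    (fun x a hv => by rw [estimator_eq_zero hv, mul_zero]) hc0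
  have h3 : ∑ x, ∑ a, (if G.Visits o x a then μ₀ x a * (τ * G.estimator p o x a) ^ 2 else 0) ≤
      τ ^ 2 * G.visitSum o (fun x a => μ₀ x a / p x a ^ 2) := by
    rw [visitSum, Finset.mul_sum]
    refine Finset.sum_le_sum fun x _ => ?_
    rw [Finset.mul_sum]
    refine Finset.sum_le_sum fun a _ => ?_
    split_ifs
    · have h4 := pow_le_pow_left₀ (estimator_nonneg ho hp x a) (estimator_le ho hp x a) 2
      rw [div_pow, one_pow] at h4
      calc μ₀ x a * (τ * G.estimator p o x a) ^ 2
          = τ ^ 2 * (μ₀ x a * G.estimator p o x a ^ 2) := by ring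
        _ ≤ τ ^ 2 * (μ₀ x a * (1 / p x a ^ 2)) := by
          have := (h₀ x a).le
          gcongr
        _ = _ := by rw [mul_one_div]
    · simp
  have h4 := mul_le_mul_of_nonneg_left h3 (show 0 ≤ (H : ℝ) ^ 2 / 2 by positivity)
  rw [pairing_smul_right, pairing_smul_right, ← mul_sub, ← dilKL_eq, ← dilKL_eq] at h1
  refine le_of_mul_le_mul_left (h1.trans ?_) hτ
  rw [mul_add, mul_sub, mul_div_cancel₀ _ hτ.ne', mul_div_cancel₀ _ hτ.ne']
  have h5 : τ * (τ * H ^ 2 / 2 * G.visitSum o (fun x a => μ₀ x a / p x a ^ 2)) =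
    (H : ℝ) ^ 2 / 2 * (τ ^ 2 * G.visitSum o (fun x a => μ₀ x a / p x a ^ 2)) := by ring
  rw [h5]
  linarith

/-- Without mixing the iterate is itself played, so `μ₀` times the estimator is at most one, which
is the hypothesis of the weighted second-order bound. -/
theorem omdStrategy_bal_step (hG : G.IsTreePerfectRecall) (hA : 0 < A) (hB : 0 < B)
    (hτ : 0 < τ) (hμ : μ ∈ G.TX) (hμ₀ : μ₀ ∈ G.TX) (h₀ : ∀ x a, 0 < μ₀ x a)
    {o : Fin H → Fin nX × Fin A × ℝ} (ho : G.IsObservation o) :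
    pairing μ₀ (G.estimator μ₀ o) - pairing μ (G.estimator μ₀ o) ≤
      G.balKL μ μ₀ / τ - G.balKL μ (G.omdStrategy G.balWeight τ μ₀ (G.estimator μ₀ o)) / τ +
        τ * H ^ 2 / 2 * G.visitSum o (fun x a => 1 / (G.balWeight x * μ₀ x a)) := by
  have : Nonempty (Fin A) := ⟨⟨0, hA⟩⟩
  have hT := isGradedTree_childX hG
  have hw := balWeight_pos hG hA hB
  have hc0 : ∀ x a, 0 ≤ τ * G.estimator μ₀ o x a := fun x a =>
    mul_nonneg hτ.le (estimator_nonneg ho h₀ x a)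
  have h1 := pairing_sub_le (H := H) hT (fun x => (G.level x).2)
    hw hμ hμ₀ h₀ (policyOf_omdStrategy (τ := τ) (c := G.estimator μ₀ o) hG hA hw h₀) hc0
  have h2 := sum_backCost_sq_le_weighted (H := H) hT (fun x => (G.level x).2) hw hμ₀ h₀
    (isPlayPath_visits hG ho) (c := fun x a => τ * G.estimator μ₀ o x a)
    (fun x a hv => by rw [estimator_eq_zero hv, mul_zero]) hc0 hτ.le (fun x a => by
      have h3 := estimator_le ho h₀ x a
      rw [le_div_iff₀ (h₀ x a)] at h3
      nlinarith)
  rw [pairing_smul_right, pairing_smul_right, ← mul_sub, ← balKL_eq, ← balKL_eq] at h1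
  refine le_of_mul_le_mul_left (h1.trans ?_) hτ
  rw [mul_add, mul_sub, mul_div_cancel₀ _ hτ.ne', mul_div_cancel₀ _ hτ.ne']
  have h5 : τ * (τ * H ^ 2 / 2 * G.visitSum o (fun x a => 1 / (G.balWeight x * μ₀ x a))) =
    (τ * H) ^ 2 / 2 * G.visitSum o (fun x a => 1 / (G.balWeight x * μ₀ x a)) := by ring
  rw [h5, visitSum]
  linarith

end OMD

end EFG

namespace EFG

variable {H nS nX nY A B : ℕ} {G : EFG H nS nX nY A B}

/-! ### The phases of the algorithm -/

/-- What the analysis of the phases needs to know about the parameters. -/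
structure GoodParams (G : EFG H nS nX nY A B) (δ : ℝ) (T : ℕ) : Prop where
  one_lt : 1 < G.paramR δ T
  horizon_le : (H : ℝ) ≤ G.paramR δ T
  eta_pos : 0 < G.paramEta δ T
  tau_pos : 0 < G.paramTau T
  dil_le : ∀ μ ∈ G.TX, dilKL μ G.uniformStrategy / G.paramEta δ T ≤ G.paramR δ T

/-- The memory in the course of a phase. -/
structure IsAdmissible (G : EFG H nS nX nY A B) (δ : ℝ) (T : ℕ) (st : PAState nX A) : Prop where
  muHat_mem : st.muHat ∈ G.TX
  muHat_pos : ∀ x a, 0 < st.muHat x a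
  one_le_k : 1 ≤ st.k
  alpha_eq : st.alpha = min (2 ^ (st.k - 1) / G.paramR δ T) 1
  -- Controls the number of phases, including one whose `α` has been capped at `1`.
  pow_lt : (2 : ℝ) ^ (st.k - 1) < 2 * G.paramR δ T

/-- The next iterate of mirror descent in a phase with mixing weight `α`. -/
noncomputable def omdUpdate (G : EFG H nS nX nY A B) (δ : ℝ) (T : ℕ) (α : ℝ)
    (μ₀ c : Fin nX → Fin A → ℝ) : Fin nX → Fin A → ℝ :=
  if α < 1 then G.omdStrategy (fun _ => 1) (G.paramEta δ T) μ₀ c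
  else G.omdStrategy G.balWeight (G.paramTau T) μ₀ c

/-- The divergence used in a phase with mixing weight `α`, over the learning rate. -/
noncomputable def omdDiv (G : EFG H nS nX nY A B) (δ : ℝ) (T : ℕ) (α : ℝ)
    (μ μ' : Fin nX → Fin A → ℝ) : ℝ :=
  if α < 1 then dilKL μ μ' / G.paramEta δ T else G.balKL μ μ' / G.paramTau T

/-- The second-order term of a round. -/
noncomputable def secondOrder (G : EFG H nS nX nY A B) (δ : ℝ) (T : ℕ)
    (μc : Fin nX → Fin A → ℝ) (st : PAState nX A) (o : Fin H → Fin nX × Fin A × ℝ) : ℝ :=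
  if st.alpha < 1 then G.paramEta δ T * H ^ 2 / 2 *
    G.visitSum o (fun x a => st.muHat x a / st.play μc x a ^ 2)
  else G.paramTau T * H ^ 2 / 2 *
    G.visitSum o (fun x a => 1 / (G.balWeight x * st.muHat x a))

/-- The beginning of a new phase is due. -/
def Exceeds (G : EFG H nS nX nY A B) (δ : ℝ) (T : ℕ) (μc : Fin nX → Fin A → ℝ)
    (cum : Fin nX → Fin A → ℝ) : Prop :=
  ∃ μ ∈ G.TX, 2 * G.paramR δ T < pairing cum (fun x a => μc x a - μ x a)

variable {δ : ℝ} {T : ℕ} {μc : Fin nX → Fin A → ℝ} {st : PAState nX A}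
  {o : Fin H → Fin nX × Fin A × ℝ}

theorem paStep_eq (hG : G.IsTreePerfectRecall) (hA : 0 < A) (hB : 0 < B)
    (hpos : ∀ x a, 0 < st.muHat x a) :
    G.paStep δ T μc st o =
      if G.Exceeds δ T μc (fun x a => st.cum x a + G.estimator (st.play μc) o x a) ∧ st.alpha < 1
      then ⟨st.k + 1, min (2 ^ st.k / G.paramR δ T) 1, fun _ _ => 0, G.uniformStrategy⟩
      else ⟨st.k, st.alpha, fun x a => st.cum x a + G.estimator (st.play μc) o x a,
        G.omdUpdate δ T st.alpha st.muHat (G.estimator (st.play μc) o)⟩ := by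
  have h : (if st.alpha < 1 then
      argminOn (fun μ => G.paramEta δ T * pairing μ (G.estimator (st.play μc) o) +
        dilKL μ st.muHat) G.TX
      else argminOn (fun μ => G.paramTau T * pairing μ (G.estimator (st.play μc) o) +
        G.balKL μ st.muHat) G.TX) =
      G.omdUpdate δ T st.alpha st.muHat (G.estimator (st.play μc) o) := by
    simp_rw [dilKL_eq, balKL_eq, argminOn_eq_omdStrategy hG hA (fun _ => one_pos) hpos,
      argminOn_eq_omdStrategy hG hA (balWeight_pos hG hA hB) hpos, omdUpdate]
  rw [← h]
  unfold paStep Exceeds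
  simp only

theorem omdUpdate_mem (hG : G.IsTreePerfectRecall) (hA : 0 < A) (hB : 0 < B)
    {μ₀ c : Fin nX → Fin A → ℝ} {α : ℝ} (h₀ : ∀ x a, 0 < μ₀ x a) :
    G.omdUpdate δ T α μ₀ c ∈ G.TX := by
  unfold omdUpdate
  split_ifs
  · exact omdStrategy_mem hG hA (fun _ => one_pos) h₀
  · exact omdStrategy_mem hG hA (balWeight_pos hG hA hB) h₀

theorem omdUpdate_pos {μ₀ c : Fin nX → Fin A → ℝ} {α : ℝ} (h₀ : ∀ x a, 0 < μ₀ x a)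
    (x : Fin nX) (a : Fin A) : 0 < G.omdUpdate δ T α μ₀ c x a := by
  unfold omdUpdate
  split_ifs <;> exact omdStrategy_pos h₀ x a

theorem omdDiv_nonneg (hG : G.IsTreePerfectRecall) (hA : 0 < A) (hB : 0 < B)
    (hP : G.GoodParams δ T) {α : ℝ} {μ μ' : Fin nX → Fin A → ℝ} (hμ : μ ∈ G.TX)
    (hpos : ∀ x a, 0 < μ' x a) : 0 ≤ G.omdDiv δ T α μ μ' := by
  unfold omdDiv
  split_ifs
  · rw [dilKL_eq]
    exact div_nonneg (wKL_nonneg (fun _ => zero_le_one) hμ hpos) hP.eta_pos.le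
  · rw [balKL_eq]
    exact div_nonneg (wKL_nonneg (fun x => (balWeight_pos hG hA hB x).le) hμ hpos) hP.tau_pos.le

namespace IsAdmissible

theorem alpha_pos (hP : G.GoodParams δ T) (h : G.IsAdmissible δ T st) : 0 < st.alpha := by
  rw [h.alpha_eq]
  have := hP.one_lt
  positivity

theorem alpha_le_one (h : G.IsAdmissible δ T st) : st.alpha ≤ 1 := by
  rw [h.alpha_eq]
  exact min_le_right _ _

theorem play_mem (hP : G.GoodParams δ T) (h : G.IsAdmissible δ T st) (hμc : μc ∈ G.TX) :
    st.play μc ∈ G.TX := by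
  have h0 := (h.alpha_pos hP).le
  have h1 := sub_nonneg.2 h.alpha_le_one
  refine ⟨fun x a => add_nonneg (mul_nonneg h0 (h.muHat_pos x a).le)
    (mul_nonneg h1 (hμc.1 x a)), fun x hx => ?_, fun x a x' hx => ?_⟩
  · simp only [PAState.play, Finset.sum_add_distrib, ← Finset.mul_sum]
    rw [h.muHat_mem.2.1 x hx, hμc.2.1 x hx]
    ring
  · simp only [PAState.play, Finset.sum_add_distrib, ← Finset.mul_sum]
    rw [h.muHat_mem.2.2 _ _ _ hx, hμc.2.2 _ _ _ hx]

theorem play_pos (hP : G.GoodParams δ T) (h : G.IsAdmissible δ T st) (hμc : μc ∈ G.TX)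
    (x : Fin nX) (a : Fin A) : 0 < st.play μc x a :=
  add_pos_of_pos_of_nonneg (mul_pos (h.alpha_pos hP) (h.muHat_pos x a))
    (mul_nonneg (sub_nonneg.2 h.alpha_le_one) (hμc.1 x a))

theorem play_of_not_lt (h : G.IsAdmissible δ T st) (h1 : ¬ st.alpha < 1) :
    st.play μc = st.muHat := by
  have : st.alpha = 1 := le_antisymm h.alpha_le_one (not_lt.1 h1)
  funext x a
  simp [PAState.play, this]

/-- This is the stake of a phase: below the cap, its win or loss is measured in units of `αR =
2^(k-1)`. -/
theorem alpha_mul (hP : G.GoodParams δ T) (h : G.IsAdmissible δ T st) (h1 : st.alpha < 1) :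
    st.alpha * G.paramR δ T = 2 ^ (st.k - 1) := by
  have h2 := h.alpha_eq
  have hR := hP.one_lt
  rcases min_choice ((2 : ℝ) ^ (st.k - 1) / G.paramR δ T) 1 with h3 | h3
  · rw [h2, h3]
    field_simp
  · rw [h3] at h2
    linarith

theorem init (hG : G.IsTreePerfectRecall) (hA : 0 < A) (hP : G.GoodParams δ T) :
    G.IsAdmissible δ T (G.paInit δ T) where
  muHat_mem := uniformStrategy_mem hG hA
  muHat_pos := uniformStrategy_pos hA
  one_le_k := le_rfl
  alpha_eq := by
    have h1 := hP.one_lt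
    simp only [paInit, Nat.sub_self, pow_zero]
    rw [min_eq_left]
    rw [div_le_one (by linarith)]
    exact h1.le
  pow_lt := by
    have h1 := hP.one_lt
    simp only [paInit, Nat.sub_self, pow_zero]
    linarith

theorem step (hG : G.IsTreePerfectRecall) (hA : 0 < A) (hB : 0 < B) (hP : G.GoodParams δ T)
    (h : G.IsAdmissible δ T st) : G.IsAdmissible δ T (G.paStep δ T μc st o) := by
  rw [paStep_eq hG hA hB h.muHat_pos]
  split_ifs with hc
  · refine ⟨uniformStrategy_mem hG hA, uniformStrategy_pos hA, by simp, by simp, ?_⟩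
    have h1 := h.alpha_mul hP hc.2
    have h2 := h.one_le_k
    have hR := hP.one_lt
    simp only [Nat.add_sub_cancel]
    calc (2 : ℝ) ^ st.k = 2 * 2 ^ (st.k - 1) := by
          rw [← pow_succ', Nat.sub_add_cancel h2]
      _ = 2 * (st.alpha * G.paramR δ T) := by rw [h1]
      -- A new phase opens only while `α < 1`, that is, while `2^(k-1) < R`.
      _ < 2 * G.paramR δ T := by nlinarith [hc.2]
  · exact ⟨omdUpdate_mem hG hA hB h.muHat_pos, omdUpdate_pos h.muHat_pos, h.one_le_k, h.alpha_eq,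
      h.pow_lt⟩

end IsAdmissible

/-- One step of mirror descent in either kind of phase. -/
theorem omd_step (hG : G.IsTreePerfectRecall) (hA : 0 < A) (hB : 0 < B) (hP : G.GoodParams δ T)
    (hμc : μc ∈ G.TX) (h : G.IsAdmissible δ T st) (ho : G.IsObservation o)
    {μ : Fin nX → Fin A → ℝ} (hμ : μ ∈ G.TX) :
    pairing st.muHat (G.estimator (st.play μc) o) - pairing μ (G.estimator (st.play μc) o) ≤
      G.omdDiv δ T st.alpha μ st.muHat - G.omdDiv δ T st.alpha μ
        (G.omdUpdate δ T st.alpha st.muHat (G.estimator (st.play μc) o)) +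
        G.secondOrder δ T μc st o := by
  by_cases h1 : st.alpha < 1
  · simp only [omdDiv, omdUpdate, secondOrder, if_pos h1]
    exact omdStrategy_dil_step hG hA hP.eta_pos hμ h.muHat_mem h.muHat_pos (h.play_pos hP hμc) ho
  · simp only [omdDiv, omdUpdate, secondOrder, if_neg h1, h.play_of_not_lt h1]
    exact omdStrategy_bal_step hG hA hB hP.tau_pos hμ h.muHat_mem h.muHat_pos ho

/-- The regrets `L μ`, up to the sum `Q` of the second-order terms, at a moment when the current
phase has seen the loss `V` of mirror descent and the second-order terms `W`. -/
structure PhaseBound (G : EFG H nS nX nY A B) (δ : ℝ) (T : ℕ) (μc : Fin nX → Fin A → ℝ)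
    (st : PAState nX A) (L : (Fin nX → Fin A → ℝ) → ℝ) (Q V W : ℝ) : Prop where
  omd : ∀ μ ∈ G.TX, V - pairing μ st.cum ≤ G.omdDiv δ T st.alpha μ G.uniformStrategy -
    G.omdDiv δ T st.alpha μ st.muHat + W
  -- The first term is the total won in the completed phases, the second is the running phase. The
  -- current `αW` is removed from `Q` so that it cancels when `omd` is inserted.
  comparator : L μc ≤ -(2 ^ (st.k - 1) - 1) + st.alpha * (V - pairing μc st.cum) +
    (Q - st.alpha * W)
  -- Each completed phase is charged `4R`; the running phase splits according to the mixture into a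
  -- mirror-descent part and a `μc` part.
  general : ∀ μ ∈ G.TX, L μ ≤ (st.k - 1) * (4 * G.paramR δ T) +
    st.alpha * (V - pairing μ st.cum) +
    (1 - st.alpha) * (pairing μc st.cum - pairing μ st.cum) + (Q - st.alpha * W)
  test : st.alpha < 1 → ∀ μ ∈ G.TX,
    pairing μc st.cum - pairing μ st.cum ≤ 2 * G.paramR δ T

theorem phaseBound_init (hP : G.GoodParams δ T) :
    G.PhaseBound δ T μc (G.paInit δ T) (fun _ => 0) 0 0 0 := by
  have hR := hP.one_lt
  refine ⟨fun μ _ => ?_, ?_, fun μ _ => ?_, fun _ μ _ => ?_⟩ <;>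
    (simp only [paInit, pairing_zero_right]; simp; try linarith)

/-- The played strategy dominates `(1 - α) μc`, so each visited pair contributes at most one. This
bounds the overshoot in the round in which the test fires. -/
theorem mixed_comparator_le (hG : G.IsTreePerfectRecall) (hP : G.GoodParams δ T)
    (hμc : μc ∈ G.TX) (h : G.IsAdmissible δ T st) (ho : G.IsObservation o) :
    (1 - st.alpha) * pairing μc (G.estimator (st.play μc) o) ≤ H := by
  rw [pairing_estimator, visitSum, Finset.mul_sum]
  refine le_trans ?_ (visitSum_one_le hG ho)
  refine Finset.sum_le_sum fun x _ => ?_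
  rw [Finset.mul_sum]
  refine Finset.sum_le_sum fun a _ => ?_
  split_ifs
  · have hp := h.play_pos hP hμc x a
    rw [← mul_assoc, ← mul_div_assoc, div_le_one hp]
    have h1 : (1 - st.alpha) * μc x a ≤ st.play μc x a := by
      have := mul_nonneg (h.alpha_pos hP).le (h.muHat_pos x a).le
      simp only [PAState.play]
      linarith
    refine le_trans (mul_le_of_le_one_right ?_ (ho.cost_le_one _)) h1
    exact mul_nonneg (sub_nonneg.2 h.alpha_le_one) (hμc.1 x a)
  · simp

theorem PhaseBound.step (hG : G.IsTreePerfectRecall) (hA : 0 < A) (hB : 0 < B)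
    (hP : G.GoodParams δ T) (hμc : μc ∈ G.TX) (h : G.IsAdmissible δ T st)
    (ho : G.IsObservation o) {L : (Fin nX → Fin A → ℝ) → ℝ} {Q V W : ℝ}
    (hb : G.PhaseBound δ T μc st L Q V W) :
    ∃ V' W', G.PhaseBound δ T μc (G.paStep δ T μc st o)
      (fun μ => L μ + pairing (fun x a => st.play μc x a - μ x a) (G.estimator (st.play μc) o))
      (Q + st.alpha * G.secondOrder δ T μc st o) V' W' := by
  set c := G.estimator (st.play μc) o with hc
  set s := G.secondOrder δ T μc st o with hs
  set m := pairing st.muHat c with hm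
  set α := st.alpha with hα
  have hα0 : 0 < α := h.alpha_pos hP
  have hα1 : α ≤ 1 := h.alpha_le_one
  have hR := hP.one_lt
  have hplay : ∀ μ, pairing (fun x a => st.play μc x a - μ x a) c =
      α * m + (1 - α) * pairing μc c - pairing μ c := by
    intro μ
    rw [pairing_sub_left, pairing_comm (st.play μc)]
    have : st.play μc = fun x a => α * st.muHat x a + (1 - α) * μc x a := rfl
    rw [this, pairing_add_right, pairing_smul_right, pairing_smul_right, pairing_comm c,
      pairing_comm c]
  have homd : ∀ μ ∈ G.TX, (V + m) - (pairing μ st.cum + pairing μ c) ≤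
      G.omdDiv δ T α μ G.uniformStrategy - G.omdDiv δ T α μ (G.omdUpdate δ T α st.muHat c) +
        (W + s) := fun μ hμ => by
    have h1 := omd_step hG hA hB hP hμc h ho hμ
    have h2 := hb.omd μ hμ
    linarith
  have hcomp := hb.comparator
  have hgen := hb.general
  rw [paStep_eq hG hA hB h.muHat_pos]
  split_ifs with hx
  · obtain ⟨⟨μ₁, hμ₁, hex⟩, hlt⟩ := hx
    rw [pairing_sub_right, pairing_add_right, pairing_add_right] at hex
    -- Just before the reset, including the current round, the mirror-descent regret is at most `R`
    -- plus second-order terms.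
    have hdil : ∀ μ ∈ G.TX, (V + m) - (pairing μ st.cum + pairing μ c) ≤
        G.paramR δ T + (W + s) := fun μ hμ => by
      have h1 := homd μ hμ
      have h2 := omdDiv_nonneg hG hA hB hP (α := α) hμ (omdUpdate_pos (G := G) (δ := δ) (T := T)
        (α := α) (c := c) h.muHat_pos)
      have h3 := hP.dil_le μ hμ
      have h4 : G.omdDiv δ T α μ G.uniformStrategy ≤ G.paramR δ T := by
        rw [omdDiv, if_pos hlt]
        exact h3
      linarith
    refine ⟨0, 0, fun μ _ => ?_, ?_, fun μ hμ => ?_, fun _ μ _ => ?_⟩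
    · simp only [pairing_zero_right]
      linarith
    · simp only [pairing_zero_right, hplay, Nat.add_sub_cancel]
      have h1 := hdil μ₁ hμ₁
      have h2 := h.alpha_mul hP hlt
      have h3 : (2 : ℝ) ^ st.k = 2 * 2 ^ (st.k - 1) := by
        rw [← pow_succ', Nat.sub_add_cancel h.one_le_k]
      -- Mirror descent is within `R` of `μ₁`, which beats `μc` by more than `2R`; so it beats `μc`
      -- by `R`, and multiplication by `α` yields the win `2^(k-1)`.
      have h4 : (V + m) - (pairing μc st.cum + pairing μc c) ≤ -G.paramR δ T + (W + s) := by
        linarith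
      have h5 := mul_le_mul_of_nonneg_left h4 hα0.le
      rw [h3]
      linarith
    · simp only [pairing_zero_right, hplay]
      have h1 := mul_le_mul_of_nonneg_left (hdil μ hμ) hα0.le
      have h2 := mixed_comparator_le hG hP hμc h ho
      -- The test had not fired before this round. With the overshoot the phase costs at most `αR +
      -- 2(1 - α)R + H ≤ 4R`.
      have h3 : (1 - α) * (pairing μc st.cum - pairing μ st.cum) ≤
          (1 - α) * (2 * G.paramR δ T) :=
        mul_le_mul_of_nonneg_left (hb.test hlt μ hμ) (sub_nonneg.2 hα1)
      have h4 : 0 ≤ pairing μ c := Finset.sum_nonneg fun x _ => Finset.sum_nonneg fun a _ =>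
        mul_nonneg (hμ.1 x a) (estimator_nonneg ho (h.play_pos hP hμc) x a)
      have h5 := hgen μ hμ
      have h6 := hP.horizon_le
      have h7 := mul_nonneg (sub_nonneg.2 hα1) h4
      push_cast
      nlinarith
    · simp only [pairing_zero_right]
      linarith
  · refine ⟨V + m, W + s, fun μ hμ => ?_, ?_, fun μ hμ => ?_, fun hlt μ hμ => ?_⟩
    · simp only [pairing_add_right]
      exact homd μ hμ
    · simp only [pairing_add_right, hplay]
      linarith
    · simp only [pairing_add_right, hplay]
      linarith [hgen μ hμ]
    · by_contra hcon
      refine hx ⟨⟨μ, hμ, ?_⟩, hlt⟩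
      rw [pairing_sub_right]
      exact not_le.1 hcon

end EFG

/-! ### Sums over paths of a finite chain. -/

section Chain

variable {α : Type*}

/-- The weight of a path of a chain with initial weights `f` and transition weights `K`. -/
noncomputable def chainWeight (f : α → ℝ) (K : α → α → ℝ) (n : ℕ) (z : Fin (n + 1) → α) : ℝ :=
  f (z 0) * ∏ i : Fin n, K (z i.castSucc) (z i.succ)

theorem chainWeight_cons (f : α → ℝ) (K : α → α → ℝ) (n : ℕ) (σ : α) (z : Fin (n + 1) → α) :
    chainWeight f K (n + 1) (Fin.cons σ z : Fin (n + 2) → α) =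
      f σ * K σ (z 0) * ∏ i : Fin n, K (z i.castSucc) (z i.succ) := by
  rw [chainWeight, Fin.prod_univ_succ]
  simp only [Fin.cons_zero, Fin.castSucc_zero, Fin.cons_succ]
  rw [← mul_assoc]
  rfl

variable [Fintype α]

/-- The first state is summed out, which pushes the initial weights one step forward. -/
theorem sum_chainWeight_succ (f : α → ℝ) (K : α → α → ℝ) (n : ℕ) (g : (Fin (n + 1) → α) → ℝ) :
    ∑ z : Fin (n + 2) → α, chainWeight f K (n + 1) z * g (fun i => z i.succ) =
      ∑ z : Fin (n + 1) → α, chainWeight (fun σ' => ∑ σ, f σ * K σ σ') K n z * g z := by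
  rw [← (Fin.consEquiv fun _ : Fin (n + 2) => α).sum_comp, Fintype.sum_prod_type, Finset.sum_comm]
  refine Finset.sum_congr rfl fun z _ => ?_
  have h : ∀ σ, (Fin.consEquiv fun _ : Fin (n + 2) => α) (σ, z) = Fin.cons σ z := fun _ => rfl
  simp_rw [h, chainWeight_cons, Fin.cons_succ]
  rw [← Finset.sum_mul, ← Finset.sum_mul, chainWeight]

/-- The kernel is required to be stochastic only on states satisfying `P`: policies at infosets of
mass zero are `0` and do not sum to one, but such states carry no weight. -/
theorem sum_chainWeight {K : α → α → ℝ} {n : ℕ} {P : ℕ → α → Prop}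
    (hK : ∀ j < n, ∀ σ, P j σ → ∑ σ', K σ σ' = 1)
    (hP : ∀ j σ σ', P j σ → K σ σ' ≠ 0 → P (j + 1) σ') (m j : ℕ) (hm : j + m = n) (f : α → ℝ)
    (hf : ∀ σ, f σ ≠ 0 → P j σ) : ∑ z, chainWeight f K m z = ∑ σ, f σ := by
  induction m generalizing j f with
  | zero =>
    rw [← (Equiv.funUnique (Fin 1) α).symm.sum_comp]
    simp [chainWeight]
  | succ m ih =>
    have h1 := sum_chainWeight_succ f K m fun _ => 1
    simp only [mul_one] at h1
    rw [h1, ih (j + 1) (by omega)]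
    · rw [Finset.sum_comm]
      refine Finset.sum_congr rfl fun σ _ => ?_
      rw [← Finset.mul_sum]
      by_cases h : f σ = 0
      · rw [h, zero_mul]
      · rw [hK j (by omega) σ (hf σ h), mul_one]
    · intro σ' h
      obtain ⟨σ, -, hσ⟩ := Finset.exists_ne_zero_of_sum_ne_zero h
      exact hP j σ σ' (hf σ (left_ne_zero_of_mul hσ)) (right_ne_zero_of_mul hσ)

/-- `F` is the forward marginal: the steps before time `h` are absorbed by `F (j + 1) = F j K`, and
the steps after it sum to one. -/
theorem sum_chainWeight_mul {K : α → α → ℝ} {n : ℕ} {P : ℕ → α → Prop} {F : ℕ → α → ℝ}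
    (hK : ∀ j < n, ∀ σ, P j σ → ∑ σ', K σ σ' = 1)
    (hP : ∀ j σ σ', P j σ → K σ σ' ≠ 0 → P (j + 1) σ')
    (hF : ∀ j σ, F j σ ≠ 0 → P j σ)
    (hFK : ∀ j < n, ∀ σ', F (j + 1) σ' = ∑ σ, F j σ * K σ σ') (φ : α → ℝ)
    (h m j : ℕ) (hm : j + m = n) (hh : h < m + 1) :
    ∑ z : Fin (m + 1) → α, chainWeight (F j) K m z * φ (z ⟨h, hh⟩) = ∑ σ, F (j + h) σ * φ σ := by
  induction h generalizing m j with
  | zero =>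
    rw [← sum_chainWeight hK hP m j hm (fun σ => F (j + 0) σ * φ σ)
      fun σ hσ => hF j σ (left_ne_zero_of_mul hσ)]
    refine Finset.sum_congr rfl fun z _ => ?_
    simp only [chainWeight, add_zero, Fin.zero_eta]
    ring
  | succ h ih =>
    obtain ⟨m, rfl⟩ : ∃ k, m = k + 1 := ⟨m - 1, by omega⟩
    have h1 := sum_chainWeight_succ (F j) K m fun z => φ (z ⟨h, by omega⟩)
    have h2 : (fun σ' => ∑ σ, F j σ * K σ σ') = F (j + 1) :=
      funext fun σ' => (hFK j (by omega) σ').symm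
    rw [h2, ih m (j + 1) (by omega) (by omega)] at h1
    rw [show j + (h + 1) = j + 1 + h by omega, ← h1]
    rfl

end Chain

namespace EFG

variable {H nS nX nY A B : ℕ} {G : EFG H nS nX nY A B}

/-! ### The law of a trajectory -/

theorem pathProb_nonneg {μ : Fin nX → Fin A → ℝ} {ν : Fin nY → Fin B → ℝ} (hμ : μ ∈ G.TX)
    (hν : ν ∈ G.TY) (z : Fin H → Fin nS × Fin A × Fin B) : 0 ≤ G.pathProb μ ν z := by
  refine Finset.prod_nonneg fun h _ => mul_nonneg (mul_nonneg (mul_nonneg ?_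
    (policyOf_nonneg hμ _ _)) (policyOf_nonneg hν _ _)) ?_
  · split_ifs
    · exact G.p0_nonneg _
    · exact zero_le_one
  · split_ifs
    · exact G.p_nonneg _ _ _ _
    · exact zero_le_one

theorem p_ne_zero_of_pathProb_ne_zero {μ : Fin nX → Fin A → ℝ} {ν : Fin nY → Fin B → ℝ}
    {z : Fin H → Fin nS × Fin A × Fin B} (hz : G.pathProb μ ν z ≠ 0) (h : Fin H)
    (hh : (h : ℕ) + 1 < H) :
    G.p (z h).1 (z h).2.1 (z h).2.2 (z ⟨(h : ℕ) + 1, hh⟩).1 ≠ 0 := by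
  have h1 := Finset.prod_ne_zero_iff.1 hz h (Finset.mem_univ _)
  have h2 := right_ne_zero_of_mul h1
  rwa [dif_pos hh] at h2

theorem stage_of_pathProb_ne_zero {μ : Fin nX → Fin A → ℝ} {ν : Fin nY → Fin B → ℝ}
    {z : Fin H → Fin nS × Fin A × Fin B} (hz : G.pathProb μ ν z ≠ 0) (h : Fin H) :
    G.stage (z h).1 = h := by
  obtain ⟨h, hh⟩ := h
  induction h with
  | zero =>
    have h1 := Finset.prod_ne_zero_iff.1 hz ⟨0, hh⟩ (Finset.mem_univ _)
    have h2 := left_ne_zero_of_mul (left_ne_zero_of_mul (left_ne_zero_of_mul h1))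
    rw [if_pos rfl] at h2
    exact Fin.ext (G.p0_stage _ h2)
  | succ h ih =>
    have h1 := G.p_stage _ _ _ _ (p_ne_zero_of_pathProb_ne_zero hz ⟨h, by omega⟩ hh)
    rw [ih (by omega)] at h1
    exact Fin.ext h1

theorem pathProb_eq_chainWeight {n : ℕ} {G : EFG (n + 1) nS nX nY A B} (μ : Fin nX → Fin A → ℝ)
    (ν : Fin nY → Fin B → ℝ) (z : Fin (n + 1) → Fin nS × Fin A × Fin B) :
    G.pathProb μ ν z = chainWeight
      (fun σ => G.p0 σ.1 * (policyOf μ (G.x σ.1) σ.2.1 * policyOf ν (G.y σ.1) σ.2.2))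
      (fun σ σ' => G.p σ.1 σ.2.1 σ.2.2 σ'.1 *
        (policyOf μ (G.x σ'.1) σ'.2.1 * policyOf ν (G.y σ'.1) σ'.2.2)) n z := by
  have h1 : ∏ h : Fin (n + 1), (if (h : ℕ) = 0 then G.p0 (z h).1 else 1) = G.p0 (z 0).1 := by
    rw [Fin.prod_univ_succ]
    simp
  have h2 : ∏ h : Fin (n + 1), (if hh : (h : ℕ) + 1 < n + 1 then
        G.p (z h).1 (z h).2.1 (z h).2.2 (z ⟨(h : ℕ) + 1, hh⟩).1 else 1) =
      ∏ i : Fin n, G.p (z i.castSucc).1 (z i.castSucc).2.1 (z i.castSucc).2.2 (z i.succ).1 := by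
    rw [Fin.prod_univ_castSucc]
    simp only [Fin.val_last, lt_irrefl, dite_false, mul_one]
    refine Finset.prod_congr rfl fun i _ => ?_
    rw [dif_pos (by simp)]
    rfl
  unfold pathProb chainWeight
  simp_rw [mul_assoc (if _ then G.p0 _ else 1 : ℝ), Finset.prod_mul_distrib]
  rw [h1, h2, Fin.prod_univ_succ (fun h => policyOf μ (G.x (z h).1) (z h).2.1),
    Fin.prod_univ_succ (fun h => policyOf ν (G.y (z h).1) (z h).2.2)]
  ring

/-- Policies multiplied along a path recover the treeplex weights, because each mass is the weight
of the predecessor pair. The marginal at stage `h` is therefore reaching probability times the two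
treeplex weights. -/
theorem sum_pathProb_mul (hG : G.IsTreePerfectRecall) {μ : Fin nX → Fin A → ℝ}
    {ν : Fin nY → Fin B → ℝ} (hμ : μ ∈ G.TX) (hν : ν ∈ G.TY) (h : Fin H)
    (φ : Fin nS × Fin A × Fin B → ℝ) :
    ∑ z, G.pathProb μ ν z * φ (z h) = ∑ σ : Fin nS × Fin A × Fin B,
      G.reachAux h σ.1 * (μ (G.x σ.1) σ.2.1 * ν (G.y σ.1) σ.2.2) * φ σ := by
  obtain ⟨n, rfl⟩ : ∃ n, H = n + 1 := ⟨H - 1, by have := G.horizon_pos; omega⟩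
  set F : ℕ → Fin nS × Fin A × Fin B → ℝ := fun j σ =>
    G.reachAux j σ.1 * (μ (G.x σ.1) σ.2.1 * ν (G.y σ.1) σ.2.2) with hF
  have h0 : (fun σ : Fin nS × Fin A × Fin B =>
      G.p0 σ.1 * (policyOf μ (G.x σ.1) σ.2.1 * policyOf ν (G.y σ.1) σ.2.2)) = F 0 := by
    funext σ
    by_cases h : G.p0 σ.1 = 0
    · simp [hF, reachAux, h]
    · have h0 := G.p0_stage _ h
      have hx : (G.level (G.x σ.1) : ℕ) = 0 := by rw [level_x hG, h0]
      have hy : (G.levelY (G.y σ.1) : ℕ) = 0 := by rw [levelY_y hG, h0]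
      simp only [hF, policyOf, reachAux]
      rw [hμ.2.1 _ hx, hν.2.1 _ hy, div_one, div_one]
  simp_rw [pathProb_eq_chainWeight, h0]
  have key := sum_chainWeight_mul (K := fun σ σ' : Fin nS × Fin A × Fin B =>
    G.p σ.1 σ.2.1 σ.2.2 σ'.1 *
      (policyOf μ (G.x σ'.1) σ'.2.1 * policyOf ν (G.y σ'.1) σ'.2.2)) (n := n)
    -- Positive weight at a pair is positive mass at its successors, so the successor policies do
    -- sum to one.
    (P := fun j σ => (G.stage σ.1 : ℕ) = j ∧ μ (G.x σ.1) σ.2.1 ≠ 0 ∧ ν (G.y σ.1) σ.2.2 ≠ 0)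
    (F := F) ?_ ?_ ?_ ?_ φ h n 0 (by omega) h.2
  · rw [zero_add] at key
    exact key
  · rintro j hj ⟨s, a, b⟩ ⟨h1, h2, h3⟩
    rw [Fintype.sum_prod_type]
    rw [← G.p_sum s a b (by simp only at h1; omega)]
    refine Finset.sum_congr rfl fun s' _ => ?_
    by_cases hp : G.p s a b s' = 0
    · simp [hp]
    · rw [Fintype.sum_prod_type]
      simp only
      simp_rw [← Finset.mul_sum]
      rw [← Finset.sum_mul, sum_policyOf, sum_policyOf]
      · ring
      · rwa [hν.2.2 _ _ _ ⟨s, a, s', rfl, rfl, hp⟩]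
      · rwa [hμ.2.2 _ _ _ ⟨s, b, s', rfl, rfl, hp⟩]
  · rintro j ⟨s, a, b⟩ ⟨s', a', b'⟩ ⟨h1, -, -⟩ hK
    have h4 := right_ne_zero_of_mul hK
    refine ⟨?_, fun h => left_ne_zero_of_mul h4 ?_, fun h => right_ne_zero_of_mul h4 ?_⟩
    · rw [G.p_stage _ _ _ _ (left_ne_zero_of_mul hK), h1]
    · simp only at h
      rw [policyOf, h, zero_div]
    · simp only at h
      rw [policyOf, h, zero_div]
  · intro j σ hσ
    have h4 := right_ne_zero_of_mul hσ
    exact ⟨stage_of_reachAux_ne_zero (left_ne_zero_of_mul hσ), left_ne_zero_of_mul h4,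
      right_ne_zero_of_mul h4⟩
  · rintro j hj ⟨s', a', b'⟩
    rw [Fintype.sum_prod_type]
    simp only [hF, reachAux]
    rw [Finset.sum_mul]
    refine Finset.sum_congr rfl fun s _ => ?_
    rw [Fintype.sum_prod_type, Finset.sum_mul]
    refine Finset.sum_congr rfl fun a _ => ?_
    rw [Finset.sum_mul]
    refine Finset.sum_congr rfl fun b _ => ?_
    by_cases hp : G.p s a b s' = 0
    · simp [hp]
    · rw [← mul_policyOf hμ (G.x s') a', ← mul_policyOf hν (G.y s') b',
        hμ.2.2 _ _ _ ⟨s, b, s', rfl, rfl, hp⟩, hν.2.2 _ _ _ ⟨s, a, s', rfl, rfl, hp⟩]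
      ring

/-- The probability of passing through a pair of Alice, with weights depending on the state and on
Bob's action. -/
theorem sum_pathProb_visit (hG : G.IsTreePerfectRecall) {μ : Fin nX → Fin A → ℝ}
    {ν : Fin nY → Fin B → ℝ} (hμ : μ ∈ G.TX) (hν : ν ∈ G.TY) (x : Fin nX) (a : Fin A)
    (φ : Fin nS × Fin A × Fin B → ℝ) :
    ∑ z, G.pathProb μ ν z * (if G.x (z (G.level x)).1 = x ∧ (z (G.level x)).2.1 = a then
      φ (z (G.level x)) else 0) =
      μ x a * ∑ s, if G.x s = x then ∑ b, G.reach s * ν (G.y s) b * φ (s, a, b) else 0 := by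
  rw [sum_pathProb_mul hG hμ hν (G.level x) fun σ => if G.x σ.1 = x ∧ σ.2.1 = a then φ σ else 0,
    Fintype.sum_prod_type, Finset.mul_sum]
  refine Finset.sum_congr rfl fun s _ => ?_
  rw [Fintype.sum_prod_type]
  simp only
  by_cases hx : G.x s = x
  · subst hx
    rw [if_pos rfl, Finset.sum_eq_single a]
    · simp only [and_self, if_true, level_x hG]
      rw [Finset.mul_sum]
      refine Finset.sum_congr rfl fun b _ => ?_
      rw [reach]
      ring
    · intro a' _ ha
      simp [ha]
    · simp
  · simp [hx]

end EFG

/-! ### Measurability of the algorithm. -/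

section TreeplexMeasurable

variable {Ω I K : Type*} [MeasurableSpace Ω] [Fintype K]

theorem measurable_policyOf {μ : Ω → I → K → ℝ} (hμ : ∀ x a, Measurable fun ω => μ ω x a)
    (x : I) (a : K) : Measurable fun ω => policyOf (μ ω) x a := by
  unfold policyOf
  exact (hμ x a).div (Finset.measurable_sum _ fun a _ => hμ x a)

variable [Fintype I]

theorem measurable_backIter {child : I → K → I → Prop} {w : I → ℝ} {π c : Ω → I → K → ℝ}
    (hπ : ∀ x a, Measurable fun ω => π ω x a) (hc : ∀ x a, Measurable fun ω => c ω x a) (n : ℕ)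
    (x : I) : Measurable fun ω => backIter child w (π ω) (c ω) n x := by
  induction n generalizing x with
  | zero => exact measurable_const
  | succ n ih =>
    refine measurable_const.mul (Real.measurable_log.comp (Finset.measurable_sum _ fun a _ =>
      (hπ x a).mul (Real.measurable_exp.comp (((hc x a).add
        (Finset.measurable_sum _ fun x' _ => ?_)).neg.div_const _))))
    split_ifs
    · exact ih x'
    · exact measurable_const

theorem measurable_nextPolicy {H : ℕ} {level : I → ℕ} {child : I → K → I → Prop} {w : I → ℝ}
    {π c : Ω → I → K → ℝ} (hπ : ∀ x a, Measurable fun ω => π ω x a)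
    (hc : ∀ x a, Measurable fun ω => c ω x a) (x : I) (a : K) :
    Measurable fun ω => nextPolicy H level child w (π ω) (c ω) x a := by
  refine (hπ x a).mul (Real.measurable_exp.comp (((Measurable.add (hc x a)
    (Finset.measurable_sum _ fun x' _ => ?_)).sub
      (measurable_backIter hπ hc _ _)).neg.div_const _))
  split_ifs
  · exact measurable_backIter hπ hc _ _
  · exact measurable_const

end TreeplexMeasurable

/-- The memory of the algorithm is a random variable. -/
structure PAState.IsMeasurable {Ω : Type*} (m : MeasurableSpace Ω) {nX A : ℕ}
    (S : Ω → PAState nX A) : Prop where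
  k : Measurable[m] fun ω => (S ω).k
  alpha : Measurable[m] fun ω => (S ω).alpha
  cum : ∀ x a, Measurable[m] fun ω => (S ω).cum x a
  muHat : ∀ x a, Measurable[m] fun ω => (S ω).muHat x a

theorem PAState.IsMeasurable.mono {Ω : Type*} {m m' : MeasurableSpace Ω} (hle : m ≤ m')
    {nX A : ℕ} {S : Ω → PAState nX A} (h : PAState.IsMeasurable m S) :
    PAState.IsMeasurable m' S :=
  ⟨h.k.mono hle le_rfl, h.alpha.mono hle le_rfl, fun x a => (h.cum x a).mono hle le_rfl,
    fun x a => (h.muHat x a).mono hle le_rfl⟩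

namespace EFG

variable {H nS nX nY A B : ℕ} {G : EFG H nS nX nY A B} {δ : ℝ} {T : ℕ}
  {μc : Fin nX → Fin A → ℝ}

section Measurability

variable {Ω : Type*} [m : MeasurableSpace Ω]

theorem measurable_estimator {p : Ω → Fin nX → Fin A → ℝ}
    {O : Ω → Fin H → Fin nX × Fin A × ℝ} (hp : ∀ x a, Measurable fun ω => p ω x a)
    (hO : ∀ h, Measurable fun ω => O ω h) (x : Fin nX) (a : Fin A) :
    Measurable fun ω => G.estimator (p ω) (O ω) x a := by
  unfold estimator
  refine Measurable.ite ?_ ((measurable_snd.comp (measurable_snd.comp (hO _))).div (hp x a))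
    measurable_const
  exact ((measurable_fst.comp (hO (G.level x))) (measurableSet_singleton x)).inter
    ((measurable_fst.comp (measurable_snd.comp (hO (G.level x)))) (measurableSet_singleton a))

theorem measurable_omdStrategy {w : Fin nX → ℝ} {τ : ℝ} {μ₀ c : Ω → Fin nX → Fin A → ℝ}
    (h₀ : ∀ x a, Measurable fun ω => μ₀ ω x a) (hc : ∀ x a, Measurable fun ω => c ω x a)
    (x : Fin nX) (a : Fin A) :
    Measurable fun ω => G.omdStrategy w τ (μ₀ ω) (c ω) x a := by
  have h := measurable_nextPolicy (H := H) (level := fun x => (G.level x : ℕ))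
    (child := G.childX) (w := w) (measurable_policyOf h₀)
    (fun x a => (hc x a).const_mul τ)
  refine (h x a).mul (Finset.measurable_prod _ fun x' _ => Finset.measurable_prod _ fun a' _ => ?_)
  split_ifs
  · exact h x' a'
  · exact measurable_const

theorem measurableSet_exceeds {C : Ω → Fin nX → Fin A → ℝ}
    (hC : ∀ x a, Measurable fun ω => C ω x a) :
    MeasurableSet {ω | G.Exceeds δ T μc (C ω)} := by
  -- The test is a union over uncountably many `μ`; openness of each set replaces a countability or
  -- maximiser argument.
  have h1 : IsOpen {c : Fin nX → Fin A → ℝ | G.Exceeds δ T μc c} := by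
    have : {c : Fin nX → Fin A → ℝ | G.Exceeds δ T μc c} = ⋃ μ ∈ G.TX,
        {c | 2 * G.paramR δ T < pairing c (fun x a => μc x a - μ x a)} := by
      ext c
      simp [Exceeds]
    rw [this]
    refine isOpen_biUnion fun μ _ => isOpen_lt continuous_const ?_
    unfold pairing
    fun_prop
  have h2 : Measurable C := measurable_pi_lambda _ fun x => measurable_pi_lambda _ fun a => hC x a
  exact h2 h1.measurableSet

theorem isMeasurable_paStep (hG : G.IsTreePerfectRecall) (hA : 0 < A) (hB : 0 < B)
    {S : Ω → PAState nX A} (hS : PAState.IsMeasurable m S)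
    (hpos : ∀ ω x a, 0 < (S ω).muHat x a) {O : Ω → Fin H → Fin nX × Fin A × ℝ}
    (hO : ∀ h, Measurable fun ω => O ω h) :
    PAState.IsMeasurable m fun ω => G.paStep δ T μc (S ω) (O ω) := by
  have hp : ∀ x a, Measurable fun ω => (S ω).play μc x a := fun x a =>
    (hS.alpha.mul (hS.muHat x a)).add ((measurable_const.sub hS.alpha).mul measurable_const)
  have hc := measurable_estimator (G := G) hp hO
  have hcum : ∀ x a, Measurable fun ω =>
      (S ω).cum x a + G.estimator ((S ω).play μc) (O ω) x a := fun x a => (hS.cum x a).add (hc x a)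
  have hset : MeasurableSet {ω | G.Exceeds δ T μc (fun x a => (S ω).cum x a +
      G.estimator ((S ω).play μc) (O ω) x a) ∧ (S ω).alpha < 1} :=
    (measurableSet_exceeds hcum).inter (measurableSet_lt hS.alpha measurable_const)
  have heq : ∀ ω, G.paStep δ T μc (S ω) (O ω) = _ := fun ω => paStep_eq hG hA hB (hpos ω)
  constructor
  · simp_rw [heq, apply_ite PAState.k]
    exact Measurable.ite hset (hS.k.add_const 1) hS.k
  · simp_rw [heq, apply_ite PAState.alpha]
    refine Measurable.ite hset ?_ hS.alpha
    exact (measurable_from_top (f := fun k : ℕ => min ((2 : ℝ) ^ k / G.paramR δ T) 1)).comp hS.k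
  · intro x a
    simp_rw [heq, apply_ite PAState.cum, ite_apply]
    exact Measurable.ite hset measurable_const (hcum x a)
  · intro x a
    simp_rw [heq, apply_ite PAState.muHat, ite_apply]
    refine Measurable.ite hset measurable_const ?_
    simp_rw [omdUpdate, ite_apply]
    exact Measurable.ite (measurableSet_lt hS.alpha measurable_const)
      (measurable_omdStrategy hS.muHat hc x a) (measurable_omdStrategy hS.muHat hc x a)

end Measurability

/-- The observations of Alice with normalised costs. -/
noncomputable def normObserve (G : EFG H nS nX nY A B) (lo r : ℝ) (v : Traj H nS A B) (h : Fin H) :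
    Fin nX × Fin A × ℝ :=
  ((G.observe v h).1, (G.observe v h).2.1, ((G.observe v h).2.2 - lo) / r)

theorem measurable_normObserve (lo r : ℝ) (h : Fin H) :
    Measurable fun v : Traj H nS A B => G.normObserve lo r v h := by
  unfold normObserve observe
  have h1 : Measurable fun v : Traj H nS A B => v.1 h :=
    (measurable_pi_apply h).comp measurable_fst
  have h2 : Measurable fun v : Traj H nS A B => v.2 h :=
    (measurable_pi_apply h).comp measurable_snd
  simp only
  refine Measurable.prodMk ((measurable_of_countable fun s => G.x s).comp (measurable_fst.comp h1))
    (Measurable.prodMk (measurable_fst.comp (measurable_snd.comp h1))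
      ((h2.sub_const lo).div_const r))

theorem paState_succ (lo r : ℝ) (w : ℕ → Traj H nS A B) (t : ℕ) :
    G.paState δ T μc lo r w (t + 1) =
      G.paStep δ T μc (G.paState δ T μc lo r w t) (G.normObserve lo r (w t)) := rfl

theorem isAdmissible_paState (hG : G.IsTreePerfectRecall) (hA : 0 < A) (hB : 0 < B)
    (hP : G.GoodParams δ T) (lo r : ℝ) (w : ℕ → Traj H nS A B) (t : ℕ) :
    G.IsAdmissible δ T (G.paState δ T μc lo r w t) := by
  induction t with
  | zero => exact IsAdmissible.init hG hA hP
  | succ t ih => exact ih.step hG hA hB hP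

section Play

variable {Ω : Type*} [mΩ : MeasurableSpace Ω] {P : Measure Ω} {ℱ : Filtration ℕ mΩ} {lo r : ℝ}
  {ν : ℕ → Ω → Fin nY → Fin B → ℝ} {w : ℕ → Ω → Traj H nS A B}

theorem isMeasurable_paState (hG : G.IsTreePerfectRecall) (hA : 0 < A) (hB : 0 < B)
    (hP : G.GoodParams δ T) (hplay : G.IsPlay P ℱ δ T μc lo r ν w) {t : ℕ} (ht : t ≤ T) :
    PAState.IsMeasurable (ℱ t) fun ω => G.paState δ T μc lo r (fun j => w j ω) t := by
  induction t with
  | zero =>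
    exact ⟨measurable_const, measurable_const, fun _ _ => measurable_const,
      fun _ _ => measurable_const⟩
  | succ t ih =>
    have h2 := (ih (by omega)).mono (ℱ.mono (Nat.le_succ t))
    exact @isMeasurable_paStep _ _ _ _ _ _ G _ _ _ Ω (ℱ (t + 1)) hG hA hB _ h2
      (fun ω => (isAdmissible_paState hG hA hB hP lo r _ t).muHat_pos) _
      (fun h => (measurable_normObserve lo r h).comp (hplay.traj_meas t (by omega)))

end Play

end EFG

/-! ### The trajectory of a round, given the past. -/

namespace EFG

variable {H nS nX nY A B : ℕ} {G : EFG H nS nX nY A B} {δ : ℝ} {T : ℕ}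
  {μc : Fin nX → Fin A → ℝ}

/-- The law of the trajectory when the states and actions are given. -/
noncomputable def costLaw (G : EFG H nS nX nY A B) (z : Fin H → Fin nS × Fin A × Fin B) :
    Measure (Traj H nS A B) :=
  (Measure.dirac z).prod (Measure.pi fun h => G.cost (z h).1 (z h).2.1 (z h).2.2)

theorem trajLaw_eq (μ : Fin nX → Fin A → ℝ) (ν : Fin nY → Fin B → ℝ) :
    G.trajLaw μ ν = ∑ z, ENNReal.ofReal (G.pathProb μ ν z) • G.costLaw z := rfl

instance isProbabilityMeasure_cost (s : Fin nS) (a : Fin A) (b : Fin B) :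
    IsProbabilityMeasure (G.cost s a b) := G.cost_prob s a b

instance isProbabilityMeasure_costLaw (z : Fin H → Fin nS × Fin A × Fin B) :
    IsProbabilityMeasure (G.costLaw z) := by
  unfold costLaw
  infer_instance

theorem trajLaw_apply (μ : Fin nX → Fin A → ℝ) (ν : Fin nY → Fin B → ℝ)
    (E : Set (Traj H nS A B)) :
    G.trajLaw μ ν E = ∑ z, ENNReal.ofReal (G.pathProb μ ν z) * G.costLaw z E := by
  rw [trajLaw_eq, Measure.finsetSum_apply]
  simp

theorem trajLaw_apply_ne_top (μ : Fin nX → Fin A → ℝ) (ν : Fin nY → Fin B → ℝ)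
    (E : Set (Traj H nS A B)) : G.trajLaw μ ν E ≠ ⊤ := by
  rw [trajLaw_apply]
  exact ENNReal.sum_ne_top.2 fun z _ => ENNReal.mul_ne_top ENNReal.ofReal_ne_top
    (measure_ne_top _ _)

theorem measurable_pathProb {Ω : Type*} [MeasurableSpace Ω] {μ : Ω → Fin nX → Fin A → ℝ}
    {ν : Ω → Fin nY → Fin B → ℝ} (hμ : ∀ x a, Measurable fun ω => μ ω x a)
    (hν : ∀ y b, Measurable fun ω => ν ω y b) (z : Fin H → Fin nS × Fin A × Fin B) :
    Measurable fun ω => G.pathProb (μ ω) (ν ω) z :=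
  Finset.measurable_prod _ fun _ _ => ((measurable_const.mul (measurable_policyOf hμ _ _)).mul
    (measurable_policyOf hν _ _)).mul measurable_const

section Play

variable {Ω : Type*} [mΩ : MeasurableSpace Ω] {P : Measure Ω}
  {ℱ : Filtration ℕ mΩ} {lo r : ℝ}
  {ν : ℕ → Ω → Fin nY → Fin B → ℝ} {w : ℕ → Ω → Traj H nS A B}

theorem measurable_paStrategy (hG : G.IsTreePerfectRecall) (hA : 0 < A) (hB : 0 < B)
    (hP : G.GoodParams δ T) (hplay : G.IsPlay P ℱ δ T μc lo r ν w) {t : ℕ} (ht : t ≤ T)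
    (x : Fin nX) (a : Fin A) :
    Measurable[ℱ t] fun ω => G.paStrategy δ T μc lo r (fun j => w j ω) t x a := by
  have hS := isMeasurable_paState hG hA hB hP hplay ht
  exact (hS.alpha.mul (hS.muHat x a)).add ((measurable_const.sub hS.alpha).mul measurable_const)

theorem measurable_nu (hplay : G.IsPlay P ℱ δ T μc lo r ν w) {t : ℕ} (ht : t < T)
    (y : Fin nY) (b : Fin B) : Measurable[ℱ t] fun ω => ν t ω y b :=
  (measurable_pi_apply b).comp ((measurable_pi_apply y).comp (hplay.nu_meas t ht))

theorem measurable_pathProb_play (hG : G.IsTreePerfectRecall) (hA : 0 < A) (hB : 0 < B)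
    (hP : G.GoodParams δ T) (hplay : G.IsPlay P ℱ δ T μc lo r ν w) {t : ℕ} (ht : t < T)
    (z : Fin H → Fin nS × Fin A × Fin B) : Measurable[ℱ t] fun ω =>
      G.pathProb (G.paStrategy δ T μc lo r (fun j => w j ω) t) (ν t ω) z :=
  @measurable_pathProb _ _ _ _ _ _ G Ω (ℱ t) _ _
    (measurable_paStrategy hG hA hB hP hplay ht.le) (measurable_nu hplay ht) z

variable [IsProbabilityMeasure P]

/-- Upgrades `traj_law` from conditional probabilities to arbitrary nonnegative densities known
before the round, without integrability. -/
theorem setLIntegral_traj (hG : G.IsTreePerfectRecall) (hA : 0 < A) (hB : 0 < B)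
    (hP : G.GoodParams δ T) (hplay : G.IsPlay P ℱ δ T μc lo r ν w) {t : ℕ} (ht : t < T)
    {g : Ω → ENNReal} (hg : Measurable[ℱ t] g) {E : Set (Traj H nS A B)} (hE : MeasurableSet E) :
    ∫⁻ ω in w t ⁻¹' E, g ω ∂P = ∫⁻ ω, G.trajLaw
      (G.paStrategy δ T μc lo r (fun j => w j ω) t) (ν t ω) E * g ω ∂P := by
  set L : Ω → ENNReal := fun ω =>
    G.trajLaw (G.paStrategy δ T μc lo r (fun j => w j ω) t) (ν t ω) E with hL
  have hle := ℱ.le t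
  have hW : MeasurableSet (w t ⁻¹' E) :=
    ((hplay.traj_meas t ht).mono (ℱ.le _) le_rfl) hE
  have hLm : Measurable[ℱ t] L := by
    simp_rw [hL, trajLaw_apply]
    exact Finset.measurable_sum _ fun z _ =>
      (ENNReal.measurable_ofReal.comp (measurable_pathProb_play hG hA hB hP hplay ht z)).mul_const _
  have hLm' : Measurable L := hLm.mono hle le_rfl
  have hlaw := hplay.traj_law t ht E hE
  have hint : Integrable (fun ω => (L ω).toReal) P :=
    (integrable_condExp (m := ℱ t)).congr hlaw
  -- The defining property of conditional expectation says that the two measures agree on `ℱ t`;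
  -- integrals of `ℱ t`-measurable functions then agree as well.
  have key : (P.restrict (w t ⁻¹' E)).trim hle = (P.withDensity L).trim hle := by
    refine @Measure.ext _ (ℱ t) _ _ fun S hS => ?_
    have hS' : MeasurableSet S := hle S hS
    rw [trim_measurableSet_eq hle hS, trim_measurableSet_eq hle hS, withDensity_apply _ hS',
      Measure.restrict_apply hS']
    have h1 := setIntegral_condExp hle (f := (w t ⁻¹' E).indicator fun _ => (1 : ℝ)) (μ := P)
      ((integrable_const 1).indicator hW) hS
    rw [setIntegral_indicator hW, setIntegral_const, smul_eq_mul, mul_one] at h1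
    have h2 : ∫ ω in S, (L ω).toReal ∂P = P.real (S ∩ w t ⁻¹' E) := by
      rw [← h1]
      exact integral_congr_ae (ae_restrict_of_ae (hlaw.mono fun ω h => h.symm))
    have h3 : ∫⁻ ω in S, L ω ∂P = ENNReal.ofReal (∫ ω in S, (L ω).toReal ∂P) := by
      rw [ofReal_integral_eq_lintegral_ofReal hint.integrableOn
        (Filter.Eventually.of_forall fun ω => ENNReal.toReal_nonneg)]
      refine lintegral_congr fun ω => ?_
      rw [ENNReal.ofReal_toReal (trajLaw_apply_ne_top _ _ _)]
    rw [h3, h2, Measure.real, ENNReal.ofReal_toReal (measure_ne_top _ _)]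
  rw [← lintegral_trim hle hg, key, lintegral_trim hle hg,
    lintegral_withDensity_eq_lintegral_mul _ hLm' (hg.mono hle le_rfl)]
  rfl

/-- The law of the trajectory of a round under a density which is known before the round. -/
theorem map_withDensity_traj (hG : G.IsTreePerfectRecall) (hA : 0 < A) (hB : 0 < B)
    (hP : G.GoodParams δ T) (hplay : G.IsPlay P ℱ δ T μc lo r ν w) {t : ℕ} (ht : t < T)
    {g : Ω → ENNReal} (hg : Measurable[ℱ t] g) :
    (P.withDensity g).map (w t) = ∑ z, (∫⁻ ω, ENNReal.ofReal (G.pathProb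
      (G.paStrategy δ T μc lo r (fun j => w j ω) t) (ν t ω) z) * g ω ∂P) • G.costLaw z := by
  have hw : Measurable (w t) := (hplay.traj_meas t ht).mono (ℱ.le _) le_rfl
  have hp : ∀ z, Measurable fun ω => ENNReal.ofReal (G.pathProb
      (G.paStrategy δ T μc lo r (fun j => w j ω) t) (ν t ω) z) := fun z =>
    ENNReal.measurable_ofReal.comp
      ((measurable_pathProb_play hG hA hB hP hplay ht z).mono (ℱ.le _) le_rfl)
  have hg' : Measurable g := hg.mono (ℱ.le _) le_rfl
  ext E hE
  rw [Measure.map_apply hw hE, withDensity_apply _ (hw hE),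
    setLIntegral_traj hG hA hB hP hplay ht hg hE, Measure.finsetSum_apply]
  simp_rw [trajLaw_apply, Finset.sum_mul]
  have hm : ∀ z, Measurable fun ω => ENNReal.ofReal (G.pathProb
      (G.paStrategy δ T μc lo r (fun j => w j ω) t) (ν t ω) z) * G.costLaw z E * g ω := fun z =>
    ((hp z).mul_const _).mul hg'
  have hm' : ∀ z, Measurable fun ω => ENNReal.ofReal (G.pathProb
      (G.paStrategy δ T μc lo r (fun j => w j ω) t) (ν t ω) z) * g ω := fun z => (hp z).mul hg'
  rw [lintegral_finsetSum _ fun z _ => hm z]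
  refine Finset.sum_congr rfl fun z _ => ?_
  rw [Measure.smul_apply, smul_eq_mul, ← lintegral_mul_const _ (hm' z)]
  exact lintegral_congr fun ω => by ring

/-- Conditional expectation of a function of the trajectory of a round. -/
theorem integral_mul_traj (hG : G.IsTreePerfectRecall) (hA : 0 < A) (hB : 0 < B)
    (hP : G.GoodParams δ T) (hμc : μc ∈ G.TX) (hplay : G.IsPlay P ℱ δ T μc lo r ν w) {t : ℕ}
    (ht : t < T) {g : Ω → ℝ} (hg : Measurable[ℱ t] g) (hg0 : ∀ ω, 0 ≤ g ω)
    {φ : Traj H nS A B → ℝ} (hφ : Measurable φ) (hφ0 : ∀ v, 0 ≤ φ v) (hφ1 : ∀ v, φ v ≤ 1)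
    (hL : Integrable (fun ω => g ω * ∑ z, G.pathProb
      (G.paStrategy δ T μc lo r (fun j => w j ω) t) (ν t ω) z * ∫ v, φ v ∂(G.costLaw z)) P) :
    Integrable (fun ω => g ω * φ (w t ω)) P ∧ ∫ ω, g ω * φ (w t ω) ∂P =
      ∫ ω, g ω * ∑ z, G.pathProb (G.paStrategy δ T μc lo r (fun j => w j ω) t) (ν t ω) z *
        ∫ v, φ v ∂(G.costLaw z) ∂P := by
  have hw : Measurable (w t) := (hplay.traj_meas t ht).mono (ℱ.le _) le_rfl
  have hg' : Measurable g := hg.mono (ℱ.le _) le_rfl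
  set p : (Fin H → Fin nS × Fin A × Fin B) → Ω → ℝ := fun z ω => G.pathProb
      (G.paStrategy δ T μc lo r (fun j => w j ω) t) (ν t ω) z with hp
  have hp0 : ∀ z ω, 0 ≤ p z ω := fun z ω => pathProb_nonneg
    ((isAdmissible_paState hG hA hB hP lo r _ t).play_mem hP hμc) (hplay.nu_mem t ht ω) z
  have hpm : ∀ z, Measurable (p z) := fun z =>
    (measurable_pathProb_play hG hA hB hP hplay ht z).mono (ℱ.le _) le_rfl
  have hφi : ∀ z, 0 ≤ ∫ v, φ v ∂(G.costLaw z) := fun z => integral_nonneg hφ0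
  have hφl : ∀ z, ∫⁻ v, ENNReal.ofReal (φ v) ∂(G.costLaw z) =
      ENNReal.ofReal (∫ v, φ v ∂(G.costLaw z)) := fun z => by
    rw [ofReal_integral_eq_lintegral_ofReal]
    · refine Integrable.of_bound hφ.aestronglyMeasurable 1 (Filter.Eventually.of_forall fun v => ?_)
      rw [Real.norm_of_nonneg (hφ0 v)]
      exact hφ1 v
    · exact Filter.Eventually.of_forall hφ0
  have hgm : Measurable[ℱ t] fun ω => ENNReal.ofReal (g ω) := ENNReal.measurable_ofReal.comp hg
  have hgm' : Measurable fun ω => ENNReal.ofReal (g ω) := ENNReal.measurable_ofReal.comp hg'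
  have hφm : Measurable fun v => ENNReal.ofReal (φ v) := ENNReal.measurable_ofReal.comp hφ
  -- The density `g`, later a quotient by the played strategy, is not assumed bounded. The identity
  -- is proved for nonnegative integrals and also transfers integrability from the right side.
  have key : ∫⁻ ω, ENNReal.ofReal (g ω * φ (w t ω)) ∂P =
      ∫⁻ ω, ENNReal.ofReal (g ω * ∑ z, p z ω * ∫ v, φ v ∂(G.costLaw z)) ∂P := by
    have h1 := map_withDensity_traj hG hA hB hP hplay ht hgm
    have h2 : ∫⁻ v, ENNReal.ofReal (φ v) ∂((P.withDensity fun ω => ENNReal.ofReal (g ω)).map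
        (w t)) = ∫⁻ ω, ENNReal.ofReal (g ω * φ (w t ω)) ∂P := by
      rw [lintegral_map hφm hw, lintegral_withDensity_eq_lintegral_mul _ hgm'
        (show Measurable fun ω => ENNReal.ofReal (φ (w t ω)) from hφm.comp hw)]
      refine lintegral_congr fun ω => ?_
      rw [ENNReal.ofReal_mul (hg0 ω)]
      rfl
    rw [← h2, h1, lintegral_finsetSum_measure]
    simp_rw [lintegral_smul_measure, hφl, smul_eq_mul]
    have h3 : ∀ ω, ENNReal.ofReal (g ω * ∑ z, p z ω * ∫ v, φ v ∂(G.costLaw z)) =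
        ∑ z, ENNReal.ofReal (p z ω) * ENNReal.ofReal (g ω) *
          ENNReal.ofReal (∫ v, φ v ∂(G.costLaw z)) := fun ω => by
      rw [Finset.mul_sum, ENNReal.ofReal_sum_of_nonneg fun z _ =>
        mul_nonneg (hg0 ω) (mul_nonneg (hp0 z ω) (hφi z))]
      refine Finset.sum_congr rfl fun z _ => ?_
      rw [ENNReal.ofReal_mul (hg0 ω), ENNReal.ofReal_mul (hp0 z ω)]
      ring
    have hpm' : ∀ z, Measurable fun ω => ENNReal.ofReal (p z ω) := fun z =>
      ENNReal.measurable_ofReal.comp (hpm z)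
    simp_rw [h3]
    have hm' : ∀ z, Measurable fun ω => ENNReal.ofReal (p z ω) * ENNReal.ofReal (g ω) := fun z =>
      (hpm' z).mul hgm'
    rw [lintegral_finsetSum _ fun z _ => (hm' z).mul_const _]
    refine Finset.sum_congr rfl fun z _ => ?_
    rw [lintegral_mul_const _ (hm' z)]
  have hn1 : ∀ ω, 0 ≤ g ω * φ (w t ω) := fun ω => mul_nonneg (hg0 ω) (hφ0 _)
  have hn2 : ∀ ω, 0 ≤ g ω * ∑ z, p z ω * ∫ v, φ v ∂(G.costLaw z) := fun ω =>
    mul_nonneg (hg0 ω) (Finset.sum_nonneg fun z _ => mul_nonneg (hp0 z ω) (hφi z))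
  have hm1 : AEStronglyMeasurable (fun ω => g ω * φ (w t ω)) P :=
    (hg'.mul (hφ.comp hw)).aestronglyMeasurable
  refine ⟨⟨hm1, ?_⟩, ?_⟩
  · rw [hasFiniteIntegral_iff_ofReal (Filter.Eventually.of_forall hn1), key,
      ← hasFiniteIntegral_iff_ofReal (Filter.Eventually.of_forall hn2)]
    exact hL.2
  · rw [integral_eq_lintegral_of_nonneg_ae (Filter.Eventually.of_forall hn1) hm1, key,
      integral_eq_lintegral_of_nonneg_ae (Filter.Eventually.of_forall hn2) hL.1]

end Play

end EFG

namespace EFG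

variable {H nS nX nY A B : ℕ} {G : EFG H nS nX nY A B} {δ : ℝ} {T : ℕ}
  {μc : Fin nX → Fin A → ℝ}

/-! ### Occupancies -/

theorem mul_occ_le_one (hG : G.IsTreePerfectRecall) {μ : Fin nX → Fin A → ℝ}
    {ν : Fin nY → Fin B → ℝ} (hμ : μ ∈ G.TX) (hν : ν ∈ G.TY) (x : Fin nX) (a : Fin A) :
    μ x a * G.occ ν x ≤ 1 := by
  rw [← sum_mass_mul_occ hG hμ hν (G.level x)]
  have h1 : (if G.level x = G.level x then (∑ a, μ x a) * G.occ ν x else 0) ≤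
      ∑ x', (if G.level x' = G.level x then (∑ a, μ x' a) * G.occ ν x' else 0) :=
    Finset.single_le_sum (f := fun x' =>
      if G.level x' = G.level x then (∑ a, μ x' a) * G.occ ν x' else 0) (fun x' _ => by
        split_ifs
        · exact mul_nonneg (mass_nonneg hμ x') (occ_nonneg hν x')
        · exact le_rfl) (Finset.mem_univ x)
  rw [if_pos rfl] at h1
  exact (mul_le_mul_of_nonneg_right (le_mass hμ x a) (occ_nonneg hν x)).trans h1

/-- A different strategy may be used for each stage, as needed for the balanced ones. -/
theorem sum_mass_level_mul_occ (hG : G.IsTreePerfectRecall)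
    {μ : Fin H → Fin nX → Fin A → ℝ} {ν : Fin nY → Fin B → ℝ} (hμ : ∀ h, μ h ∈ G.TX)
    (hν : ν ∈ G.TY) : ∑ x, ∑ a, μ (G.level x) x a * G.occ ν x = H := by
  have h1 : ∀ x, ∑ a, μ (G.level x) x a * G.occ ν x =
      ∑ h, if G.level x = h then (∑ a, μ h x a) * G.occ ν x else 0 := by
    intro x
    rw [Finset.sum_ite_eq, if_pos (Finset.mem_univ _), Finset.sum_mul]
  simp_rw [h1]
  rw [Finset.sum_comm]
  simp_rw [sum_mass_mul_occ hG (hμ _) hν]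
  simp

theorem sum_mul_occ (hG : G.IsTreePerfectRecall) {μ : Fin nX → Fin A → ℝ}
    {ν : Fin nY → Fin B → ℝ} (hμ : μ ∈ G.TX) (hν : ν ∈ G.TY) :
    ∑ x, ∑ a, μ x a * G.occ ν x = H := sum_mass_level_mul_occ hG (fun _ => hμ) hν

/-- Bounding `μc` below by `δ` in `∑ μc · occ = H`. -/
theorem sum_occ_le (hG : G.IsTreePerfectRecall) {ν : Fin nY → Fin B → ℝ} (hμc : μc ∈ G.TX)
    (hν : ν ∈ G.TY) (hδ : 0 < δ) (h : ∀ x a, δ ≤ μc x a) :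
    ∑ x, ∑ _a : Fin A, G.occ ν x ≤ H / δ := by
  rw [le_div_iff₀ hδ, ← sum_mul_occ hG hμc hν, Finset.sum_mul]
  refine Finset.sum_le_sum fun x _ => ?_
  rw [Finset.sum_mul]
  refine Finset.sum_le_sum fun a _ => ?_
  rw [mul_comm]
  exact mul_le_mul_of_nonneg_right (h x a) (occ_nonneg hν x)

/-- The inverse weight is the balanced strategy of the stage of the infoset, so each stage
contributes one. -/
theorem sum_balWeight_occ (hG : G.IsTreePerfectRecall) (hA : 0 < A) (hB : 0 < B)
    {ν : Fin nY → Fin B → ℝ} (hν : ν ∈ G.TY) :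
    ∑ x, ∑ _a : Fin A, 1 / G.balWeight x * G.occ ν x = H := by
  rw [← sum_mass_level_mul_occ hG (balStrategy_mem hG hA hB) hν]
  simp_rw [balStrategy_level]

/-- The bound for the expectation of the second-order term of a round. -/
noncomputable def secondOrderBound (G : EFG H nS nX nY A B) (δ : ℝ) (T : ℕ) (α : ℝ) : ℝ :=
  if α < 1 then α * (G.paramEta δ T * H ^ 3 / δ) else G.paramTau T * H ^ 3 / 2

/-- The summands of the second-order term of a round. -/
noncomputable def secondOrderTerm (G : EFG H nS nX nY A B) (δ : ℝ) (T : ℕ)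
    (μc : Fin nX → Fin A → ℝ) (st : PAState nX A) (x : Fin nX) (a : Fin A) : ℝ :=
  if st.alpha < 1 then st.alpha * (G.paramEta δ T * H ^ 2 / 2 *
    (st.muHat x a / st.play μc x a ^ 2))
  else st.alpha * (G.paramTau T * H ^ 2 / 2 * (1 / (G.balWeight x * st.muHat x a)))

theorem alpha_mul_secondOrder (st : PAState nX A) (o : Fin H → Fin nX × Fin A × ℝ) :
    st.alpha * G.secondOrder δ T μc st o = G.visitSum o (G.secondOrderTerm δ T μc st) := by
  unfold secondOrder secondOrderTerm
  split_ifs <;> simp only [visitSum, Finset.mul_sum, mul_ite, mul_zero]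

theorem secondOrderTerm_nonneg (hG : G.IsTreePerfectRecall) (hA : 0 < A) (hB : 0 < B)
    (hP : G.GoodParams δ T) {st : PAState nX A} (hst : G.IsAdmissible δ T st)
    (x : Fin nX) (a : Fin A) : 0 ≤ G.secondOrderTerm δ T μc st x a := by
  have h1 := hst.alpha_pos hP
  have h2 := hst.muHat_pos x a
  have h3 := balWeight_pos hG hA hB x
  have h4 := hP.eta_pos
  have h5 := hP.tau_pos
  unfold secondOrderTerm
  split_ifs <;> positivity

/-- The visiting probability cancels one power of the played strategy. What remains is `(iterate /
played) · occ` in the mixed case and `occ / weight` in the balanced one. -/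
theorem sum_secondOrderTerm_le (hG : G.IsTreePerfectRecall) (hA : 0 < A) (hB : 0 < B)
    (hP : G.GoodParams δ T) (hδ : 0 < δ) (hμc : μc ∈ G.TX) (h : ∀ x a, δ ≤ μc x a)
    {st : PAState nX A} (hst : G.IsAdmissible δ T st) {ν : Fin nY → Fin B → ℝ}
    (hν : ν ∈ G.TY) :
    ∑ x, ∑ a, G.secondOrderTerm δ T μc st x a * (st.play μc x a * G.occ ν x) ≤
      G.secondOrderBound δ T st.alpha := by
  have hα := hst.alpha_pos hP
  have hα1 := hst.alpha_le_one
  have hη := hP.eta_pos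
  unfold secondOrderTerm secondOrderBound
  split_ifs with hlt
  · have key : ∑ x, ∑ a, (1 + st.muHat x a / δ) * G.occ ν x ≤ 2 * (H / δ) := by
      have h1 : ∑ x, ∑ a, (1 + st.muHat x a / δ) * G.occ ν x =
          ∑ x, ∑ _a : Fin A, G.occ ν x + (∑ x, ∑ a, st.muHat x a * G.occ ν x) / δ := by
        simp_rw [Finset.sum_div, ← Finset.sum_add_distrib]
        exact Finset.sum_congr rfl fun x _ => Finset.sum_congr rfl fun a _ => by ring
      rw [h1, sum_mul_occ hG hst.muHat_mem hν]
      linarith [sum_occ_le hG hμc hν hδ h]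
    calc _ ≤ ∑ x, ∑ a, st.alpha * (G.paramEta δ T * H ^ 2 / 2) *
          ((1 + st.muHat x a / δ) * G.occ ν x) := by
          refine Finset.sum_le_sum fun x _ => Finset.sum_le_sum fun a _ => ?_
          have hp := hst.play_pos hP hμc x a
          have hm := hst.muHat_pos x a
          have ho := occ_nonneg hν x
          -- The mixture lies between the iterate and `μc`. If the iterate is the smaller, the ratio
          -- is at most one; otherwise the mixture is at least `μc ≥ δ`. No factor `1/α` or `1/(1 -
          -- α)` appears.
          have h1 : st.muHat x a / st.play μc x a ≤ 1 + st.muHat x a / δ := by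
            have hd : 0 < st.muHat x a / δ := by positivity
            rcases le_total (st.muHat x a) (μc x a) with hc | hc
            · have : st.muHat x a / st.play μc x a ≤ 1 := by
                rw [div_le_one hp]
                simp only [PAState.play]
                nlinarith
              linarith
            · have : st.muHat x a / st.play μc x a ≤ st.muHat x a / δ := by
                refine div_le_div_of_nonneg_left hm.le hδ ((h x a).trans ?_)
                simp only [PAState.play]
                nlinarith
              linarith
          have h2 : st.alpha * (G.paramEta δ T * H ^ 2 / 2 *
              (st.muHat x a / st.play μc x a ^ 2)) * (st.play μc x a * G.occ ν x) =
              st.alpha * (G.paramEta δ T * H ^ 2 / 2) *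
                (st.muHat x a / st.play μc x a * G.occ ν x) := by
            field_simp
          rw [h2]
          gcongr
      _ = st.alpha * (G.paramEta δ T * H ^ 2 / 2) *
          ∑ x, ∑ a, (1 + st.muHat x a / δ) * G.occ ν x := by
          simp_rw [Finset.mul_sum]
      _ ≤ st.alpha * (G.paramEta δ T * H ^ 2 / 2) * (2 * (H / δ)) := by gcongr
      _ = _ := by ring
  · have h1 : st.alpha = 1 := le_antisymm hα1 (not_lt.1 hlt)
    rw [hst.play_of_not_lt hlt, h1]
    have h2 : ∀ x a, 1 * (G.paramTau T * H ^ 2 / 2 * (1 / (G.balWeight x * st.muHat x a))) *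
        (st.muHat x a * G.occ ν x) =
        G.paramTau T * H ^ 2 / 2 * (1 / G.balWeight x * G.occ ν x) := fun x a => by
      have := (hst.muHat_pos x a).ne'
      have := (balWeight_pos hG hA hB x).ne'
      field_simp
    simp_rw [h2, ← Finset.mul_sum]
    have h3 := sum_balWeight_occ hG hA hB hν
    simp_rw [← Finset.mul_sum] at h3
    rw [h3]
    apply le_of_eq
    ring

/-! ### Normalised costs -/

/-- The cost vector of the normalised costs. -/
noncomputable def normCost (G : EFG H nS nX nY A B) (lo r : ℝ) (ν : Fin nY → Fin B → ℝ)
    (x : Fin nX) (a : Fin A) : ℝ :=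
  ∑ s, if G.x s = x then ∑ b, G.reach s * ν (G.y s) b * ((G.meanCost s a b - lo) / r) else 0

variable {lo r : ℝ}

theorem integrable_cost (hcost : ∀ s a b, ∀ᵐ u ∂(G.cost s a b), u ∈ Set.Icc lo (lo + r))
    (s : Fin nS) (a : Fin A) (b : Fin B) : Integrable (fun u => u) (G.cost s a b) := by
  refine Integrable.of_bound measurable_id.aestronglyMeasurable (|lo| + |lo + r|) ?_
  filter_upwards [hcost s a b] with u hu
  rw [Real.norm_eq_abs]
  have h1 := hu.1
  have h2 := hu.2
  rw [abs_le]
  constructor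
  · linarith [neg_abs_le lo, abs_nonneg (lo + r)]
  · linarith [le_abs_self (lo + r), abs_nonneg lo]

theorem normMeanCost_mem (hr : 0 < r)
    (hcost : ∀ s a b, ∀ᵐ u ∂(G.cost s a b), u ∈ Set.Icc lo (lo + r))
    (s : Fin nS) (a : Fin A) (b : Fin B) : (G.meanCost s a b - lo) / r ∈ Set.Icc (0 : ℝ) 1 := by
  have h1 : lo ≤ G.meanCost s a b := by
    have := integral_mono_ae (integrable_const lo) (integrable_cost hcost s a b)
      ((hcost s a b).mono fun u hu => hu.1)
    simpa [meanCost] using this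
  have h2 : G.meanCost s a b ≤ lo + r := by
    have := integral_mono_ae (integrable_cost hcost s a b) (integrable_const (lo + r))
      ((hcost s a b).mono fun u hu => hu.2)
    simpa [meanCost] using this
  exact ⟨div_nonneg (by linarith) hr.le, (div_le_one hr).2 (by linarith)⟩

theorem normCost_nonneg (hr : 0 < r)
    (hcost : ∀ s a b, ∀ᵐ u ∂(G.cost s a b), u ∈ Set.Icc lo (lo + r)) {ν : Fin nY → Fin B → ℝ}
    (hν : ν ∈ G.TY) (x : Fin nX) (a : Fin A) : 0 ≤ G.normCost lo r ν x a :=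
  Finset.sum_nonneg fun s _ => by
    split_ifs
    · exact Finset.sum_nonneg fun b _ => mul_nonneg (mul_nonneg (reach_nonneg s) (hν.1 _ _))
        (normMeanCost_mem hr hcost s a b).1
    · exact le_rfl

theorem normCost_le_occ (hr : 0 < r)
    (hcost : ∀ s a b, ∀ᵐ u ∂(G.cost s a b), u ∈ Set.Icc lo (lo + r)) {ν : Fin nY → Fin B → ℝ}
    (hν : ν ∈ G.TY) (x : Fin nX) (a : Fin A) : G.normCost lo r ν x a ≤ G.occ ν x :=
  Finset.sum_le_sum fun s _ => by
    split_ifs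
    · rw [Finset.mul_sum]
      exact Finset.sum_le_sum fun b _ => mul_le_of_le_one_right
        (mul_nonneg (reach_nonneg s) (hν.1 _ _)) (normMeanCost_mem hr hcost s a b).2
    · exact le_rfl

/-- Regrets scale with the normalisation of the costs. -/
theorem instRegret_eq (hG : G.IsTreePerfectRecall) (hr : 0 < r) {μ μ' : Fin nX → Fin A → ℝ}
    {ν : Fin nY → Fin B → ℝ} (hμ : μ ∈ G.TX) (hμ' : μ' ∈ G.TX) (hν : ν ∈ G.TY) :
    G.instRegret μ' ν μ = r * (pairing μ' (G.normCost lo r ν) - pairing μ (G.normCost lo r ν)) := by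
  have h1 : ∀ x a, G.costVec ν x a = r * G.normCost lo r ν x a + lo * G.occ ν x := by
    intro x a
    rw [costVec, normCost, occ, Finset.mul_sum, Finset.mul_sum, ← Finset.sum_add_distrib]
    refine Finset.sum_congr rfl fun s _ => ?_
    split_ifs
    · rw [Finset.mul_sum, Finset.mul_sum, Finset.mul_sum, ← Finset.sum_add_distrib]
      refine Finset.sum_congr rfl fun b _ => ?_
      field_simp
      ring
    · simp
  -- The shift costs every strategy `lo · H`, so it cancels in differences.
  have h2 : ∀ {μ : Fin nX → Fin A → ℝ}, μ ∈ G.TX →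
      pairing μ (G.costVec ν) = r * pairing μ (G.normCost lo r ν) + lo * H := by
    intro μ hμ
    rw [← sum_mul_occ hG hμ hν, pairing, pairing, Finset.mul_sum, Finset.mul_sum,
      ← Finset.sum_add_distrib]
    refine Finset.sum_congr rfl fun x _ => ?_
    rw [Finset.mul_sum, Finset.mul_sum, ← Finset.sum_add_distrib]
    refine Finset.sum_congr rfl fun a _ => ?_
    rw [h1]
    ring
  rw [instRegret, pairing_sub_left, h2 hμ, h2 hμ']
  ring

end EFG

/-! ### Observations and unbiasedness of the estimators. -/

namespace EFG

variable {H nS nX nY A B : ℕ} {G : EFG H nS nX nY A B} {δ : ℝ} {T : ℕ}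
  {μc : Fin nX → Fin A → ℝ} {lo r : ℝ}

theorem paStrategy_mem (hG : G.IsTreePerfectRecall) (hA : 0 < A) (hB : 0 < B)
    (hP : G.GoodParams δ T) (hμc : μc ∈ G.TX) (lo r : ℝ) (w : ℕ → Traj H nS A B) (t : ℕ) :
    G.paStrategy δ T μc lo r w t ∈ G.TX :=
  (isAdmissible_paState hG hA hB hP lo r w t).play_mem hP hμc

theorem visits_normObserve (v : Traj H nS A B) (x : Fin nX) (a : Fin A) :
    G.Visits (G.normObserve lo r v) x a ↔
      G.x (v.1 (G.level x)).1 = x ∧ (v.1 (G.level x)).2.1 = a := Iff.rfl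

theorem costLaw_eq_map (z : Fin H → Fin nS × Fin A × Fin B) : G.costLaw z =
    (Measure.pi fun h => G.cost (z h).1 (z h).2.1 (z h).2.2).map (Prod.mk z) := by
  rw [costLaw, Measure.dirac_prod]

theorem integral_costLaw (z : Fin H → Fin nS × Fin A × Fin B) {φ : Traj H nS A B → ℝ}
    (hφ : Measurable φ) : ∫ v, φ v ∂(G.costLaw z) =
      ∫ u, φ (z, u) ∂(Measure.pi fun h => G.cost (z h).1 (z h).2.1 (z h).2.2) := by
  rw [costLaw_eq_map, integral_map measurable_prodMk_left.aemeasurable hφ.aestronglyMeasurable]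

/-- The indicator of the trajectories through `(x, a)`. -/
noncomputable def visitFun (G : EFG H nS nX nY A B) (x : Fin nX) (a : Fin A)
    (v : Traj H nS A B) : ℝ :=
  if G.x (v.1 (G.level x)).1 = x ∧ (v.1 (G.level x)).2.1 = a then 1 else 0

/-- The normalised cost at `(x, a)` of the trajectories through `(x, a)`, cut off at `0` and `1`. -/
noncomputable def visitCost (G : EFG H nS nX nY A B) (lo r : ℝ) (x : Fin nX) (a : Fin A)
    (v : Traj H nS A B) : ℝ :=
  if G.x (v.1 (G.level x)).1 = x ∧ (v.1 (G.level x)).2.1 = a then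
    max 0 (min 1 ((v.2 (G.level x) - lo) / r)) else 0

theorem measurableSet_visit (x : Fin nX) (a : Fin A) : MeasurableSet {v : Traj H nS A B |
    G.x (v.1 (G.level x)).1 = x ∧ (v.1 (G.level x)).2.1 = a} :=
  measurable_fst (Set.toFinite {z : Fin H → Fin nS × Fin A × Fin B |
    G.x (z (G.level x)).1 = x ∧ (z (G.level x)).2.1 = a}).measurableSet

theorem measurable_visitFun (x : Fin nX) (a : Fin A) : Measurable (G.visitFun x a) :=
  Measurable.ite (measurableSet_visit x a) measurable_const measurable_const

theorem measurable_visitCost (x : Fin nX) (a : Fin A) : Measurable (G.visitCost lo r x a) := by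
  refine Measurable.ite (measurableSet_visit x a) ?_ measurable_const
  have : Measurable fun v : Traj H nS A B => v.2 (G.level x) :=
    (measurable_pi_apply _).comp measurable_snd
  exact measurable_const.max (measurable_const.min ((this.sub_const lo).div_const r))

theorem integral_visitFun (z : Fin H → Fin nS × Fin A × Fin B) (x : Fin nX) (a : Fin A) :
    ∫ v, G.visitFun x a v ∂(G.costLaw z) =
      if G.x (z (G.level x)).1 = x ∧ (z (G.level x)).2.1 = a then 1 else 0 := by
  rw [integral_costLaw z (measurable_visitFun x a)]
  simp only [visitFun]
  split_ifs <;> simp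

theorem integral_visitCost (hr : 0 < r)
    (hcost : ∀ s a b, ∀ᵐ u ∂(G.cost s a b), u ∈ Set.Icc lo (lo + r))
    (z : Fin H → Fin nS × Fin A × Fin B) (x : Fin nX) (a : Fin A) :
    ∫ v, G.visitCost lo r x a v ∂(G.costLaw z) =
      if G.x (z (G.level x)).1 = x ∧ (z (G.level x)).2.1 = a then
        (G.meanCost (z (G.level x)).1 a (z (G.level x)).2.2 - lo) / r else 0 := by
  rw [integral_costLaw z (measurable_visitCost x a)]
  simp only [visitCost]
  split_ifs with h
  · rw [integral_comp_eval (μ := fun h => G.cost (z h).1 (z h).2.1 (z h).2.2)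
      (i := G.level x) (f := fun u : ℝ => max 0 (min 1 ((u - lo) / r)))
      (by fun_prop), h.2]
    have h1 : ∫ u, max 0 (min 1 ((u - lo) / r)) ∂(G.cost (z (G.level x)).1 a (z (G.level x)).2.2) =
        ∫ u, (u - lo) / r ∂(G.cost (z (G.level x)).1 a (z (G.level x)).2.2) := by
      refine integral_congr_ae ?_
      filter_upwards [hcost (z (G.level x)).1 a (z (G.level x)).2.2] with u hu
      have h2 : (u - lo) / r ≤ 1 := (div_le_one hr).2 (by linarith [hu.2])
      have h3 : 0 ≤ (u - lo) / r := div_nonneg (by linarith [hu.1]) hr.le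
      rw [min_eq_right h2, max_eq_right h3]
    rw [h1, integral_div, integral_sub (integrable_cost hcost _ _ _) (integrable_const lo)]
    simp [meanCost]
  · simp

section Play

variable {Ω : Type*} [mΩ : MeasurableSpace Ω] {P : Measure Ω}
  {ℱ : Filtration ℕ mΩ}
  {ν : ℕ → Ω → Fin nY → Fin B → ℝ} {w : ℕ → Ω → Traj H nS A B}

theorem measurable_occ (hplay : G.IsPlay P ℱ δ T μc lo r ν w) {t : ℕ} (ht : t < T)
    (x : Fin nX) : Measurable fun ω => G.occ (ν t ω) x := by
  refine Finset.measurable_sum _ fun s _ => ?_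
  split_ifs
  · exact (Finset.measurable_sum _ fun b _ =>
      (measurable_nu hplay ht _ b).mono (ℱ.le t) le_rfl).const_mul _
  · exact measurable_const

theorem measurable_normCost (hplay : G.IsPlay P ℱ δ T μc lo r ν w) {t : ℕ} (ht : t < T)
    (x : Fin nX) (a : Fin A) : Measurable fun ω => G.normCost lo r (ν t ω) x a := by
  refine Finset.measurable_sum _ fun s _ => ?_
  split_ifs
  · exact Finset.measurable_sum _ fun b _ =>
      (((measurable_nu hplay ht _ b).mono (ℱ.le t) le_rfl).const_mul _).mul_const _
  · exact measurable_const

variable [IsProbabilityMeasure P]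

/-- The observations are almost surely consistent with the game. -/
theorem ae_isObservation (hG : G.IsTreePerfectRecall) (hA : 0 < A) (hB : 0 < B)
    (hP : G.GoodParams δ T) (hplay : G.IsPlay P ℱ δ T μc lo r ν w) (hr : 0 < r)
    (hcost : ∀ s a b, ∀ᵐ u ∂(G.cost s a b), u ∈ Set.Icc lo (lo + r)) {t : ℕ} (ht : t < T) :
    ∀ᵐ ω ∂P, G.IsObservation (G.normObserve lo r (w t ω)) := by
  have hw : Measurable (w t) := (hplay.traj_meas t ht).mono (ℱ.le _) le_rfl
  have h1 := map_withDensity_traj hG hA hB hP hplay ht (g := fun _ => 1) measurable_const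
  have h2 : P.withDensity (fun _ => 1) = P := by
    have := withDensity_one (μ := P)
    exact this
  rw [h2] at h1
  refine ae_of_ae_map (p := fun v => G.IsObservation (G.normObserve lo r v)) hw.aemeasurable ?_
  rw [h1, ae_finsetSum_measure_iff]
  intro z _
  -- A path impossible for all `ω` has coefficient zero in the law; any other path has legal
  -- transitions and stages.
  by_cases hz : ∃ ω, G.pathProb (G.paStrategy δ T μc lo r (fun j => w j ω) t) (ν t ω) z ≠ 0
  · obtain ⟨ω, hz⟩ := hz
    refine Measure.ae_smul_measure ?_ _
    have h3 : ∀ᵐ v ∂(G.costLaw z), v.1 = z ∧ ∀ h, v.2 h ∈ Set.Icc lo (lo + r) := by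
      rw [costLaw_eq_map, ae_map_iff measurable_prodMk_left.aemeasurable]
      · simp only [true_and]
        exact Filter.eventually_all.2 fun h =>
          Measure.tendsto_eval_ae_ae.eventually (hcost (z h).1 (z h).2.1 (z h).2.2)
      · refine (measurable_fst (measurableSet_singleton z)).inter ?_
        have hs : {v : Traj H nS A B | ∀ h, v.2 h ∈ Set.Icc lo (lo + r)} =
            ⋂ h, {v | v.2 h ∈ Set.Icc lo (lo + r)} := by
          ext
          simp
        change MeasurableSet {v : Traj H nS A B | ∀ h, v.2 h ∈ Set.Icc lo (lo + r)}
        rw [hs]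
        exact MeasurableSet.iInter fun h =>
          ((measurable_pi_apply h).comp measurable_snd) measurableSet_Icc
    filter_upwards [h3] with v hv
    obtain ⟨rfl, hv⟩ := hv
    refine ⟨fun h => ?_, fun h hh => ?_, fun h => ?_, fun h => ?_⟩
    · exact (level_x hG _).trans (stage_of_pathProb_ne_zero hz h)
    · exact ⟨_, _, _, rfl, rfl, p_ne_zero_of_pathProb_ne_zero hz h hh⟩
    · exact div_nonneg (sub_nonneg.2 (hv h).1) hr.le
    · refine (div_le_one hr).2 ?_
      have := (hv h).2
      simp only [observe]
      linarith
  · push Not at hz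
    simp [hz]

/-- The expectation of a sum over the visited pairs with weights known before the round. -/
theorem integral_visitSum (hG : G.IsTreePerfectRecall) (hA : 0 < A) (hB : 0 < B)
    (hP : G.GoodParams δ T) (hμc : μc ∈ G.TX) (hplay : G.IsPlay P ℱ δ T μc lo r ν w) {t : ℕ}
    (ht : t < T) {f : Ω → Fin nX → Fin A → ℝ} (hf : ∀ x a, Measurable[ℱ t] fun ω => f ω x a)
    (hf0 : ∀ ω x a, 0 ≤ f ω x a)
    (hi : ∀ x a, Integrable (fun ω => f ω x a *
      (G.paStrategy δ T μc lo r (fun j => w j ω) t x a * G.occ (ν t ω) x)) P) :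
    Integrable (fun ω => G.visitSum (G.normObserve lo r (w t ω)) (f ω)) P ∧
      ∫ ω, G.visitSum (G.normObserve lo r (w t ω)) (f ω) ∂P = ∫ ω, ∑ x, ∑ a, f ω x a *
        (G.paStrategy δ T μc lo r (fun j => w j ω) t x a * G.occ (ν t ω) x) ∂P := by
  have hL : ∀ x a ω, ∑ z, G.pathProb (G.paStrategy δ T μc lo r (fun j => w j ω) t) (ν t ω) z *
      ∫ v, G.visitFun x a v ∂(G.costLaw z) =
      G.paStrategy δ T μc lo r (fun j => w j ω) t x a * G.occ (ν t ω) x := fun x a ω => by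
    simp_rw [integral_visitFun]
    rw [sum_pathProb_visit hG (paStrategy_mem hG hA hB hP hμc lo r _ t)
      (hplay.nu_mem t ht ω) x a fun _ => 1]
    simp only [mul_one, occ, Finset.mul_sum]
  have key := fun x a => integral_mul_traj hG hA hB hP hμc hplay ht (hf x a)
    (fun ω => hf0 ω x a) (measurable_visitFun (G := G) x a)
    (fun v => by unfold visitFun; split_ifs <;> norm_num)
    (fun v => by unfold visitFun; split_ifs <;> norm_num)
    (by simp_rw [hL]; exact hi x a)
  simp_rw [hL] at key
  have heq : ∀ ω, G.visitSum (G.normObserve lo r (w t ω)) (f ω) =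
      ∑ x, ∑ a, f ω x a * G.visitFun x a (w t ω) := fun ω => by
    refine Finset.sum_congr rfl fun x _ => Finset.sum_congr rfl fun a _ => ?_
    simp only [visitFun, visits_normObserve, mul_ite, mul_one, mul_zero]
  simp_rw [heq]
  refine ⟨integrable_finsetSum _ fun x _ => integrable_finsetSum _ fun a _ => (key x a).1, ?_⟩
  rw [integral_finsetSum _ fun x _ => integrable_finsetSum _ fun a _ => (key x a).1,
    integral_finsetSum _ fun x _ => integrable_finsetSum _ fun a _ => hi x a]
  refine Finset.sum_congr rfl fun x _ => ?_
  rw [integral_finsetSum _ fun a _ => (key x a).1, integral_finsetSum _ fun a _ => hi x a]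
  exact Finset.sum_congr rfl fun a _ => (key x a).2

/-- The products are bounded by one because weight times occupancy is a probability. -/
theorem integrable_mul_normCost (hG : G.IsTreePerfectRecall)
    (hplay : G.IsPlay P ℱ δ T μc lo r ν w) (hr : 0 < r)
    (hcost : ∀ s a b, ∀ᵐ u ∂(G.cost s a b), u ∈ Set.Icc lo (lo + r)) {t : ℕ} (ht : t < T)
    {μ : Ω → Fin nX → Fin A → ℝ} (hμm : ∀ x a, Measurable fun ω => μ ω x a)
    (hμ : ∀ ω, μ ω ∈ G.TX) (x : Fin nX) (a : Fin A) :
    Integrable (fun ω => μ ω x a * G.normCost lo r (ν t ω) x a) P := by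
  refine Integrable.of_bound ((hμm x a).mul (measurable_normCost hplay ht x a)).aestronglyMeasurable
    1 (Filter.Eventually.of_forall fun ω => ?_)
  have h1 := normCost_nonneg hr hcost (hplay.nu_mem t ht ω) x a
  have h2 := normCost_le_occ hr hcost (hplay.nu_mem t ht ω) x a
  have h3 := (hμ ω).1 x a
  rw [Real.norm_of_nonneg (mul_nonneg h3 h1)]
  exact (mul_le_mul_of_nonneg_left h2 h3).trans (mul_occ_le_one hG (hμ ω) (hplay.nu_mem t ht ω) x a)

theorem integrable_pairing_normCost (hG : G.IsTreePerfectRecall)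
    (hplay : G.IsPlay P ℱ δ T μc lo r ν w) (hr : 0 < r)
    (hcost : ∀ s a b, ∀ᵐ u ∂(G.cost s a b), u ∈ Set.Icc lo (lo + r)) {t : ℕ} (ht : t < T)
    {μ : Ω → Fin nX → Fin A → ℝ} (hμm : ∀ x a, Measurable fun ω => μ ω x a)
    (hμ : ∀ ω, μ ω ∈ G.TX) : Integrable (fun ω => pairing (μ ω) (G.normCost lo r (ν t ω))) P :=
  integrable_finsetSum _ fun x _ => integrable_finsetSum _ fun a _ =>
    integrable_mul_normCost hG hplay hr hcost ht hμm hμ x a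

/-- The cost estimators are unbiased. -/
theorem integral_pairing_estimator (hG : G.IsTreePerfectRecall) (hA : 0 < A) (hB : 0 < B)
    (hP : G.GoodParams δ T) (hμc : μc ∈ G.TX) (hplay : G.IsPlay P ℱ δ T μc lo r ν w)
    (hr : 0 < r) (hcost : ∀ s a b, ∀ᵐ u ∂(G.cost s a b), u ∈ Set.Icc lo (lo + r)) {t : ℕ}
    (ht : t < T) {μ : Ω → Fin nX → Fin A → ℝ} (hμm : ∀ x a, Measurable[ℱ t] fun ω => μ ω x a)
    (hμ : ∀ ω, μ ω ∈ G.TX) :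
    Integrable (fun ω => pairing (μ ω) (G.estimator
      (G.paStrategy δ T μc lo r (fun j => w j ω) t) (G.normObserve lo r (w t ω)))) P ∧
    ∫ ω, pairing (μ ω) (G.estimator (G.paStrategy δ T μc lo r (fun j => w j ω) t)
      (G.normObserve lo r (w t ω))) ∂P = ∫ ω, pairing (μ ω) (G.normCost lo r (ν t ω)) ∂P := by
  set p : Ω → Fin nX → Fin A → ℝ := fun ω => G.paStrategy δ T μc lo r (fun j => w j ω) t with hp
  have hadm := fun ω => isAdmissible_paState (μc := μc) hG hA hB hP lo r (fun j => w j ω) t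
  have hppos : ∀ ω x a, 0 < p ω x a := fun ω x a => (hadm ω).play_pos hP hμc x a
  have hpmem : ∀ ω, p ω ∈ G.TX := fun ω => (hadm ω).play_mem hP hμc
  have hL : ∀ x a ω, μ ω x a / p ω x a * ∑ z,
      G.pathProb (G.paStrategy δ T μc lo r (fun j => w j ω) t) (ν t ω) z *
      ∫ v, G.visitCost lo r x a v ∂(G.costLaw z) =
      μ ω x a * G.normCost lo r (ν t ω) x a := fun x a ω => by
    simp_rw [integral_visitCost hr hcost]
    rw [sum_pathProb_visit hG (hpmem ω) (hplay.nu_mem t ht ω) x a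
      fun σ => (G.meanCost σ.1 a σ.2.2 - lo) / r]
    have := (hppos ω x a).ne'
    simp only [normCost]
    field_simp
  have hgm : ∀ x a, Measurable[ℱ t] fun ω => μ ω x a / p ω x a := fun x a =>
    (hμm x a).div (measurable_paStrategy hG hA hB hP hplay ht.le x a)
  have hi := fun x a => integrable_mul_normCost hG hplay hr hcost ht
    (fun x a => (hμm x a).mono (ℱ.le t) le_rfl) hμ x a
  have key := fun x a => integral_mul_traj hG hA hB hP hμc hplay ht (hgm x a)
    (fun ω => div_nonneg ((hμ ω).1 x a) (hppos ω x a).le)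
    (measurable_visitCost (G := G) (lo := lo) (r := r) x a)
    (fun v => by
      unfold visitCost
      split_ifs
      · exact le_max_left _ _
      · exact le_rfl)
    (fun v => by
      unfold visitCost
      split_ifs
      · exact max_le zero_le_one (min_le_left _ _)
      · exact zero_le_one)
    (by simp_rw [hL]; exact hi x a)
  simp_rw [hL] at key
  -- Almost surely the normalised costs lie in `[0, 1]`, so the cut-off of `visitCost`, which makes
  -- it bounded everywhere, changes nothing.
  have heq : (fun ω => pairing (μ ω) (G.estimator (p ω) (G.normObserve lo r (w t ω)))) =ᵐ[P]
      fun ω => ∑ x, ∑ a, μ ω x a / p ω x a * G.visitCost lo r x a (w t ω) := by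
    filter_upwards [ae_isObservation hG hA hB hP hplay hr hcost ht] with ω ho
    rw [pairing_estimator]
    refine Finset.sum_congr rfl fun x _ => Finset.sum_congr rfl fun a _ => ?_
    have h1 := ho.cost_nonneg (G.level x)
    have h2 := ho.cost_le_one (G.level x)
    simp only [visitCost, visits_normObserve, mul_ite, mul_zero]
    split_ifs
    · change _ = μ ω x a / p ω x a * max 0 (min 1 (G.normObserve lo r (w t ω) (G.level x)).2.2)
      rw [min_eq_right h2, max_eq_right h1]
      ring
    · rfl
  refine ⟨(integrable_congr heq).2 (integrable_finsetSum _ fun x _ =>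
    integrable_finsetSum _ fun a _ => (key x a).1), ?_⟩
  rw [integral_congr_ae heq]
  unfold pairing
  rw [integral_finsetSum _ fun x _ => integrable_finsetSum _ fun a _ => (key x a).1,
    integral_finsetSum _ fun x _ => integrable_finsetSum _ fun a _ => hi x a]
  refine Finset.sum_congr rfl fun x _ => ?_
  rw [integral_finsetSum _ fun a _ => (key x a).1, integral_finsetSum _ fun a _ => hi x a]
  exact Finset.sum_congr rfl fun a _ => (key x a).2

end Play

end EFG

namespace EFG

variable {H nS nX nY A B : ℕ} {G : EFG H nS nX nY A B} {δ : ℝ} {T : ℕ}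
  {μc : Fin nX → Fin A → ℝ} {lo r : ℝ}

/-! ### The parameters -/

/-- The inequalities between the parameters on which the regret bounds rest. -/
structure TunedParams (G : EFG H nS nX nY A B) (δ : ℝ) (T : ℕ) (μc : Fin nX → Fin A → ℝ) :
    Prop extends G.GoodParams δ T where
  comparator_le : dilKL μc G.uniformStrategy / G.paramEta δ T +
    T * (G.paramEta δ T * H ^ 3 / δ) ≤ G.paramR δ T
  bal_le : ∀ μ ∈ G.TX, G.balKL μ G.uniformStrategy / G.paramTau T ≤ G.paramR δ T / 2
  dil_second_le : T * (G.paramEta δ T * H ^ 3 / δ) ≤ G.paramR δ T / 4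
  bal_second_le : T * (G.paramTau T * H ^ 3 / 2) ≤ G.paramR δ T / 4

theorem nX_pos (G : EFG H nS nX nY A B) : 0 < nX :=
  Fin.pos (G.x G.exists_stage_zero.choose)

theorem log_pos_of_two_le {A : ℕ} (hA : 2 ≤ A) : 1 / 2 < Real.log A := by
  have h1 : (2 : ℝ) ≤ A := by exact_mod_cast hA
  have h2 := Real.log_le_log two_pos h1
  linarith [Real.log_two_gt_d9]

-- All parameters become monomials in the square roots `a`, `b`, `c`, `e`, `s` of `X log A`, `T`,
-- `H`, `8`, `A`. Then `X log A / η = R/√H`, the mixed second-order total is `R δ√H/8`, and both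
-- balanced quantities are compared with `R` through `A ≤ 1/δ`.
set_option maxHeartbeats 1000000 in
theorem tunedParams (hG : G.IsTreePerfectRecall) (hA : 2 ≤ A) (hB : 0 < B) (hT : 0 < T)
    (hδ : 0 < δ) (hδA : δ ≤ 1 / A) (hμc : μc ∈ G.TX) (h : ∀ x a, δ ≤ μc x a) :
    G.TunedParams δ T μc := by
  have hδH := mul_horizon_le_one hG hA hB hμc h
  have hA0 : 0 < A := by omega
  have hl := log_pos_of_two_le hA
  have hdil := fun μ hμ => dilKL_uniform_le (G := G) (μ := μ) hG hA0 hμ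
  have hdilc := dilKL_uniform_le_of_ge hG hA0 hμc hδ h
  have hbal := fun μ hμ => balKL_uniform_le (G := G) (μ := μ) hG hA0 hB hμ
  have hH1 : (1 : ℝ) ≤ H := by exact_mod_cast G.horizon_pos
  have hH2 : (H : ℝ) = 1 ∨ (2 : ℝ) ≤ H := by
    have := G.horizon_pos
    rcases Nat.lt_or_ge H 2 with h2 | h2
    · left
      have : H = 1 := by omega
      rw [this, Nat.cast_one]
    · right
      exact_mod_cast h2
  have hX1 : (1 : ℝ) ≤ nX := by exact_mod_cast G.nX_pos
  have hT1 : (1 : ℝ) ≤ T := by exact_mod_cast hT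
  have hA2 : (2 : ℝ) ≤ A := by exact_mod_cast hA
  obtain ⟨l, hl_def⟩ : ∃ l, l = Real.log A := ⟨_, rfl⟩
  rw [← hl_def] at hl hdilc
  simp_rw [← hl_def] at hdil hbal
  obtain ⟨a, ha⟩ : ∃ a, a = √(nX * l) := ⟨_, rfl⟩
  obtain ⟨b, hb⟩ : ∃ b, b = √(T : ℝ) := ⟨_, rfl⟩
  obtain ⟨c, hc⟩ : ∃ c, c = √(H : ℝ) := ⟨_, rfl⟩
  obtain ⟨e, he⟩ : ∃ e, e = √(8 : ℝ) := ⟨_, rfl⟩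
  obtain ⟨s, hs⟩ : ∃ s, s = √(A : ℝ) := ⟨_, rfl⟩
  have ha0 : 0 < a := by rw [ha]; exact Real.sqrt_pos.2 (by positivity)
  have hb0 : 0 < b := by rw [hb]; exact Real.sqrt_pos.2 (by positivity)
  have hc1 : 1 ≤ c := by rw [hc]; exact Real.one_le_sqrt.2 hH1
  have he0 : 0 < e := by rw [he]; exact Real.sqrt_pos.2 (by norm_num)
  have hs0 : 0 < s := by rw [hs]; exact Real.sqrt_pos.2 (by positivity)
  have ha2 : a ^ 2 = nX * l := by rw [ha]; exact Real.sq_sqrt (by positivity)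
  have hb2 : b ^ 2 = T := by rw [hb]; exact Real.sq_sqrt (by positivity)
  have hc2 : c ^ 2 = H := by rw [hc]; exact Real.sq_sqrt (by positivity)
  have he2 : e ^ 2 = 8 := by rw [he]; exact Real.sq_sqrt (by norm_num)
  have hs2 : s ^ 2 = A := by rw [hs]; exact Real.sq_sqrt (by positivity)
  have he2' : 2 ≤ e := by rw [he]; exact Real.le_sqrt_of_sq_le (by norm_num)
  have hs1 : 1 ≤ s := by rw [hs]; exact Real.one_le_sqrt.2 (by linarith)
  have hsA : s ≤ A * e / 2 := by
    have h1 : s ≤ A := by rw [← hs2]; exact le_self_pow₀ hs1 two_ne_zero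
    have h2 : (A : ℝ) * 2 ≤ A * e := mul_le_mul_of_nonneg_left he2' (by linarith)
    linarith
  have hc0 : 0 < c := by linarith
  have hR : G.paramR δ T = δ⁻¹ * (e * a * c ^ 3 * b) := by
    rw [paramR, ← hl_def]
    congr 1
    rw [Real.sqrt_eq_iff_mul_self_eq_of_pos (by positivity)]
    calc _ = e ^ 2 * a ^ 2 * (c ^ 2) ^ 3 * b ^ 2 := by ring
      _ = _ := by rw [ha2, hb2, hc2, he2]; ring
  have hη : G.paramEta δ T = δ * a / (e * c ^ 2 * b) := by
    rw [paramEta, ← hl_def]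
    rw [Real.sqrt_eq_iff_mul_self_eq_of_pos (by positivity)]
    calc _ = δ ^ 2 * a ^ 2 / (e ^ 2 * (c ^ 2) ^ 2 * b ^ 2) := by ring
      _ = _ := by rw [ha2, hb2, hc2, he2]; ring
  have hτ : G.paramTau T = a * s / (c ^ 3 * b) := by
    rw [paramTau, ← hl_def]
    rw [Real.sqrt_eq_iff_mul_self_eq_of_pos (by positivity)]
    calc _ = a ^ 2 * s ^ 2 / ((c ^ 2) ^ 3 * b ^ 2) := by ring
      _ = _ := by rw [ha2, hb2, hc2, hs2]; ring
  have hη0 : 0 < G.paramEta δ T := by rw [hη]; positivity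
  have hτ0 : 0 < G.paramTau T := by rw [hτ]; positivity
  have hR0 : 0 < G.paramR δ T := by rw [hR]; positivity
  have hinv : (A : ℝ) ≤ δ⁻¹ := by
    rw [le_inv_comm₀ (by positivity) hδ]
    simpa using hδA
  have hXη : nX * l / G.paramEta δ T = G.paramR δ T / c := by
    rw [hη, hR, ← ha2]
    field_simp
  have hκ : T * (G.paramEta δ T * H ^ 3 / δ) = G.paramR δ T * (δ * c / 8) := by
    rw [hη, hR, ← hb2, ← hc2, ← he2]
    field_simp
  have hcc : c ≤ c ^ 2 := le_self_pow₀ hc1 two_ne_zero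
  have hδc : δ * c ≤ 1 := (mul_le_mul_of_nonneg_left (hcc.trans_eq hc2) hδ.le).trans hδH
  have hab : a ≤ a * b := le_mul_of_one_le_right ha0.le (by rw [hb]; exact Real.one_le_sqrt.2 hT1)
  have hRA : A * (e * a * c ^ 3 * b) ≤ G.paramR δ T := by
    rw [hR]
    gcongr
  have hRH : (H : ℝ) ≤ G.paramR δ T ∧ 1 < G.paramR δ T := by
    have h1 : 1 / 2 < a := by
      have : l ≤ nX * l := le_mul_of_one_le_left (by linarith) hX1
      rw [ha]
      exact Real.lt_sqrt_of_sq_lt (by linarith)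
    have h2 : 1 / 2 < a * b := by linarith
    have h3 : c ^ 2 ≤ c ^ 3 := pow_le_pow_right₀ hc1 (by norm_num)
    have h4 : 4 * (1 / 2) * c ^ 2 ≤ A * (e * a * c ^ 3 * b) := by
      calc 4 * (1 / 2) * c ^ 2 ≤ 4 * (a * b) * c ^ 3 := by gcongr
        _ ≤ (A * e) * (a * b) * c ^ 3 := by
          have : 2 * 2 ≤ A * e := mul_le_mul hA2 he2' two_pos.le (by linarith)
          have : 4 ≤ A * e := by linarith
          gcongr
        _ = _ := by ring
    have h5 : 1 ≤ c ^ 2 := one_le_pow₀ hc1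
    rw [← hc2]
    constructor <;> linarith
  refine ⟨⟨hRH.2, hRH.1, hη0, hτ0, fun μ hμ => ?_⟩, ?_, fun μ hμ => ?_, ?_, ?_⟩
  · refine (div_le_div_of_nonneg_right (hdil μ hμ) hη0.le).trans ?_
    rw [hXη]
    exact div_le_self hR0.le hc1
  · have h1 := div_le_div_of_nonneg_right hdilc hη0.le
    rw [mul_div_assoc, hXη] at h1
    rw [hκ]
    refine (add_le_add_left h1 _).trans ?_
    have h2 : (1 - δ) * (G.paramR δ T / c) + G.paramR δ T * (δ * c / 8) =
        G.paramR δ T * ((1 - δ + δ * c ^ 2 / 8) / c) := by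
      field_simp
    rw [h2]
    refine mul_le_of_le_one_right hR0.le ?_
    rw [div_le_one hc0]
    -- For `H = 1` the second-order part `δ/8` must be paid by the `δ` gained in the divergence. For
    -- `H ≥ 2` the slack is `√H ≥ 9/8`, with `δH ≤ 1`.
    rcases hH2 with h3 | h3
    · rw [hc2, h3]
      linarith
    · have h4 : 9 / 8 ≤ c := by rw [hc]; exact Real.le_sqrt_of_sq_le (by linarith)
      rw [hc2]
      linarith
  · refine (div_le_div_of_nonneg_right (hbal μ hμ) hτ0.le).trans ?_
    have h1 : nX * A * l / G.paramTau T = s * (a * c ^ 3 * b) := by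
      rw [hτ, ← hs2, mul_right_comm, ← ha2]
      field_simp
    rw [h1]
    have h2 : s * (a * c ^ 3 * b) ≤ A * (e * a * c ^ 3 * b) / 2 := by
      calc s * (a * c ^ 3 * b) ≤ A * e / 2 * (a * c ^ 3 * b) := by gcongr
        _ = _ := by ring
    linarith
  · rw [hκ, mul_div_assoc', div_le_div_iff₀ (by norm_num) (by norm_num)]
    have := mul_le_mul_of_nonneg_left hδc hR0.le
    linarith
  · have h1 : T * (G.paramTau T * H ^ 3 / 2) = s * (a * c ^ 3 * b) / 2 := by
      rw [hτ, ← hb2, ← hc2]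
      field_simp
    rw [h1]
    have h2 : s * (a * c ^ 3 * b) ≤ A * (e * a * c ^ 3 * b) / 2 := by
      calc s * (a * c ^ 3 * b) ≤ A * e / 2 * (a * c ^ 3 * b) := by gcongr
        _ = _ := by ring
    linarith

/-! ### Pathwise regret bounds -/

/-- The regret of the first `t` rounds measured with the cost estimators. -/
noncomputable def estRegret (G : EFG H nS nX nY A B) (δ : ℝ) (T : ℕ) (μc : Fin nX → Fin A → ℝ)
    (lo r : ℝ) (w : ℕ → Traj H nS A B) (t : ℕ) (μ : Fin nX → Fin A → ℝ) : ℝ :=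
  ∑ j ∈ Finset.range t, pairing (fun x a => G.paStrategy δ T μc lo r w j x a - μ x a)
    (G.estimator (G.paStrategy δ T μc lo r w j) (G.normObserve lo r (w j)))

/-- The sum of the second-order terms of the first `t` rounds. -/
noncomputable def secondOrderSum (G : EFG H nS nX nY A B) (δ : ℝ) (T : ℕ)
    (μc : Fin nX → Fin A → ℝ) (lo r : ℝ) (w : ℕ → Traj H nS A B) (t : ℕ) : ℝ :=
  ∑ j ∈ Finset.range t, (G.paState δ T μc lo r w j).alpha *
    G.secondOrder δ T μc (G.paState δ T μc lo r w j) (G.normObserve lo r (w j))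

theorem exists_phaseBound (hG : G.IsTreePerfectRecall) (hA : 0 < A) (hB : 0 < B)
    (hP : G.GoodParams δ T) (hμc : μc ∈ G.TX) {w : ℕ → Traj H nS A B} {t : ℕ}
    (ho : ∀ j < t, G.IsObservation (G.normObserve lo r (w j))) :
    ∃ V W, G.PhaseBound δ T μc (G.paState δ T μc lo r w t)
      (G.estRegret δ T μc lo r w t) (G.secondOrderSum δ T μc lo r w t) V W := by
  induction t with
  | zero =>
    refine ⟨0, 0, ?_⟩
    have h := phaseBound_init (μc := μc) hP
    have h0 : G.estRegret δ T μc lo r w 0 = fun _ => 0 := by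
      funext μ
      simp [estRegret]
    have h1 : G.secondOrderSum δ T μc lo r w 0 = 0 := by simp [secondOrderSum]
    rw [h0, h1]
    exact h
  | succ t ih =>
    obtain ⟨V, W, hb⟩ := ih fun j hj => ho j (by omega)
    obtain ⟨V', W', hb'⟩ := hb.step hG hA hB hP hμc
      (isAdmissible_paState hG hA hB hP lo r w t) (ho t (by omega))
    refine ⟨V', W', ?_⟩
    have h1 : G.estRegret δ T μc lo r w (t + 1) = fun μ => G.estRegret δ T μc lo r w t μ +
        pairing (fun x a => G.paStrategy δ T μc lo r w t x a - μ x a)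
          (G.estimator (G.paStrategy δ T μc lo r w t) (G.normObserve lo r (w t))) := by
      funext μ
      rw [estRegret, Finset.sum_range_succ, estRegret]
    rw [h1, secondOrderSum, Finset.sum_range_succ]
    exact hb'

/-- Lets the second-order bounds of all earlier rounds be charged at the current `α`. -/
theorem alpha_mono (hG : G.IsTreePerfectRecall) (hA : 0 < A) (hB : 0 < B)
    (hP : G.GoodParams δ T) (w : ℕ → Traj H nS A B) :
    Monotone fun t => (G.paState δ T μc lo r w t).alpha := by
  refine monotone_nat_of_le_succ fun t => ?_
  have h := isAdmissible_paState (μc := μc) hG hA hB hP lo r w t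
  have hR := hP.one_lt
  rw [paState_succ, paStep_eq hG hA hB h.muHat_pos]
  split_ifs
  · rw [h.alpha_eq]
    simp only
    gcongr
    · norm_num
    · exact Nat.sub_le _ _
  · exact le_rfl

theorem secondOrderBound_le (hP : G.TunedParams δ T μc) {α : ℝ} (h0 : 0 ≤ α) :
    T * G.secondOrderBound δ T α ≤ G.paramR δ T / 4 := by
  unfold secondOrderBound
  split_ifs with h
  · have h1 := hP.dil_second_le
    have hR := hP.one_lt
    have h2 : T * (α * (G.paramEta δ T * H ^ 3 / δ)) =
      α * (T * (G.paramEta δ T * H ^ 3 / δ)) := by ring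
    rw [h2]
    nlinarith
  · exact hP.bal_second_le

theorem sum_secondOrderBound_le (hP : G.TunedParams δ T μc) (hT : 0 < T) {α : ℕ → ℝ}
    (h0 : ∀ j, 0 ≤ α j) :
    ∑ j ∈ Finset.range T, G.secondOrderBound δ T (α j) ≤ G.paramR δ T / 4 := by
  have hT' : (0 : ℝ) < T := by exact_mod_cast hT
  have h1 : ∀ j ∈ Finset.range T, G.secondOrderBound δ T (α j) ≤ G.paramR δ T / 4 / T :=
    fun j _ => by
      rw [le_div_iff₀ hT', mul_comm]
      exact secondOrderBound_le hP (h0 j)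
  refine (Finset.sum_le_sum h1).trans ?_
  rw [Finset.sum_const, Finset.card_range, nsmul_eq_mul, mul_div_cancel₀ _ hT'.ne']

/-- The past wins cover the running phase up to `1`: if `α < 1`, its loss is at most `αR = 2^(k-1)`
by the tuning. If `α = 1`, the wins are at least `R - 1`, against a divergence of `R/2` and
second-order bounds of `R/4`. The bracket on the right has nonpositive expectation. -/
theorem estRegret_comparator_le (hG : G.IsTreePerfectRecall) (hA : 0 < A) (hB : 0 < B)
    (hP : G.TunedParams δ T μc) (hT : 0 < T) (hδ : 0 < δ) (hμc : μc ∈ G.TX)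
    {w : ℕ → Traj H nS A B}
    (ho : ∀ j < T, G.IsObservation (G.normObserve lo r (w j))) :
    G.estRegret δ T μc lo r w T μc ≤ 1 + (G.secondOrderSum δ T μc lo r w T -
      ∑ j ∈ Finset.range T, G.secondOrderBound δ T (G.paState δ T μc lo r w j).alpha) := by
  have hP' := hP.toGoodParams
  obtain ⟨V, W, hb⟩ := exists_phaseBound hG hA hB hP' hμc ho
  have hadm := fun t => isAdmissible_paState (μc := μc) hG hA hB hP' lo r w t
  set st := G.paState δ T μc lo r w T with hst
  have hα0 := (hadm T).alpha_pos hP'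
  have h1 := hb.comparator
  have h2 := mul_le_mul_of_nonneg_left (hb.omd μc hμc) hα0.le
  have h3 := omdDiv_nonneg hG hA hB hP' (α := st.alpha) hμc (hadm T).muHat_pos
  have h4 := mul_nonneg hα0.le h3
  rcases lt_or_ge st.alpha 1 with hlt | hge
  · have h5 := (hadm T).alpha_mul hP' hlt
    have h6 : ∑ j ∈ Finset.range T,
        G.secondOrderBound δ T (G.paState δ T μc lo r w j).alpha ≤
        st.alpha * (T * (G.paramEta δ T * H ^ 3 / δ)) := by
      have h7 : ∀ j ∈ Finset.range T,
          G.secondOrderBound δ T (G.paState δ T μc lo r w j).alpha ≤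
          st.alpha * (G.paramEta δ T * H ^ 3 / δ) := fun j hj => by
        have h8 := alpha_mono (μc := μc) (lo := lo) (r := r) hG hA hB hP' w
          (Finset.mem_range.1 hj).le
        have h9 := hP.eta_pos
        rw [secondOrderBound, if_pos (lt_of_le_of_lt h8 hlt)]
        exact mul_le_mul_of_nonneg_right h8 (by positivity)
      refine (Finset.sum_le_sum h7).trans (le_of_eq ?_)
      rw [Finset.sum_const, Finset.card_range, nsmul_eq_mul]
      ring
    have h7 : G.omdDiv δ T st.alpha μc G.uniformStrategy =
        dilKL μc G.uniformStrategy / G.paramEta δ T := by rw [omdDiv, if_pos hlt]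
    have h8 := mul_le_mul_of_nonneg_left hP.comparator_le hα0.le
    rw [h7] at h2
    change (st.alpha * G.paramR δ T = 2 ^ (st.k - 1)) at h5
    linarith
  · have h5 : st.alpha = 1 := le_antisymm (hadm T).alpha_le_one hge
    have h6 : G.paramR δ T ≤ 2 ^ (st.k - 1) := by
      have h7 := (hadm T).alpha_eq
      have h8 := min_le_left ((2 : ℝ) ^ (st.k - 1) / G.paramR δ T) 1
      rw [← h7, ← hst, h5, one_le_div (by linarith [hP.one_lt])] at h8
      exact h8
    have h7 : G.omdDiv δ T st.alpha μc G.uniformStrategy =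
        G.balKL μc G.uniformStrategy / G.paramTau T := by rw [omdDiv, if_neg (not_lt.2 hge)]
    have h8 := hP.bal_le μc hμc
    have h9 := sum_secondOrderBound_le hP hT
      (α := fun j => (G.paState δ T μc lo r w j).alpha) fun j => ((hadm j).alpha_pos hP').le
    have hR := hP.one_lt
    rw [h7] at h2
    rw [h5] at h1 h2 h4
    linarith

/-- Number of completed phases times `4R`, plus at most `2R` for the running one. -/
theorem estRegret_le (hG : G.IsTreePerfectRecall) (hA : 0 < A) (hB : 0 < B)
    (hP : G.TunedParams δ T μc) (hμc : μc ∈ G.TX) {w : ℕ → Traj H nS A B}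
    (ho : ∀ j < T, G.IsObservation (G.normObserve lo r (w j))) {μ : Fin nX → Fin A → ℝ}
    (hμ : μ ∈ G.TX) :
    G.estRegret δ T μc lo r w T μ ≤
      (1 + Real.log (G.paramR δ T) / Real.log 2) * (4 * G.paramR δ T) + 2 * G.paramR δ T +
        G.secondOrderSum δ T μc lo r w T := by
  have hP' := hP.toGoodParams
  obtain ⟨V, W, hb⟩ := exists_phaseBound hG hA hB hP' hμc ho
  have hadm := isAdmissible_paState (μc := μc) hG hA hB hP' lo r w T
  set st := G.paState δ T μc lo r w T with hst
  have hR := hP.one_lt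
  have hα0 := hadm.alpha_pos hP'
  have hα1 := hadm.alpha_le_one
  have h1 := hb.general μ hμ
  have h2 := mul_le_mul_of_nonneg_left (hb.omd μ hμ) hα0.le
  have h3 := mul_nonneg hα0.le (omdDiv_nonneg hG hA hB hP' (α := st.alpha) hμ hadm.muHat_pos)
  have h4 : G.omdDiv δ T st.alpha μ G.uniformStrategy ≤ G.paramR δ T := by
    unfold omdDiv
    split_ifs
    · exact hP.dil_le μ hμ
    · linarith [hP.bal_le μ hμ]
  have h5 := mul_le_mul_of_nonneg_left h4 hα0.le
  have h6 : (1 - st.alpha) * (pairing μc st.cum - pairing μ st.cum) ≤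
      (1 - st.alpha) * (2 * G.paramR δ T) := by
    rcases lt_or_ge st.alpha 1 with hlt | hge
    · exact mul_le_mul_of_nonneg_left (hb.test hlt μ hμ) (by linarith)
    · rw [le_antisymm hα1 hge]
      simp
  -- Logarithm of `2^(k-1) < 2R`.
  have h7 : (st.k : ℝ) - 1 ≤ 1 + Real.log (G.paramR δ T) / Real.log 2 := by
    have h8 := Real.log_le_log (by positivity) hadm.pow_lt.le
    rw [Real.log_pow, Real.log_mul two_ne_zero (by linarith), Nat.cast_sub hadm.one_le_k,
      Nat.cast_one] at h8
    have h9 := Real.log_pos one_lt_two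
    rw [show 1 + Real.log (G.paramR δ T) / Real.log 2 =
      (Real.log 2 + Real.log (G.paramR δ T)) / Real.log 2 by field_simp, le_div_iff₀ h9]
    exact h8
  have h8 := mul_le_mul_of_nonneg_right h7 (show 0 ≤ 4 * G.paramR δ T by linarith)
  nlinarith

end EFG

/-! ### Expected regret. -/

namespace EFG

variable {H nS nX nY A B : ℕ} {G : EFG H nS nX nY A B} {δ : ℝ} {T : ℕ}
  {μc : Fin nX → Fin A → ℝ} {lo r : ℝ}

section Play

variable {Ω : Type*} [mΩ : MeasurableSpace Ω] {P : Measure Ω}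
  {ℱ : Filtration ℕ mΩ}
  {ν : ℕ → Ω → Fin nY → Fin B → ℝ} {w : ℕ → Ω → Traj H nS A B}

theorem measurable_secondOrderTerm (hG : G.IsTreePerfectRecall) (hA : 0 < A) (hB : 0 < B)
    (hP : G.GoodParams δ T) (hplay : G.IsPlay P ℱ δ T μc lo r ν w) {t : ℕ} (ht : t ≤ T)
    (x : Fin nX) (a : Fin A) : Measurable[ℱ t] fun ω =>
      G.secondOrderTerm δ T μc (G.paState δ T μc lo r (fun j => w j ω) t) x a := by
  have hS := isMeasurable_paState hG hA hB hP hplay ht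
  have hp := measurable_paStrategy hG hA hB hP hplay ht x a
  unfold secondOrderTerm
  exact Measurable.ite (measurableSet_lt hS.alpha measurable_const)
    (hS.alpha.mul (((hS.muHat x a).div (hp.pow_const 2)).const_mul _))
    (hS.alpha.mul ((((hS.muHat x a).const_mul _).const_div _).const_mul _))

theorem measurable_secondOrderBound (hG : G.IsTreePerfectRecall) (hA : 0 < A) (hB : 0 < B)
    (hP : G.GoodParams δ T) (hplay : G.IsPlay P ℱ δ T μc lo r ν w) {t : ℕ} (ht : t ≤ T) :
    Measurable fun ω =>
      G.secondOrderBound δ T (G.paState δ T μc lo r (fun j => w j ω) t).alpha := by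
  have hS := (isMeasurable_paState hG hA hB hP hplay ht).alpha.mono (ℱ.le t) le_rfl
  unfold secondOrderBound
  exact Measurable.ite (measurableSet_lt hS measurable_const) (hS.mul_const _) measurable_const

variable [IsProbabilityMeasure P]

theorem integrable_secondOrderBound (hG : G.IsTreePerfectRecall) (hA : 0 < A) (hB : 0 < B)
    (hP : G.GoodParams δ T) (hδ : 0 < δ) (hplay : G.IsPlay P ℱ δ T μc lo r ν w) {t : ℕ}
    (ht : t ≤ T) : Integrable (fun ω =>
      G.secondOrderBound δ T (G.paState δ T μc lo r (fun j => w j ω) t).alpha) P := by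
  refine Integrable.of_bound (measurable_secondOrderBound hG hA hB hP hplay ht).aestronglyMeasurable
    (G.paramEta δ T * H ^ 3 / δ + G.paramTau T * H ^ 3 / 2)
    (Filter.Eventually.of_forall fun ω => ?_)
  have hadm := isAdmissible_paState (μc := μc) hG hA hB hP lo r (fun j => w j ω) t
  have h1 : 0 ≤ G.paramEta δ T * H ^ 3 / δ := by
    have := hP.eta_pos
    positivity
  have h2 : 0 ≤ G.paramTau T * H ^ 3 / 2 := by
    have := hP.tau_pos
    positivity
  unfold secondOrderBound
  split_ifs
  · rw [Real.norm_of_nonneg (mul_nonneg (hadm.alpha_pos hP).le h1)]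
    linarith [mul_le_of_le_one_left h1 hadm.alpha_le_one]
  · rw [Real.norm_of_nonneg h2]
    linarith

/-- The second-order term of a round is integrable, and its expectation is bounded. -/
theorem integral_secondOrder_le (hG : G.IsTreePerfectRecall) (hA : 0 < A) (hB : 0 < B)
    (hP : G.GoodParams δ T) (hδ : 0 < δ) (hμc : μc ∈ G.TX) (h : ∀ x a, δ ≤ μc x a)
    (hplay : G.IsPlay P ℱ δ T μc lo r ν w) {t : ℕ} (ht : t < T) :
    Integrable (fun ω => (G.paState δ T μc lo r (fun j => w j ω) t).alpha *
      G.secondOrder δ T μc (G.paState δ T μc lo r (fun j => w j ω) t)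
        (G.normObserve lo r (w t ω))) P ∧
    ∫ ω, (G.paState δ T μc lo r (fun j => w j ω) t).alpha *
      G.secondOrder δ T μc (G.paState δ T μc lo r (fun j => w j ω) t)
        (G.normObserve lo r (w t ω)) ∂P ≤
      ∫ ω, G.secondOrderBound δ T (G.paState δ T μc lo r (fun j => w j ω) t).alpha ∂P := by
  have hadm := fun ω => isAdmissible_paState (μc := μc) hG hA hB hP lo r (fun j => w j ω) t
  have hf0 := fun ω x a => secondOrderTerm_nonneg (μc := μc) hG hA hB hP (hadm ω) x a
  have hfm := measurable_secondOrderTerm hG hA hB hP hplay ht.le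
  have hpm := measurable_paStrategy hG hA hB hP hplay ht.le
  have hsum := fun ω => sum_secondOrderTerm_le hG hA hB hP hδ hμc h (hadm ω)
    (hplay.nu_mem t ht ω)
  have hbi := integrable_secondOrderBound hG hA hB hP hδ hplay ht.le
  have h0 : ∀ ω x a, 0 ≤
      G.secondOrderTerm δ T μc (G.paState δ T μc lo r (fun j => w j ω) t) x a *
      (G.paStrategy δ T μc lo r (fun j => w j ω) t x a * G.occ (ν t ω) x) := fun ω x a =>
    mul_nonneg (hf0 ω x a) (mul_nonneg ((hadm ω).play_pos hP hμc x a).le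
      (occ_nonneg (hplay.nu_mem t ht ω) x))
  have hi : ∀ x a, Integrable (fun ω =>
      G.secondOrderTerm δ T μc (G.paState δ T μc lo r (fun j => w j ω) t) x a *
      (G.paStrategy δ T μc lo r (fun j => w j ω) t x a * G.occ (ν t ω) x)) P := fun x a => by
    refine hbi.mono' (((hfm x a).mono (ℱ.le t) le_rfl).mul (((hpm x a).mono (ℱ.le t) le_rfl).mul
      (measurable_occ hplay ht x))).aestronglyMeasurable (Filter.Eventually.of_forall fun ω => ?_)
    rw [Real.norm_of_nonneg (h0 ω x a)]
    refine le_trans ?_ (hsum ω)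
    refine le_trans (Finset.single_le_sum (f := fun a =>
      G.secondOrderTerm δ T μc (G.paState δ T μc lo r (fun j => w j ω) t) x a *
      (G.paStrategy δ T μc lo r (fun j => w j ω) t x a * G.occ (ν t ω) x))
      (fun a _ => h0 ω x a) (Finset.mem_univ a)) ?_
    exact Finset.single_le_sum (f := fun x => ∑ a,
      G.secondOrderTerm δ T μc (G.paState δ T μc lo r (fun j => w j ω) t) x a *
      (G.paStrategy δ T μc lo r (fun j => w j ω) t x a * G.occ (ν t ω) x))
      (fun x _ => Finset.sum_nonneg fun a _ => h0 ω x a) (Finset.mem_univ x)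
  obtain ⟨h1, h2⟩ := integral_visitSum hG hA hB hP hμc hplay ht hfm hf0 hi
  simp_rw [alpha_mul_secondOrder]
  refine ⟨h1, h2.trans_le (integral_mono ?_ hbi hsum)⟩
  exact integrable_finsetSum _ fun x _ => integrable_finsetSum _ fun a _ => hi x a

/-- Follows from the bounded normalised pairings, not from any lower bound on the played strategy.
-/
theorem integrable_instRegret (hG : G.IsTreePerfectRecall) (hA : 0 < A) (hB : 0 < B)
    (hP : G.GoodParams δ T) (hμc : μc ∈ G.TX) (hplay : G.IsPlay P ℱ δ T μc lo r ν w)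
    (hr : 0 < r) (hcost : ∀ s a b, ∀ᵐ u ∂(G.cost s a b), u ∈ Set.Icc lo (lo + r)) {t : ℕ}
    (ht : t < T) {μ : Fin nX → Fin A → ℝ} (hμ : μ ∈ G.TX) : Integrable
      (fun ω => G.instRegret (G.paStrategy δ T μc lo r (fun j => w j ω) t) (ν t ω) μ) P := by
  have hpmem := fun ω => paStrategy_mem hG hA hB hP hμc lo r (fun j => w j ω) t
  have h1 := integrable_pairing_normCost hG hplay hr hcost ht
    (fun x a => (measurable_paStrategy hG hA hB hP hplay ht.le x a).mono (ℱ.le t) le_rfl) hpmem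
  have h2 := integrable_pairing_normCost hG hplay hr hcost ht
    (μ := fun _ => μ) (fun _ _ => measurable_const) fun _ => hμ
  have h3 : (fun ω => G.instRegret (G.paStrategy δ T μc lo r (fun j => w j ω) t) (ν t ω) μ) =
      fun ω => r * (pairing (G.paStrategy δ T μc lo r (fun j => w j ω) t)
        (G.normCost lo r (ν t ω)) - pairing μ (G.normCost lo r (ν t ω))) :=
    funext fun ω => instRegret_eq hG hr hμ (hpmem ω) (hplay.nu_mem t ht ω)
  rw [h3]
  exact (h1.sub h2).const_mul r

theorem integral_instRegret (hG : G.IsTreePerfectRecall) (hA : 0 < A) (hB : 0 < B)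
    (hP : G.GoodParams δ T) (hμc : μc ∈ G.TX) (hplay : G.IsPlay P ℱ δ T μc lo r ν w)
    (hr : 0 < r) (hcost : ∀ s a b, ∀ᵐ u ∂(G.cost s a b), u ∈ Set.Icc lo (lo + r)) {t : ℕ}
    (ht : t < T) {μ : Fin nX → Fin A → ℝ} (hμ : μ ∈ G.TX) :
    Integrable (fun ω => pairing
      (fun x a => G.paStrategy δ T μc lo r (fun j => w j ω) t x a - μ x a)
      (G.estimator (G.paStrategy δ T μc lo r (fun j => w j ω) t)
        (G.normObserve lo r (w t ω)))) P ∧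
    ∫ ω, G.instRegret (G.paStrategy δ T μc lo r (fun j => w j ω) t) (ν t ω) μ ∂P =
      r * ∫ ω, pairing (fun x a => G.paStrategy δ T μc lo r (fun j => w j ω) t x a - μ x a)
        (G.estimator (G.paStrategy δ T μc lo r (fun j => w j ω) t)
          (G.normObserve lo r (w t ω))) ∂P := by
  have hpmem := fun ω => paStrategy_mem hG hA hB hP hμc lo r (fun j => w j ω) t
  have hpm := measurable_paStrategy hG hA hB hP hplay ht.le
  obtain ⟨h1, h2⟩ := integral_pairing_estimator hG hA hB hP hμc hplay hr hcost ht hpm hpmem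
  obtain ⟨h3, h4⟩ := integral_pairing_estimator hG hA hB hP hμc hplay hr hcost ht
    (μ := fun _ => μ) (fun _ _ => measurable_const) fun _ => hμ
  simp_rw [pairing_sub_left]
  refine ⟨h1.sub h3, ?_⟩
  rw [integral_sub h1 h3, h2, h4, ← integral_sub, ← integral_const_mul]
  · exact integral_congr_ae (Filter.Eventually.of_forall fun ω =>
      instRegret_eq hG hr hμ (hpmem ω) (hplay.nu_mem t ht ω))
  · exact integrable_pairing_normCost hG hplay hr hcost ht
      (fun x a => (hpm x a).mono (ℱ.le t) le_rfl) hpmem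
  · exact integrable_pairing_normCost hG hplay hr hcost ht (fun _ _ => measurable_const) fun _ => hμ

/-- The regret is the expectation of the estimated regret. -/
theorem regret_eq (hG : G.IsTreePerfectRecall) (hA : 0 < A) (hB : 0 < B)
    (hP : G.GoodParams δ T) (hμc : μc ∈ G.TX) (hplay : G.IsPlay P ℱ δ T μc lo r ν w)
    (hr : 0 < r) (hcost : ∀ s a b, ∀ᵐ u ∂(G.cost s a b), u ∈ Set.Icc lo (lo + r))
    {μ : Fin nX → Fin A → ℝ} (hμ : μ ∈ G.TX) :
    Integrable (fun ω => G.estRegret δ T μc lo r (fun j => w j ω) T μ) P ∧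
    G.regret P δ T μc lo r ν w μ =
      r * ∫ ω, G.estRegret δ T μc lo r (fun j => w j ω) T μ ∂P := by
  have key := fun j (hj : j ∈ Finset.range T) => integral_instRegret hG hA hB hP hμc hplay hr hcost
    (Finset.mem_range.1 hj) hμ
  refine ⟨integrable_finsetSum _ fun j hj => (key j hj).1, ?_⟩
  unfold estRegret regret
  rw [integral_finsetSum _ fun j hj => (key j hj).1, Finset.mul_sum]
  exact Finset.sum_congr rfl fun j hj => (key j hj).2

theorem integral_secondOrderSum_le (hG : G.IsTreePerfectRecall) (hA : 0 < A) (hB : 0 < B)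
    (hP : G.GoodParams δ T) (hδ : 0 < δ) (hμc : μc ∈ G.TX) (h : ∀ x a, δ ≤ μc x a)
    (hplay : G.IsPlay P ℱ δ T μc lo r ν w) :
    Integrable (fun ω => G.secondOrderSum δ T μc lo r (fun j => w j ω) T) P ∧
    Integrable (fun ω => ∑ j ∈ Finset.range T,
      G.secondOrderBound δ T (G.paState δ T μc lo r (fun j => w j ω) j).alpha) P ∧
    ∫ ω, G.secondOrderSum δ T μc lo r (fun j => w j ω) T ∂P ≤ ∫ ω, ∑ j ∈ Finset.range T,
      G.secondOrderBound δ T (G.paState δ T μc lo r (fun j => w j ω) j).alpha ∂P := by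
  have key := fun j (hj : j ∈ Finset.range T) => integral_secondOrder_le hG hA hB hP hδ hμc h hplay
    (Finset.mem_range.1 hj)
  have hbi := fun j (hj : j ∈ Finset.range T) => integrable_secondOrderBound hG hA hB hP hδ hplay
    (Finset.mem_range.1 hj).le
  refine ⟨integrable_finsetSum _ fun j hj => (key j hj).1, integrable_finsetSum _ hbi, ?_⟩
  unfold secondOrderSum
  rw [integral_finsetSum _ fun j hj => (key j hj).1, integral_finsetSum _ hbi]
  exact Finset.sum_le_sum fun j hj => (key j hj).2

/-- Taking expectations in the pathwise bound removes the bracket, round by round. -/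
theorem regret_comparator_le (hG : G.IsTreePerfectRecall) (hA : 0 < A) (hB : 0 < B)
    (hP : G.TunedParams δ T μc) (hT : 0 < T) (hδ : 0 < δ) (hμc : μc ∈ G.TX)
    (h : ∀ x a, δ ≤ μc x a) (hplay : G.IsPlay P ℱ δ T μc lo r ν w)
    (hr : 0 < r) (hcost : ∀ s a b, ∀ᵐ u ∂(G.cost s a b), u ∈ Set.Icc lo (lo + r)) :
    G.regret P δ T μc lo r ν w μc ≤ r := by
  have hP' := hP.toGoodParams
  obtain ⟨h1, h2⟩ := regret_eq hG hA hB hP' hμc hplay hr hcost hμc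
  obtain ⟨h3, h4, h5⟩ := integral_secondOrderSum_le hG hA hB hP' hδ hμc h hplay
  rw [h2]
  refine mul_le_of_le_one_right hr.le ?_
  have ho : ∀ᵐ ω ∂P, ∀ j < T, G.IsObservation (G.normObserve lo r (w j ω)) :=
    ae_all_iff.2 fun j => by
      by_cases hj : j < T
      · filter_upwards [ae_isObservation hG hA hB hP' hplay hr hcost hj] with ω h _ using h
      · exact Filter.Eventually.of_forall fun _ h => absurd h hj
  have h6 := integral_mono_ae h1 ((integrable_const 1).add (h3.sub h4)) (by
    filter_upwards [ho] with ω ho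
    exact estRegret_comparator_le hG hA hB hP hT hδ hμc ho)
  refine h6.trans ?_
  rw [integral_add' (integrable_const 1) (h3.sub h4), integral_sub' h3 h4]
  simp only [integral_const, probReal_univ, smul_eq_mul, mul_one]
  linarith

theorem regret_le_mul (hG : G.IsTreePerfectRecall) (hA : 0 < A) (hB : 0 < B)
    (hP : G.TunedParams δ T μc) (hT : 0 < T) (hδ : 0 < δ) (hμc : μc ∈ G.TX)
    (h : ∀ x a, δ ≤ μc x a) (hplay : G.IsPlay P ℱ δ T μc lo r ν w)
    (hr : 0 < r) (hcost : ∀ s a b, ∀ᵐ u ∂(G.cost s a b), u ∈ Set.Icc lo (lo + r))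
    {μ : Fin nX → Fin A → ℝ} (hμ : μ ∈ G.TX) :
    G.regret P δ T μc lo r ν w μ ≤ r * ((1 + Real.log (G.paramR δ T) / Real.log 2) *
      (4 * G.paramR δ T) + 2 * G.paramR δ T + G.paramR δ T / 4) := by
  have hP' := hP.toGoodParams
  obtain ⟨h1, h2⟩ := regret_eq hG hA hB hP' hμc hplay hr hcost hμ
  obtain ⟨h3, h4, h5⟩ := integral_secondOrderSum_le hG hA hB hP' hδ hμc h hplay
  rw [h2]
  refine mul_le_mul_of_nonneg_left ?_ hr.le
  have ho : ∀ᵐ ω ∂P, ∀ j < T, G.IsObservation (G.normObserve lo r (w j ω)) :=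
    ae_all_iff.2 fun j => by
      by_cases hj : j < T
      · filter_upwards [ae_isObservation hG hA hB hP' hplay hr hcost hj] with ω h _ using h
      · exact Filter.Eventually.of_forall fun _ h => absurd h hj
  have h6 := integral_mono_ae h1 ((integrable_const _).add h3) (by
    filter_upwards [ho] with ω ho
    exact estRegret_le hG hA hB hP hμc ho hμ)
  have h7 := integral_mono h4 (integrable_const (G.paramR δ T / 4)) fun ω =>
    sum_secondOrderBound_le hP hT (α := fun j => (G.paState δ T μc lo r (fun j => w j ω) j).alpha)
      fun j => ((isAdmissible_paState hG hA hB hP' lo r _ j).alpha_pos hP').le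
  refine h6.trans ?_
  simp only [Pi.add_apply]
  rw [integral_add (integrable_const _) h3]
  simp only [integral_const, probReal_univ, smul_eq_mul, one_mul] at h7 ⊢
  linarith

end Play

/-- The bound for the regret, simplified. -/
theorem regret_bound_le (G : EFG H nS nX nY A B) (hA : 2 ≤ A) (hT : 0 < T) (hδ : 0 < δ)
    (hδA : δ ≤ 1 / A) (hR : 1 < G.paramR δ T) :
    (1 + Real.log (G.paramR δ T) / Real.log 2) * (4 * G.paramR δ T) + 2 * G.paramR δ T +
      G.paramR δ T / 4 ≤ 105 * Real.log (2 + nX * A * H * T / δ) ^ 2 *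
        (δ⁻¹ * √(nX * (H : ℝ) ^ 3 * T)) := by
  have hA2 : (2 : ℝ) ≤ A := by exact_mod_cast hA
  have hX1 : (1 : ℝ) ≤ nX := by exact_mod_cast G.nX_pos
  have hH1 : (1 : ℝ) ≤ H := by exact_mod_cast G.horizon_pos
  have hT1 : (1 : ℝ) ≤ T := by exact_mod_cast hT
  have hl := log_pos_of_two_le hA
  have hinv : (A : ℝ) ≤ δ⁻¹ := by
    rw [le_inv_comm₀ (by positivity) hδ]
    simpa using hδA
  obtain ⟨D, hD⟩ : ∃ D, D = δ⁻¹ := ⟨_, rfl⟩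
  rw [← hD] at hinv
  have hD0 : 0 < D := by linarith
  obtain ⟨N, hN⟩ : ∃ N : ℝ, N = nX * A * H * T / δ := ⟨_, rfl⟩
  have hN' : N = (nX * H * T) * (A * D) := by rw [hN, hD]; field_simp
  rw [← hN]
  have hXHT : (1 : ℝ) ≤ nX * H * T :=
    one_le_mul_of_one_le_of_one_le (one_le_mul_of_one_le_of_one_le hX1 hH1) hT1
  have hAD : A * D ≤ N := by
    rw [hN']
    exact le_mul_of_one_le_left (by positivity) hXHT
  have hAN : (A : ℝ) ≤ N := (le_mul_of_one_le_right (by positivity) (by linarith)).trans hAD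
  have hN4 : 4 ≤ N := by
    have := mul_le_mul hA2 (hA2.trans hinv) two_pos.le (by positivity)
    linarith
  obtain ⟨L, hL⟩ : ∃ L, L = Real.log (2 + N) := ⟨_, rfl⟩
  rw [← hL]
  have hL1 : 1 ≤ L := by
    rw [hL, Real.le_log_iff_exp_le (by linarith)]
    linarith [Real.exp_one_lt_d9]
  have hlA : Real.log A ≤ L := by
    rw [hL]
    exact Real.log_le_log (by positivity) (by linarith)
  have hRle : G.paramR δ T ≤ 3 * L * (D * √(nX * (H : ℝ) ^ 3 * T)) := by
    -- Uses `8 log A ≤ 9 L²`, since `log A ≤ L` and `1 ≤ L`.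
    have h1 : √(8 * nX * (H : ℝ) ^ 3 * Real.log A * T) ≤ 3 * L * √(nX * (H : ℝ) ^ 3 * T) := by
      rw [Real.sqrt_le_left (by positivity), mul_pow, Real.sq_sqrt (by positivity)]
      have h2 : 8 * Real.log A ≤ (3 * L) ^ 2 := by nlinarith
      calc _ = 8 * Real.log A * (nX * (H : ℝ) ^ 3 * T) := by ring
        _ ≤ _ := by gcongr
    rw [paramR, ← hD]
    calc D * √(8 * nX * (H : ℝ) ^ 3 * Real.log A * T) ≤ D * (3 * L * √(nX * (H : ℝ) ^ 3 * T)) := by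
          gcongr
      _ = _ := by ring
  have hlogR : Real.log (G.paramR δ T) ≤ 3 * L := by
    -- A crude polynomial bound on `R` suffices, as only its logarithm enters: `log R ≤ 3L`.
    have h1 : G.paramR δ T ^ 2 ≤ (2 + N) ^ 6 := by
      rw [paramR, ← hD, mul_pow, Real.sq_sqrt (by positivity)]
      have h2 : Real.log A ≤ A := (Real.log_le_sub_one_of_pos (by positivity)).trans (by linarith)
      have h3 : (1 : ℝ) ≤ (nX * T) ^ 2 :=
        one_le_pow₀ (one_le_mul_of_one_le_of_one_le hX1 hT1)
      have h4 : (1 : ℝ) ≤ A ^ 2 * D := one_le_mul_of_one_le_of_one_le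
        (one_le_pow₀ (by linarith)) (by linarith)
      calc D ^ 2 * (8 * nX * (H : ℝ) ^ 3 * Real.log A * T)
          ≤ D ^ 2 * (8 * nX * (H : ℝ) ^ 3 * A * T) := by gcongr
        _ = 2 ^ 3 * (D ^ 2 * nX * (H : ℝ) ^ 3 * A * T) * (1 * 1) := by ring
        _ ≤ N ^ 3 * (D ^ 2 * nX * (H : ℝ) ^ 3 * A * T) * ((nX * T) ^ 2 * (A ^ 2 * D)) := by
          gcongr
          linarith
        _ = N ^ 6 := by rw [hN']; ring
        _ ≤ _ := by gcongr; linarith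
    have h2 := Real.log_le_log (by positivity) h1
    rw [Real.log_pow, Real.log_pow, ← hL] at h2
    push_cast at h2
    linarith
  have hquot : Real.log (G.paramR δ T) / Real.log 2 ≤ 6 * L := by
    rw [div_le_iff₀ (Real.log_pos one_lt_two)]
    have := mul_le_mul_of_nonneg_left Real.log_two_gt_d9.le (show 0 ≤ 6 * L by linarith)
    linarith
  have hR0 : 0 ≤ G.paramR δ T := by linarith
  calc _ ≤ (1 + 6 * L) * (4 * G.paramR δ T) + 2 * G.paramR δ T + G.paramR δ T / 4 := by gcongr
    _ ≤ 35 * L * G.paramR δ T := by nlinarith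
    _ ≤ 35 * L * (3 * L * (D * √(nX * (H : ℝ) ^ 3 * T))) := by gcongr
    _ = _ := by rw [hD]; ring

/-! ### A single action -/

/-- If there is a single action, then there is a single strategy. -/
theorem eq_of_single_action {A : ℕ} [Subsingleton (Fin A)] {G : EFG H nS nX nY A B}
    (hG : G.IsTreePerfectRecall) {μ μ' : Fin nX → Fin A → ℝ} (hμ : μ ∈ G.TX) (hμ' : μ' ∈ G.TX) :
    μ = μ' := by
  have key : ∀ n x, (G.level x : ℕ) = n → ∑ a, μ x a = ∑ a, μ' x a := fun n => by
    induction n with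
    | zero => exact fun x hx => (hμ.2.1 x hx).trans (hμ'.2.1 x hx).symm
    | succ n ih =>
      intro x hx
      obtain ⟨x₀, a, h⟩ := (isGradedTree_childX hG).exists_parent (x' := x) (by omega)
      have h1 := ih x₀ (by have := level_childX hG h; omega)
      rw [Fintype.sum_subsingleton _ a, Fintype.sum_subsingleton _ a] at h1
      rw [hμ.2.2 _ _ _ h, hμ'.2.2 _ _ _ h, h1]
  funext x a
  have h := key _ x rfl
  rwa [Fintype.sum_subsingleton _ a, Fintype.sum_subsingleton _ a] at h

/-- If there is a single action, then the algorithm plays the comparator. -/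
theorem paStrategy_of_single_action {G : EFG H nS nX nY 1 B} (hG : G.IsTreePerfectRecall)
    {μc : Fin nX → Fin 1 → ℝ} (hμc : μc ∈ G.TX) (w : ℕ → Traj H nS 1 B) (t : ℕ) :
    G.paStrategy δ T μc lo r w t = μc := by
  -- Here `log A = 0`, so `R = 0` and `α = 1/0 = 0` by convention. The test cannot fire because
  -- there is only one strategy.
  have hR : G.paramR δ T = 0 := by simp [paramR]
  have hα : (G.paState δ T μc lo r w t).alpha = 0 := by
    induction t with
    | zero => simp [paState, paInit, hR]
    | succ t ih =>
      rw [paState_succ, paStep, if_neg, ih]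
      rintro ⟨⟨μ, hμ, h⟩, -⟩
      rw [eq_of_single_action hG hμ hμc, hR] at h
      simp [pairing_zero_right] at h
  funext x a
  simp [paStrategy, PAState.play, hα]

theorem instRegret_self (μ : Fin nX → Fin A → ℝ) (ν : Fin nY → Fin B → ℝ) :
    G.instRegret μ ν μ = 0 := by
  simp [instRegret, pairing]

theorem pos_of_mem_TY {ν : Fin nY → Fin B → ℝ} (hG : G.IsTreePerfectRecall) (hν : ν ∈ G.TY) :
    0 < B := by
  obtain ⟨s, hs⟩ := G.exists_stage_zero
  rcases Nat.eq_zero_or_pos B with rfl | h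
  · have h1 : G.levelY (G.y s) = G.stage s :=
      hG.y_stage _ _ (Function.surjInv_eq G.y_surj _)
    have h2 := hν.2.1 (G.y s) ((congrArg Fin.val h1).trans hs)
    simp at h2
  · exact h

end EFG

/-! ### The theorem. -/

theorem theorem3 :
    ∃ (C : ℝ) (d : ℕ), 0 < C ∧
      ∀ (H nS nX nY A B : ℕ) (G : EFG H nS nX nY A B), G.IsTreePerfectRecall →
      ∀ (δ : ℝ), 0 < δ → δ ≤ 1 / (A : ℝ) →
      ∀ (μc : Fin nX → Fin A → ℝ), μc ∈ G.TX → (∀ x a, δ ≤ μc x a) →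
      ∀ (lo r : ℝ), 0 < r →
        (∀ s a b, ∀ᵐ u ∂(G.cost s a b), u ∈ Set.Icc lo (lo + r)) →
      ∀ (T : ℕ) (Ω : Type*) (mΩ : MeasurableSpace Ω) (P : Measure Ω) (_ : IsProbabilityMeasure P)
        (ℱ : Filtration ℕ mΩ) (ν : ℕ → Ω → Fin nY → Fin B → ℝ) (w : ℕ → Ω → Traj H nS A B),
        G.IsPlay P ℱ δ T μc lo r ν w →
        (∀ t < T, ∀ μ ∈ G.TX, Integrable
          (fun ω => G.instRegret (G.paStrategy δ T μc lo r (fun j => w j ω) t) (ν t ω) μ) P) ∧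
        G.regret P δ T μc lo r ν w μc ≤ r ∧
        ∀ μ ∈ G.TX, G.regret P δ T μc lo r ν w μ ≤
          r * (C * Real.log (2 + nX * A * H * T / δ) ^ d *
            (δ⁻¹ * √(nX * (H : ℝ) ^ 3 * T))) := by
  -- `105 = 35 · 3`: at most `35 L R` from the phases, and `R ≤ 3 L δ⁻¹ √(X H³ T)`; one power of `L`
  -- comes from each.
  refine ⟨105, 2, by norm_num, fun H nS nX nY A B G hG δ hδ hδA μc hμc h lo r hr hcost T Ω mΩ P hP
    ℱ ν w hplay => ?_⟩
  have hrhs : 0 ≤ r * (105 * Real.log (2 + nX * A * H * T / δ) ^ 2 *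
      (δ⁻¹ * √(nX * (H : ℝ) ^ 3 * T))) := by positivity
  rcases Nat.eq_zero_or_pos T with rfl | hT
  · refine ⟨fun t ht => absurd ht (Nat.not_lt_zero t), ?_, fun μ _ => ?_⟩
    · simpa [EFG.regret] using hr.le
    · simp [EFG.regret]
  have hA0 : A ≠ 0 := by
    rintro rfl
    simp only [Nat.cast_zero, div_zero] at hδA
    linarith
  -- Bob's strategy in round `0` must sum to one at a root, so he has an action.
  have hB : 0 < B := by
    obtain ⟨ω⟩ := nonempty_of_isProbabilityMeasure P
    exact EFG.pos_of_mem_TY hG (hplay.nu_mem 0 hT ω)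
  rcases Nat.lt_or_ge A 2 with hA | hA
  · obtain rfl : A = 1 := by omega
    have h0 : ∀ t, ∀ μ ∈ G.TX, ∀ ω,
        G.instRegret (G.paStrategy δ T μc lo r (fun j => w j ω) t) (ν t ω) μ = 0 :=
      fun t μ hμ ω => by
        rw [EFG.paStrategy_of_single_action hG hμc, EFG.eq_of_single_action hG hμ hμc,
          EFG.instRegret_self]
    have h1 : ∀ μ ∈ G.TX, G.regret P δ T μc lo r ν w μ = 0 := fun μ hμ => by
      simp [EFG.regret, h0 _ μ hμ]
    refine ⟨fun t _ μ hμ => ?_, (h1 μc hμc).trans_le hr.le, fun μ hμ => (h1 μ hμ).trans_le hrhs⟩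
    simp [h0 t μ hμ]
  · have hA' : 0 < A := by omega
    have hP := EFG.tunedParams hG hA hB hT hδ hδA hμc h
    have hP' := hP.toGoodParams
    refine ⟨fun t ht μ hμ => EFG.integrable_instRegret hG hA' hB hP' hμc hplay hr hcost ht hμ,
      EFG.regret_comparator_le hG hA' hB hP hT hδ hμc h hplay hr hcost, fun μ hμ => ?_⟩
    exact (EFG.regret_le_mul hG hA' hB hP hT hδ hμc h hplay hr hcost hμ).trans
      (mul_le_mul_of_nonneg_left (EFG.regret_bound_le G hA hT hδ hδA hP'.one_lt) hr.le)
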